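/- Let $0<q<1$ and let $m\ge 3$ be an integer. Write $[u]_q=\frac{q^u-1}{q-1}$, $[k]_q!=[k]_q\cdots[1]_q$, $(u;q)_k=\prod_{i=0}^{k-1}(1-uq^i)$, $\mu=1+q^{2-m}$, and for $t>0$ let $\Gamma_q(t)=\frac{(q;q)_\infty}{(q^t;q)_\infty}(1-q)^{1-t}$ be the $q$-Gamma function. For $1\le i\le m$ put $i'=m+1-i$, and let $\rho_i=\frac m2-i$ if $i<i'$, $\rho_i=0$ if $i=i'$, $\rho_i=-\rho_{i'}$ if $i>i'$. Let $C_{ij}=C^{ij}=q^{-\rho_i}\delta_{ij'}$ be the metric and $\hat R$ the braid matrix of the quantum orthogonal group $O_q(m)$, $$\hat R=q\sum_{i\ne i'}e^i_i\otimes e^i_i+\sum_{i\neq j,j'\text{ or }i=j=i'}e^j_i\otimes e^i_j+q^{-1}\sum_{i\ne i'}e^{i'}_i\otimes e^i_{i'}+(q-q^{-1})\Big(\sum_{i<j}e^i_i\otimes e^j_j-\sum_{i<j}q^{\rho_j-\rho_i}e^{j'}_i\otimes e^{j}_{i'}\Big),$$ where $e^a_b$ is the matrix unit in row $a$ and column $b$,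 and $\hat R^{ij}_{kl}$ denotes the entry in row $(i,j)$ and column $(k,l)$. Let $\mathcal P_A$ be its spectral projection for the eigenvalue $-q^{-1}$. Summation over repeated indices is understood. Let $\mathcal P$ be the complex algebra generated by $x^1,\dots,x^m$ with relations $(\mathcal P_A)^{ij}_{kl}x^kx^l=0$ (polynomials on quantum Euclidean space $\mathbb R^m_q$), $\mathcal P_k$ its homogeneous part of degree $k$, and $\mathbf x^2=x^iC_{ij}x^j$. (a) There is a unique family of linear operators $\partial^1,\dots,\partial^m$ on $\mathcal P$ with $\partial^i1=0$ and $\partial^i(x^jf)=C^{ij}f+q(\hat R^{-1})^{ij}_{kl}x^k\,\partial^l f$ for all $f\in\mathcal P$. Let $\Delta=\partial^iC_{ij}\partial^j$, let $\mathcal S_k=\mathcal P_k\cap\ker\Delta$ be the spherical harmonics of degree $k$, and let the quantum sphere integral be $$\int_{\mathbb S^{m-1}_q}R=\sum_{k\ge0}\frac{2\,\Gamma_{q^2}(\frac12)^m}{\mu^{2k}\,[k]_{q^2}!\,\Gamma_{q^2}(k+\frac m2)}\,(\Delta^kR)(0),\qquad R\in\mathcal P .$$ (b) Let $\mathbf y$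 be a copy of the coordinates $\mathbf x$; polynomials in $\mathbf x$ and $\mathbf y$, written with all $\mathbf x$ to the left of all $\mathbf y$, are the elements of $\mathcal P\otimes\mathcal P$. There is a unique family $\langle\mathbf x|\mathbf y\rangle^{(l)}\in\mathcal P_l\otimes\mathcal P_l$, $l\ge0$, with $\langle\mathbf x|\mathbf y\rangle^{(0)}=1$ and $\partial_x^j\langle\mathbf x|\mathbf y\rangle^{(l)}=[l]_q\,\langle\mathbf x|\mathbf y\rangle^{(l-1)}y^j$ for all $l\ge1$ and all $j$. Let $C_n^\lambda(q;t)=\sum_{j=0}^{\lfloor n/2\rfloor}\frac{(-1)^jq^{j(j-1)}}{[j]_{q^2}!\,[n-2j]_q!}\frac{(q^{2\lambda};q^2)_{n-j}}{(1-q^2)^{n-j}}((1+q)t)^{n-2j}$ be the $q$-Gegenbauer polynomials, let $c_j^{n,\lambda}$ be given by $C_n^\lambda\big(q;\frac{\mu}{1+q}t\big)=\sum_{j=0}^{\lfloor n/2\rfloor} c_j^{n,\lambda}t^{n-2j}$, let $C_n=\frac{[\frac m2+n-1]_{q^2}\,\Gamma_{q^2}(\frac m2-1)}{2\,\Gamma_{q^2}(\frac12)^m}$,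 and $$F_n(\mathbf x|\mathbf y)=C_n\sum_{j=0}^{\lfloor n/2\rfloor}c_j^{n,\frac m2-1}\,\mathbf x^{2j}\,\langle\mathbf x|\mathbf y\rangle^{(n-2j)}\,\mathbf y^{2j}.$$ **Theorem.** Statements (a) and (b) hold, and for all $n,k\ge0$ and all $S_k\in\mathcal S_k$, $$\int_{\mathbb S^{m-1}_q,\,\mathbf x}S_k(\mathbf x)\,F_n(\mathbf x|\mathbf y)=\delta_{kn}\,S_k(\mathbf y).$$ Moreover $F_k$ is the reproducing kernel of the spherical harmonics of degree $k$: $F_k\in\mathcal S_k\otimes\mathcal S_k$, and it is the only element $T$ of $\mathcal S_k\otimes\mathcal S_k$ with $\int_{\mathbb S^{m-1}_q,\,\mathbf x}S(\mathbf x)\,T(\mathbf x|\mathbf y)=S(\mathbf y)$ for all $S\in\mathcal S_k$. -/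

import Mathlib

open scoped TensorProduct

/-! ### `q`-calculus -/

/-- The `q`-number `[u]_q = (q^u - 1) / (q - 1)`. -/
noncomputable def qNumber (q u : ℝ) : ℝ := (q ^ u - 1) / (q - 1)

/-- The `q`-factorial `[k]_q! = [k]_q ⋯ [1]_q`. -/
noncomputable def qFactorial (q : ℝ) (k : ℕ) : ℝ :=
  ∏ i ∈ Finset.range k, qNumber q ((i : ℝ) + 1)

/-- The finite shifted factorial `(u; q)_k = (1 - u) (1 - q u) ⋯ (1 - q^(k-1) u)`. -/
noncomputable def qShifted (u q : ℝ) (k : ℕ) : ℝ :=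
  ∏ i ∈ Finset.range k, (1 - u * q ^ i)

/-- The infinite shifted factorial `(u; q)_∞`, for `0 < q < 1`. -/
noncomputable def qShiftedInf (u q : ℝ) : ℝ := ∏' i : ℕ, (1 - u * q ^ i)

/-- The `q`-Gamma function `Γ_q(t) = (q; q)_∞ / (q^t; q)_∞ * (1 - q)^(1 - t)`,
for `0 < q < 1` and `t > 0`. -/
noncomputable def qGamma (q t : ℝ) : ℝ :=
  qShiftedInf q q / qShiftedInf (q ^ t) q * (1 - q) ^ (1 - t)

/-- The `q`-Gegenbauer polynomial
`C_n^λ(q; t) = ∑_j (-1)^j q^(j(j-1)) / ([j]_{q²}! [n-2j]_q!)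
  * (q^(2λ); q²)_{n-j} / (1-q²)^(n-j) * ((1+q) t)^(n-2j)`. -/
noncomputable def qGegenbauer (q lam : ℝ) (n : ℕ) : Polynomial ℝ :=
  ∑ j ∈ Finset.range (n / 2 + 1),
    Polynomial.C ((-1) ^ j * q ^ (j * (j - 1)) / (qFactorial (q ^ 2) j * qFactorial q (n - 2 * j))
        * (qShifted (q ^ (2 * lam)) (q ^ 2) (n - j) / (1 - q ^ 2) ^ (n - j)))
      * (Polynomial.C (1 + q) * Polynomial.X) ^ (n - 2 * j)

/-! ### The braid matrix of `O_q(m)`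

Indices run over `Fin m`, and `i' = Fin.rev i`. -/

/-- `ρ = (m/2 - 1, m/2 - 2, …, 1 - m/2)`, in decreasing order, where for odd `m` the middle
entry is `0` between `1/2` and `-1/2`, and for even `m` the entry `0` occurs twice. -/
noncomputable def rhoVec (m : ℕ) (i : Fin m) : ℝ :=
  if i < i.rev then (m : ℝ) / 2 - 1 - (i : ℝ)
  else if i.rev < i then -((m : ℝ) / 2 - 1 - (i.rev : ℝ))
  else 0

/-- The metric `C_{ij} = C^{ij} = q^(-ρ_i) δ_{i j'}`. -/
noncomputable def qMetric (q : ℝ) (m : ℕ) (i j : Fin m) : ℝ :=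
  if j = i.rev then q ^ (-rhoVec m i) else 0

/-- The braid matrix `R̂^{ij}_{kl}` of `O_q(m)`, with row index `(i, j)` and column index
`(k, l)`:
`R̂ = ∑_{i ≠ i'} q e^i_i ⊗ e^i_i + ∑_{i ≠ j, j' or i = j = i'} e^j_i ⊗ e^i_j`
`  + ∑_{i ≠ i'} q⁻¹ e^{i'}_i ⊗ e^i_{i'}`
`  + (q - q⁻¹) (∑_{i < j} e^i_i ⊗ e^j_j - ∑_{i < j} q^(ρ_j - ρ_i) e^{j'}_i ⊗ e^j_{i'})`. -/
noncomputable def braidMatrix (q : ℝ) (m : ℕ) : Matrix (Fin m × Fin m) (Fin m × Fin m) ℝ :=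
  fun a b =>
    (if b = (a.2, a.1) then
        (if a.1 = a.2 ∧ a.1 ≠ a.1.rev then q
          else if a.2 = a.1.rev ∧ a.1 ≠ a.2 then q⁻¹
          else 1)
      else 0)
    + (q - q⁻¹) *
      ((if b = a ∧ a.1 < a.2 then 1 else 0)
        - (if a.1 = a.2.rev ∧ b.2 = b.1.rev ∧ b.1 < a.2
            then q ^ (rhoVec m a.2 - rhoVec m b.1) else 0))

/-- The projection operator `𝒫_A` in `R̂ = q 𝒫_S - q⁻¹ 𝒫_A + q^(1-m) 𝒫_1`, i.e. the spectral
projection of `R̂` for the eigenvalue `-q⁻¹`. -/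
noncomputable def antisymProj (q : ℝ) (m : ℕ) : Matrix (Fin m × Fin m) (Fin m × Fin m) ℝ :=
  ((q + q⁻¹) * (q⁻¹ + q ^ (1 - (m : ℤ))))⁻¹ •
    ((braidMatrix q m - q • (1 : Matrix (Fin m × Fin m) (Fin m × Fin m) ℝ)) *
      (braidMatrix q m - q ^ (1 - (m : ℤ)) • (1 : Matrix (Fin m × Fin m) (Fin m × Fin m) ℝ)))

/-! ### Polynomials on quantum Euclidean space -/

/-- The commutation relations `(𝒫_A)^{ij}_{kl} x^k x^l = 0`. -/
def QEuclidRel (q : ℝ) (m : ℕ) (a b : FreeAlgebra ℂ (Fin m)) : Prop :=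
  ∃ i j : Fin m,
    a = ∑ k, ∑ l, ((antisymProj q m (i, j) (k, l) : ℝ) : ℂ) •
          (FreeAlgebra.ι ℂ k * FreeAlgebra.ι ℂ l) ∧ b = 0

/-- The algebra `𝒫` of polynomials on the quantum Euclidean space `ℝ^m_q`. -/
abbrev QPoly (q : ℝ) (m : ℕ) : Type := RingQuot (QEuclidRel q m)

/-- The coordinate `x^i`. -/
noncomputable def qCoord (q : ℝ) (m : ℕ) (i : Fin m) : QPoly q m :=
  RingQuot.mkAlgHom ℂ (QEuclidRel q m) (FreeAlgebra.ι ℂ i)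

/-- The evaluation `f ↦ f(0)`. -/
noncomputable def evalZero (q : ℝ) (m : ℕ) : QPoly q m →ₐ[ℂ] ℂ :=
  RingQuot.liftAlgHom ℂ ⟨FreeAlgebra.lift ℂ (fun _ : Fin m => (0 : ℂ)), by
    rintro a b ⟨i, j, rfl, rfl⟩
    simp only [map_sum, map_smul, map_mul, FreeAlgebra.lift_ι_apply, mul_zero, smul_zero,
      Finset.sum_const_zero, map_zero]⟩

/-- The generalized norm squared `x² = x^i C_{ij} x^j`. -/
noncomputable def normSqElt (q : ℝ) (m : ℕ) : QPoly q m :=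
  ∑ i, ∑ j, ((qMetric q m i j : ℝ) : ℂ) • (qCoord q m i * qCoord q m j)

/-- The homogeneous polynomials `𝒫_k` of degree `k`, spanned by the products of `k`
coordinates. -/
noncomputable def homogPoly (q : ℝ) (m k : ℕ) : Submodule ℂ (QPoly q m) :=
  (Submodule.span ℂ (Set.range (qCoord q m))) ^ k

/-- The action of the partial derivatives on polynomials: linear operators with `∂^i 1 = 0` and
`∂^i x^j = C^{ij} + q (R̂⁻¹)^{ij}_{kl} x^k ∂^l`. -/
def IsPartials (q : ℝ) (m : ℕ) (d : Fin m → (QPoly q m →ₗ[ℂ] QPoly q m)) : Prop :=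
  (∀ i, d i 1 = 0) ∧
  ∀ (i j : Fin m) (f : QPoly q m),
    d i (qCoord q m j * f) =
      ((qMetric q m i j : ℝ) : ℂ) • f +
        ∑ k, ∑ l, ((q * (braidMatrix q m)⁻¹ (i, j) (k, l) : ℝ) : ℂ) • (qCoord q m k * d l f)

/-- The partial derivatives `∂^i`: the unique family of operators with the property
`IsPartials`. -/
noncomputable def qPartial (q : ℝ) (m : ℕ) : Fin m → (QPoly q m →ₗ[ℂ] QPoly q m) :=
  Classical.epsilon (IsPartials q m)

/-- The Laplace operator `Δ = ∂^i C_{ij} ∂^j`. -/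
noncomputable def qLaplace (q : ℝ) (m : ℕ) : Module.End ℂ (QPoly q m) :=
  ∑ i, ∑ j, ((qMetric q m i j : ℝ) : ℂ) • (qPartial q m i ∘ₗ qPartial q m j)

/-- The spherical harmonics `𝒮_k = 𝒫_k ∩ ker Δ` of degree `k`. -/
noncomputable def sphHarmonics (q : ℝ) (m k : ℕ) : Submodule ℂ (QPoly q m) :=
  homogPoly q m k ⊓ LinearMap.ker (qLaplace q m)

/-- `μ = 1 + q^(2-m)`. -/
noncomputable def muConst (q : ℝ) (m : ℕ) : ℝ := 1 + q ^ (2 - (m : ℤ))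

/-! ### Polynomials in two sets of variables

A polynomial in `x` and `y`, written with all the `x` to the left of all the `y`, is an element
of `𝒫 ⊗ 𝒫`. Multiplication by a polynomial in `x` on the left and by a polynomial in `y` on the
right do not need the commutation relations between `x` and `y`. -/

/-- `T(x, y) ↦ a(x) T(x, y) b(y)`. -/
noncomputable def sandwich (q : ℝ) (m : ℕ) (a b : QPoly q m) :
    QPoly q m ⊗[ℂ] QPoly q m →ₗ[ℂ] QPoly q m ⊗[ℂ] QPoly q m :=
  TensorProduct.map (LinearMap.mulLeft ℂ a) (LinearMap.mulRight ℂ b)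

/-- The integral over the quantum sphere with respect to `x`, by the Pizzetti formula
`∫ R = ∑_k 2 Γ_{q²}(1/2)^m / (μ^(2k) [k]_{q²}! Γ_{q²}(k + m/2)) (Δ^k R)(0)`;
the variables `y` are to the right and are not affected. All but finitely many terms vanish. -/
noncomputable def sphereIntegralX (q : ℝ) (m : ℕ) (T : QPoly q m ⊗[ℂ] QPoly q m) : QPoly q m :=
  ∑ᶠ k : ℕ,
    ((2 * qGamma (q ^ 2) (1 / 2) ^ m /
        (muConst q m ^ (2 * k) * qFactorial (q ^ 2) k
          * qGamma (q ^ 2) ((k : ℝ) + (m : ℝ) / 2)) : ℝ) : ℂ) •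
      TensorProduct.lid ℂ (QPoly q m)
        (TensorProduct.map ((evalZero q m).toLinearMap ∘ₗ (qLaplace q m ^ k)) LinearMap.id T)

/-- The generalized powers `⟨x|y⟩^(l)` of the inner product: `⟨x|y⟩^(0) = 1`, `⟨x|y⟩^(l)` is
homogeneous of degree `l` in `x` and in `y`, and `∂_x^j ⟨x|y⟩^(l) = [l]_q ⟨x|y⟩^(l-1) y^j`. -/
def IsGenPower (q : ℝ) (m : ℕ) (G : ℕ → QPoly q m ⊗[ℂ] QPoly q m) : Prop :=
  G 0 = 1 ⊗ₜ[ℂ] 1 ∧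
  (∀ l, G l ∈ LinearMap.range (TensorProduct.mapIncl (homogPoly q m l) (homogPoly q m l))) ∧
  ∀ (l : ℕ) (j : Fin m),
    TensorProduct.map (qPartial q m j) LinearMap.id (G (l + 1)) =
      ((qNumber q ((l : ℝ) + 1) : ℝ) : ℂ) • sandwich q m 1 (qCoord q m j) (G l)

/-- The generalized powers `⟨x|y⟩^(l)`: the unique family with the property `IsGenPower`. -/
noncomputable def genPower (q : ℝ) (m : ℕ) : ℕ → QPoly q m ⊗[ℂ] QPoly q m :=
  Classical.epsilon (IsGenPower q m)

/-- The coefficients `c_j^{n,λ}` in `C_n^λ(q; μ t / (1 + q)) = ∑_j c_j^{n,λ} t^(n-2j)`. -/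
noncomputable def gegCoeff (q : ℝ) (m n : ℕ) (lam : ℝ) (j : ℕ) : ℝ :=
  ((qGegenbauer q lam n).comp
    (Polynomial.C (muConst q m / (1 + q)) * Polynomial.X)).coeff (n - 2 * j)

/-- `C_n = [m/2 + n - 1]_{q²} Γ_{q²}(m/2 - 1) / (2 Γ_{q²}(1/2)^m)`. -/
noncomputable def kernelConst (q : ℝ) (m n : ℕ) : ℝ :=
  qNumber (q ^ 2) ((m : ℝ) / 2 + n - 1) * qGamma (q ^ 2) ((m : ℝ) / 2 - 1) /
    (2 * qGamma (q ^ 2) (1 / 2) ^ m)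

/-- `F_n(x|y) = C_n ∑_{j ≤ n/2} c_j^{n, m/2-1} x^{2j} ⟨x|y⟩^(n-2j) y^{2j}`. -/
noncomputable def kernelF (q : ℝ) (m n : ℕ) : QPoly q m ⊗[ℂ] QPoly q m :=
  ((kernelConst q m n : ℝ) : ℂ) •
    ∑ j ∈ Finset.range (n / 2 + 1),
      ((gegCoeff q m n ((m : ℝ) / 2 - 1) j : ℝ) : ℂ) •
        sandwich q m (normSqElt q m ^ j) (normSqElt q m ^ j) (genPower q m (n - 2 * j))

set_option linter.unusedSimpArgs false

/-! Let ⟨h, f⟩ = (h(∂) f)(0) be the pairing `diffPairing`. The theorem rests on two facts: on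
spherical harmonics the sphere integral is a multiple of this pairing, and the kernel is, up to a
constant, the tensor dual to it.

For S in 𝒮_k and harmonic f, (Δ^b (S f))(0) vanishes unless b = k, and for b = k it is μ^k [k]_{q²}!
⟨S, f⟩ (`evalZero_qLaplace_pow_mul`). Hence a single term of the Pizzetti series survives
(`sphereIntegralX_sandwich`), and different degrees are orthogonal. The generalized power of degree
l is [l]_q! times the canonical tensor of the pairing on 𝒫_l (`contractL_genPower`). A harmonic S
annihilates all multiples of x² (`diffPairing_normSqElt_mul`), so only the term j = 0 of F_k pairs
nontrivially with S, and the functional equation of Γ_{q²} makes the product of all constants equal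
to 1 (`pizzettiCoeff_mul_kernelConst`). That F_n is harmonic in x, which this argument needs, holds
because consecutive Gegenbauer coefficients satisfy a recurrence that makes ΔF_n telescope
(`qLaplace_contractR_kernelF`). Harmonicity in y is not computed: reproduction forces the pairing to
be nondegenerate on 𝒮_k, so a dual tensor in 𝒮_k ⊗ 𝒮_k exists, and it must coincide with F_k
(`mem_and_unique_of_reproducing`).

The calculus behind this comes from the braid matrix R and the metric, seen as a crossing and a cup
or cap. They satisfy the relations of the Birman–Murakami–Wenzl algebra: R - R⁻¹ = (q - q⁻¹)(1 - K)
with K = C^{ij} C_{kl}, sliding of strands past cups and caps (`slide_vec`, `slide_tr`), and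
`braid_relation`. All are proved by induction from m to m + 2, by splitting off the first and the
last index. They yield the existence of the ∂^i, the relations among them, and the commutation rules
of Δ, x² and the Euler operator. Families take values in an arbitrary module, so the same identities
serve coordinates, derivatives and slices of larger families. -/

namespace QEuclid

variable {M : Type*} [AddCommGroup M] [Module ℂ M] {q : ℝ} {m n : ℕ}

/-! ### Matrices acting on two-index families; the metric and the entries of the braid matrix -/

/-- The action of a matrix on two-index families of vectors. -/
noncomputable def matOp (A : Matrix (Fin m × Fin m) (Fin m × Fin m) ℝ) :
    (Fin m → Fin m → M) →ₗ[ℂ] (Fin m → Fin m → M) where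
  toFun w := fun i j => ∑ k, ∑ l, ((A (i, j) (k, l) : ℝ) : ℂ) • w k l
  map_add' w v := by
    funext i j
    simp [Finset.sum_add_distrib]
  map_smul' a w := by
    funext i j
    simp only [Pi.smul_apply, Finset.smul_sum, RingHom.id_apply]
    refine Finset.sum_congr rfl fun k _ => Finset.sum_congr rfl fun l _ => smul_comm _ _ _

theorem matOp_apply (A : Matrix (Fin m × Fin m) (Fin m × Fin m) ℝ) (w : Fin m → Fin m → M)
    (i j : Fin m) :
    matOp A w i j = ∑ k, ∑ l, ((A (i, j) (k, l) : ℝ) : ℂ) • w k l := rfl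

theorem matOp_sub (A A' : Matrix (Fin m × Fin m) (Fin m × Fin m) ℝ) (w : Fin m → Fin m → M) :
    matOp (A - A') w = matOp A w - matOp A' w := by
  funext i j
  simp [matOp_apply, sub_smul, Finset.sum_sub_distrib]

theorem matOp_smul (a : ℝ) (A : Matrix (Fin m × Fin m) (Fin m × Fin m) ℝ)
    (w : Fin m → Fin m → M) :
    matOp (a • A) w = (a : ℂ) • matOp A w := by
  funext i j
  simp [matOp_apply, mul_smul, Finset.smul_sum]

theorem matOp_one (w : Fin m → Fin m → M) :
    matOp (1 : Matrix (Fin m × Fin m) (Fin m × Fin m) ℝ) w = w := by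
  funext i j
  rw [matOp_apply, ← Fintype.sum_prod_type' (f := fun k l =>
    (((1 : Matrix (Fin m × Fin m) (Fin m × Fin m) ℝ) (i, j) (k, l) : ℝ) : ℂ) • w k l)]
  rw [Finset.sum_eq_single (i, j)]
  · simp
  · rintro b - hb
    rw [Matrix.one_apply_ne (Ne.symm hb)]
    simp
  · simp

theorem matOp_mul (A A' : Matrix (Fin m × Fin m) (Fin m × Fin m) ℝ) (w : Fin m → Fin m → M) :
    matOp (A * A') w = matOp A (matOp A' w) := by
  funext i j
  simp only [matOp_apply, Matrix.mul_apply, Fintype.sum_prod_type, Complex.ofReal_sum,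
    Complex.ofReal_mul, Finset.sum_smul, Finset.smul_sum, mul_smul]
  calc _ = ∑ k, ∑ x, ∑ l, ∑ y, ((A (i, j) (x, y) : ℝ) : ℂ) • ((A' (x, y) (k, l) : ℝ) : ℂ) • w k l :=
        Finset.sum_congr rfl fun k _ => Finset.sum_comm
    _ = ∑ x, ∑ k, ∑ l, ∑ y, ((A (i, j) (x, y) : ℝ) : ℂ) • ((A' (x, y) (k, l) : ℝ) : ℂ) • w k l :=
        Finset.sum_comm
    _ = ∑ x, ∑ k, ∑ y, ∑ l, ((A (i, j) (x, y) : ℝ) : ℂ) • ((A' (x, y) (k, l) : ℝ) : ℂ) • w k l :=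
        Finset.sum_congr rfl fun x _ => Finset.sum_congr rfl fun k _ => Finset.sum_comm
    _ = _ := Finset.sum_congr rfl fun x _ => Finset.sum_comm

/-- Identities proved for operators return to matrices by testing on scalar families concentrated at
one index pair. -/
theorem matOp_injective {A A' : Matrix (Fin m × Fin m) (Fin m × Fin m) ℝ}
    (h : ∀ w : Fin m → Fin m → ℂ, matOp A w = matOp A' w) : A = A' := by
  ext ⟨i, j⟩ ⟨k, l⟩
  have := congrFun (congrFun (h (fun x y => if x = k ∧ y = l then 1 else 0)) i) j
  simp only [matOp_apply, ite_and, smul_eq_mul, mul_ite, mul_one, mul_zero] at this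
  simpa using this

theorem matOp_map {M' : Type*} [AddCommGroup M'] [Module ℂ M'] (φ : M →ₗ[ℂ] M')
    (A : Matrix (Fin m × Fin m) (Fin m × Fin m) ℝ) (w : Fin m → Fin m → M) (i j : Fin m) :
    φ (matOp A w i j) = matOp A (fun k l => φ (w k l)) i j := by
  simp [matOp_apply]

/-- The nonzero entries `q^(-ρ_i)` of the metric. -/
noncomputable def metricCoeff (q : ℝ) (m : ℕ) (i : Fin m) : ℂ := ((q ^ (-rhoVec m i) : ℝ) : ℂ)

theorem rhoVec_rev (i : Fin m) : rhoVec m i.rev = -rhoVec m i := by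
  unfold rhoVec
  rw [Fin.rev_rev]
  rcases lt_trichotomy i i.rev with h | h | h
  · rw [if_neg (not_lt.mpr h.le), if_pos h, if_pos h]
  · rw [← h]; simp
  · rw [if_pos h, if_neg (not_lt.mpr h.le), if_pos h, neg_neg]

theorem metricCoeff_mul_rev (hq : 0 < q) (i : Fin m) :
    metricCoeff q m i * metricCoeff q m i.rev = 1 := by
  unfold metricCoeff
  rw [rhoVec_rev, ← Complex.ofReal_mul, ← Real.rpow_add hq]
  simp

theorem qMetric_cast (i j : Fin m) :
    ((qMetric q m i j : ℝ) : ℂ) = if j = i.rev then metricCoeff q m i else 0 := by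
  unfold qMetric metricCoeff
  split_ifs <;> simp

/-- The contraction of a two-index family with the metric. -/
noncomputable def metricTr (q : ℝ) (w : Fin m → Fin m → M) : M :=
  ∑ i, metricCoeff q m i • w i i.rev

/-- The two-index family `C^{ij} v`. -/
noncomputable def metricVec (q : ℝ) (m : ℕ) (v : M) : Fin m → Fin m → M :=
  fun i j => if j = i.rev then metricCoeff q m i • v else 0

/-- The action of the braid matrix on two-index families of vectors. -/
noncomputable def braidOp (q : ℝ) (w : Fin m → Fin m → M) : Fin m → Fin m → M :=
  matOp (braidMatrix q m) w

/-- The diagonal coefficients of the permutation part of the braid matrix. -/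
noncomputable def flipCoeff (q : ℝ) (a b : Fin m) : ℂ :=
  if a = b ∧ a ≠ a.rev then (q : ℂ) else if b = a.rev ∧ a ≠ b then (q : ℂ)⁻¹ else 1

/-- Since ρ_{b'} = -ρ_b, the factor q^(ρ_b - ρ_k) is a product of two metric entries. The last term
of R is therefore a contraction with the metric truncated to k < b, the form in which it can be
compared with `metricTr` and `metricVec`. -/
theorem braidOp_apply (hq : 0 < q) (w : Fin m → Fin m → M) (a b : Fin m) :
    braidOp q w a b = flipCoeff q a b • w b a + ((q : ℂ) - (q : ℂ)⁻¹) •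
      ((if a < b then w a b else 0) - if a = b.rev then
        ∑ k, if k < b then (metricCoeff q m k * metricCoeff q m a) • w k k.rev else 0 else 0) := by
  have key : ∀ k l : Fin m, ((braidMatrix q m (a, b) (k, l) : ℝ) : ℂ) • w k l =
      (if l = a then if k = b then flipCoeff q a b • w k l else 0 else 0) +
      ((q : ℂ) - (q : ℂ)⁻¹) • ((if l = b then if k = a then if a < b then w k l else 0 else 0 else 0)
       - if l = k.rev then if a = b.rev then if k < b then
          (metricCoeff q m k * metricCoeff q m a) • w k l else 0 else 0 else 0) := by
    intro k l
    have e1 : (((if a = b ∧ a ≠ a.rev then q else if b = a.rev ∧ a ≠ b then q⁻¹ else 1 : ℝ)) : ℂ)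
        = flipCoeff q a b := by
      unfold flipCoeff; split_ifs <;> simp
    have e2 : ((q ^ (rhoVec m b - rhoVec m k) : ℝ) : ℂ)
        = metricCoeff q m k * metricCoeff q m b.rev := by
      unfold metricCoeff
      rw [← Complex.ofReal_mul, ← Real.rpow_add hq, rhoVec_rev]
      congr 2; ring
    unfold braidMatrix
    simp only [Prod.mk.injEq]
    rw [Complex.ofReal_add, Complex.ofReal_mul, add_smul, mul_smul, Complex.ofReal_sub q, Complex.ofReal_inv]
    congr 2
    · by_cases h1 : l = a <;> by_cases h2 : k = b <;> simp [h1, h2, e1]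
    · rw [Complex.ofReal_sub, sub_smul]
      congr 1
      · by_cases h1 : l = b <;> by_cases h2 : k = a <;> by_cases h3 : a < b <;> simp [h1, h2, h3]
      · by_cases h1 : l = k.rev
        · by_cases h2 : a = b.rev
          · by_cases h3 : k < b
            · subst h2; simp [h1, h3, ← e2]
            · simp [h3]
          · simp [h2]
        · simp [h1]
  unfold braidOp
  rw [matOp_apply]
  simp only [key, Finset.sum_add_distrib, ← Finset.smul_sum, Finset.sum_sub_distrib,
    Finset.sum_ite_eq', Finset.mem_univ, if_true]
  congr 3
  by_cases h : a = b.rev <;> simp [h]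

/-! ### Linearity -/

theorem braidOp_add_apply (w v : Fin m → Fin m → M) (a b : Fin m) :
    braidOp q (fun x y => w x y + v x y) a b = braidOp q w a b + braidOp q v a b := by
  have := congrFun (congrFun (map_add (matOp (M := M) (braidMatrix q m)) w v) a) b
  exact this

theorem braidOp_sub_apply (w v : Fin m → Fin m → M) (a b : Fin m) :
    braidOp q (fun x y => w x y - v x y) a b = braidOp q w a b - braidOp q v a b := by
  have := congrFun (congrFun (map_sub (matOp (M := M) (braidMatrix q m)) w v) a) b
  exact this

theorem braidOp_smul_apply (t : ℂ) (w : Fin m → Fin m → M) (a b : Fin m) :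
    braidOp q (fun x y => t • w x y) a b = t • braidOp q w a b := by
  have := congrFun (congrFun (map_smul (matOp (M := M) (braidMatrix q m)) t w) a) b
  exact this

theorem metricTr_add (w v : Fin m → Fin m → M) :
    metricTr q (fun x y => w x y + v x y) = metricTr q w + metricTr q v := by
  simp [metricTr, Finset.sum_add_distrib]

theorem metricTr_sub (w v : Fin m → Fin m → M) :
    metricTr q (fun x y => w x y - v x y) = metricTr q w - metricTr q v := by
  simp [metricTr, smul_sub, Finset.sum_sub_distrib]

theorem metricTr_smul (t : ℂ) (w : Fin m → Fin m → M) :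
    metricTr q (fun x y => t • w x y) = t • metricTr q w := by
  simp only [metricTr, Finset.smul_sum]
  exact Finset.sum_congr rfl fun i _ => smul_comm _ _ _

theorem metricVec_add_apply (v v' : M) (a b : Fin m) :
    metricVec q m (v + v') a b = metricVec q m v a b + metricVec q m v' a b := by
  unfold metricVec; split_ifs <;> simp

theorem metricVec_sub_apply (v v' : M) (a b : Fin m) :
    metricVec q m (v - v') a b = metricVec q m v a b - metricVec q m v' a b := by
  unfold metricVec; split_ifs <;> simp [smul_sub]

theorem metricVec_smul_apply (t : ℂ) (v : M) (a b : Fin m) :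
    metricVec q m (t • v) a b = t • metricVec q m v a b := by
  unfold metricVec; split_ifs
  · exact smul_comm _ _ _
  · simp

theorem metricVec_zero_apply (a b : Fin m) : metricVec q m (0 : M) a b = 0 := by
  unfold metricVec; split_ifs <;> simp

/-- Zigzag identity: C_{ij} and C^{ij} have the same entries and are inverse to each other, because
ρ changes sign under i ↦ i'. -/
theorem metricTr_metricVec_left (hq : 0 < q) (g : Fin m → M) (l : Fin m) :
    metricTr q (fun s t => metricVec q m (g s) t l) = g l := by
  unfold metricTr metricVec
  simp only [Fin.rev_rev]
  simp only [smul_ite, smul_zero, Finset.sum_ite_eq, Finset.mem_univ, if_true, smul_smul,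
    metricCoeff_mul_rev hq, one_smul]

theorem metricTr_metricVec_right (hq : 0 < q) (g : Fin m → M) (l : Fin m) :
    metricTr q (fun s t => metricVec q m (g t) l s) = g l := by
  unfold metricTr metricVec
  simp only [smul_ite, smul_zero, Finset.sum_ite_eq', Finset.mem_univ, if_true, smul_smul,
    Fin.rev_rev]
  rw [mul_comm, metricCoeff_mul_rev hq, one_smul]

/-! ### Passing from `m` to `m + 2` -/

/-- The embedding of the inner indices. -/
def inner (i : Fin n) : Fin (n + 2) := i.succ.castSucc

theorem inner_cases {P : Fin (n + 2) → Prop} (h0 : P 0) (h1 : ∀ i, P (inner i))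
    (h2 : P (Fin.last (n + 1))) (a : Fin (n + 2)) : P a := by
  induction a using Fin.lastCases with
  | last => exact h2
  | cast i =>
    induction i using Fin.cases with
    | zero => exact h0
    | succ i => exact h1 i

omit [Module ℂ M] in
theorem sum_inner (f : Fin (n + 2) → M) :
    ∑ a, f a = f 0 + ∑ i, f (inner i) + f (Fin.last (n + 1)) := by
  rw [Fin.sum_univ_castSucc, Fin.sum_univ_succ]
  rfl

@[simp] theorem rev_inner (i : Fin n) : (inner i).rev = inner i.rev := by
  ext; simp [inner, Fin.val_rev]; omega

theorem inner_injective : Function.Injective (inner : Fin n → Fin (n + 2)) := by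
  intro i j h
  simpa [inner] using h

@[simp] theorem inner_inj {i j : Fin n} : inner i = inner j ↔ i = j := inner_injective.eq_iff

@[simp] theorem inner_lt {i j : Fin n} : inner i < inner j ↔ i < j := by
  simp [inner]

@[simp] theorem zero_lt_inner (i : Fin n) : 0 < inner i := by
  simp [inner, Fin.lt_def]

@[simp] theorem inner_lt_last (i : Fin n) : inner i < Fin.last (n + 1) := Fin.castSucc_lt_last _

@[simp] theorem zero_lt_last' : (0 : Fin (n + 2)) < Fin.last (n + 1) := Fin.last_pos

@[simp] theorem not_last_lt (i : Fin (n + 2)) : ¬ Fin.last (n + 1) < i := not_lt.mpr (Fin.le_last i)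

@[simp] theorem inner_ne_zero (i : Fin n) : inner i ≠ 0 := (zero_lt_inner i).ne'
@[simp] theorem zero_ne_inner (i : Fin n) : 0 ≠ inner i := (zero_lt_inner i).ne
@[simp] theorem inner_ne_last (i : Fin n) : inner i ≠ Fin.last (n + 1) := (inner_lt_last i).ne
@[simp] theorem last_ne_inner (i : Fin n) : Fin.last (n + 1) ≠ inner i := (inner_lt_last i).ne'
@[simp] theorem zero_ne_last' : (0 : Fin (n + 2)) ≠ Fin.last (n + 1) := zero_lt_last'.ne
/-- The inverse of the first entry of the metric in dimension `n + 2`. -/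
noncomputable def edgeCoeff (q : ℝ) (n : ℕ) : ℂ := ((q ^ ((n : ℝ) / 2) : ℝ) : ℂ)

theorem edgeCoeff_ne_zero (hq : 0 < q) : edgeCoeff q n ≠ 0 := by
  unfold edgeCoeff
  exact_mod_cast (Real.rpow_pos_of_pos hq _).ne'

theorem edgeCoeff_mul_self (hq : 0 < q) : edgeCoeff q n * edgeCoeff q n = (q : ℂ) ^ n := by
  unfold edgeCoeff
  rw [← Complex.ofReal_mul, ← Real.rpow_add hq, add_halves, Real.rpow_natCast, Complex.ofReal_pow]

theorem metricCoeff_inner (i : Fin n) : metricCoeff q (n + 2) (inner i) = metricCoeff q n i := by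
  unfold metricCoeff
  congr 2
  have h : ∀ i : Fin n, ((inner i : Fin (n + 2)) : ℕ) = (i : ℕ) + 1 := by
    intro i; simp [inner]
  unfold rhoVec
  rw [rev_inner]
  simp only [inner_lt, h]
  push_cast
  split_ifs <;> ring

theorem metricCoeff_zero (hq : 0 < q) : metricCoeff q (n + 2) 0 = (edgeCoeff q n)⁻¹ := by
  unfold metricCoeff edgeCoeff rhoVec
  rw [Fin.rev_zero, if_pos zero_lt_last', Real.rpow_neg hq.le, Complex.ofReal_inv]
  congr 3
  push_cast
  simp
  ring

theorem metricCoeff_last (hq : 0 < q) :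
    metricCoeff q (n + 2) (Fin.last (n + 1)) = edgeCoeff q n := by
  have := metricCoeff_mul_rev (m := n + 2) hq 0
  rw [metricCoeff_zero hq, Fin.rev_zero] at this
  have h2 := edgeCoeff_ne_zero (n := n) hq
  rwa [inv_mul_eq_one₀ h2, eq_comm] at this

theorem metricTr_succ (hq : 0 < q) (w : Fin (n + 2) → Fin (n + 2) → M) :
    metricTr q w = (edgeCoeff q n)⁻¹ • w 0 (Fin.last (n + 1)) +
      metricTr q (fun i j => w (inner i) (inner j)) +
      edgeCoeff q n • w (Fin.last (n + 1)) 0 := by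
  unfold metricTr
  rw [sum_inner]
  simp only [metricCoeff_inner, metricCoeff_zero hq, metricCoeff_last hq, rev_inner, Fin.rev_zero,
    Fin.rev_last]

section metricVec
variable (v : M)
theorem metricVec_zero_last (hq : 0 < q) :
    metricVec q (n + 2) v 0 (Fin.last (n + 1)) = (edgeCoeff q n)⁻¹ • v := by
  simp [metricVec, metricCoeff_zero hq]
theorem metricVec_last_zero (hq : 0 < q) :
    metricVec q (n + 2) v (Fin.last (n + 1)) 0 = edgeCoeff q n • v := by
  simp [metricVec, metricCoeff_last hq]
@[simp] theorem metricVec_zero_zero : metricVec q (n + 2) v 0 0 = 0 := by simp [metricVec]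
@[simp] theorem metricVec_last_last :
    metricVec q (n + 2) v (Fin.last (n + 1)) (Fin.last (n + 1)) = 0 := by simp [metricVec]
@[simp] theorem metricVec_zero_inner (i : Fin n) : metricVec q (n + 2) v 0 (inner i) = 0 := by
  simp [metricVec]
@[simp] theorem metricVec_inner_zero (i : Fin n) : metricVec q (n + 2) v (inner i) 0 = 0 := by
  simp [metricVec]
@[simp] theorem metricVec_last_inner (i : Fin n) :
    metricVec q (n + 2) v (Fin.last (n + 1)) (inner i) = 0 := by simp [metricVec]
@[simp] theorem metricVec_inner_last (i : Fin n) :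
    metricVec q (n + 2) v (inner i) (Fin.last (n + 1)) = 0 := by simp [metricVec]
@[simp] theorem metricVec_inner_inner (i j : Fin n) :
    metricVec q (n + 2) v (inner i) (inner j) = metricVec q n v i j := by
  simp [metricVec, metricCoeff_inner]
end metricVec

section braidOp
variable (w : Fin (n + 2) → Fin (n + 2) → M)

theorem braidOp_zero_zero (hq : 0 < q) : braidOp q w 0 0 = (q : ℂ) • w 0 0 := by
  simp [braidOp_apply hq, flipCoeff]

theorem braidOp_last_last (hq : 0 < q) :
    braidOp q w (Fin.last (n + 1)) (Fin.last (n + 1)) =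
      (q : ℂ) • w (Fin.last (n + 1)) (Fin.last (n + 1)) := by
  simp [braidOp_apply hq, flipCoeff]

theorem braidOp_last_zero (hq : 0 < q) :
    braidOp q w (Fin.last (n + 1)) 0 = (q : ℂ)⁻¹ • w 0 (Fin.last (n + 1)) := by
  simp [braidOp_apply hq, flipCoeff]

/-- The only row with an outer index that involves the inner contraction: here the truncation k < b
admits every inner k. -/
theorem braidOp_zero_last (hq : 0 < q) :
    braidOp q w 0 (Fin.last (n + 1)) = (q : ℂ)⁻¹ • w (Fin.last (n + 1)) 0 +
      ((q : ℂ) - (q : ℂ)⁻¹) • (w 0 (Fin.last (n + 1)) -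
        ((edgeCoeff q n)⁻¹ * (edgeCoeff q n)⁻¹) • w 0 (Fin.last (n + 1)) -
        (edgeCoeff q n)⁻¹ • metricTr q (fun i j => w (inner i) (inner j))) := by
  rw [braidOp_apply hq, sum_inner]
  simp only [zero_lt_last', if_true, Fin.rev_last, flipCoeff, Fin.rev_zero, zero_ne_last',
    false_and, if_false, ne_eq, not_false_eq_true, and_self, metricCoeff_zero hq,
    metricCoeff_inner, inner_lt_last, lt_self_iff_false, add_zero, rev_inner]
  rw [sub_sub]
  congr 4
  rw [metricTr, Finset.smul_sum]
  refine Finset.sum_congr rfl fun i _ => ?_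
  rw [smul_smul, mul_comm]

theorem braidOp_zero_inner (hq : 0 < q) (i : Fin n) :
    braidOp q w 0 (inner i) = w (inner i) 0 + ((q : ℂ) - (q : ℂ)⁻¹) • w 0 (inner i) := by
  simp [braidOp_apply hq, flipCoeff]

theorem braidOp_inner_zero (hq : 0 < q) (i : Fin n) :
    braidOp q w (inner i) 0 = w 0 (inner i) := by
  simp [braidOp_apply hq, flipCoeff]

theorem braidOp_inner_last (hq : 0 < q) (i : Fin n) :
    braidOp q w (inner i) (Fin.last (n + 1)) = w (Fin.last (n + 1)) (inner i) +
      ((q : ℂ) - (q : ℂ)⁻¹) • w (inner i) (Fin.last (n + 1)) := by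
  simp [braidOp_apply hq, flipCoeff]

theorem braidOp_last_inner (hq : 0 < q) (i : Fin n) :
    braidOp q w (Fin.last (n + 1)) (inner i) = w (inner i) (Fin.last (n + 1)) := by
  simp [braidOp_apply hq, flipCoeff]

/-- The inner block is the braid matrix of size n, up to the term k = 0 of the truncated
contraction, which is the metric times the entry at (0, last). -/
theorem braidOp_inner_inner (hq : 0 < q) (i j : Fin n) :
    braidOp q w (inner i) (inner j) = braidOp q (fun i j => w (inner i) (inner j)) i j -
      (((q : ℂ) - (q : ℂ)⁻¹) * (edgeCoeff q n)⁻¹) •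
        metricVec q n (w 0 (Fin.last (n + 1))) i j := by
  rw [braidOp_apply hq, braidOp_apply hq, sum_inner]
  have h : i = j.rev ↔ j = i.rev := ⟨fun h => by rw [h, Fin.rev_rev], fun h => by rw [h, Fin.rev_rev]⟩
  simp only [rev_inner, inner_lt, inner_inj, flipCoeff, metricCoeff_inner, zero_lt_inner, if_true,
    not_last_lt, if_false, add_zero, metricVec, Fin.rev_zero, metricCoeff_zero hq, h, ne_eq]
  split_ifs <;> module

end braidOp

/-- The eigenvalue `q^(1-m)` of the braid matrix on the metric. -/
noncomputable def kap (q : ℝ) (m : ℕ) : ℂ := (q : ℂ) ^ (1 - (m : ℤ))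

theorem kap_eq (hq : 0 < q) :
    kap q n = (q : ℂ) * (edgeCoeff q n)⁻¹ * (edgeCoeff q n)⁻¹ := by
  have hq' : (q : ℂ) ≠ 0 := by exact_mod_cast hq.ne'
  rw [mul_assoc, ← mul_inv, edgeCoeff_mul_self hq, kap, zpow_sub₀ hq', zpow_one, zpow_natCast]
  rfl

theorem kap_succ_eq (hq : 0 < q) :
    kap q (n + 2) = (q : ℂ)⁻¹ * (edgeCoeff q n)⁻¹ * (edgeCoeff q n)⁻¹ := by
  have hq' : (q : ℂ) ≠ 0 := by exact_mod_cast hq.ne'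
  rw [mul_assoc, ← mul_inv, edgeCoeff_mul_self hq, kap, zpow_sub₀ hq', zpow_one, zpow_natCast,
    pow_add]
  field_simp

theorem inner_induction {P : ℕ → Prop} (h0 : P 0) (h1 : P 1) (h : ∀ n, P n → P (n + 2)) (n : ℕ) :
    P n := by
  induction n using Nat.strong_induction_on with
  | _ n ih =>
    match n, ih with
    | 0, _ => exact h0
    | 1, _ => exact h1
    | n + 2, ih => exact h n (ih n (by omega))

theorem metricCoeff_one (i : Fin 1) : metricCoeff q 1 i = 1 := by
  have : i = 0 := Subsingleton.elim _ _
  subst this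
  simp [metricCoeff, rhoVec]

theorem metricVec_one (v : M) (i j : Fin 1) : metricVec q 1 v i j = v := by
  simp [metricVec, metricCoeff_one, Subsingleton.elim j i.rev]

theorem metricTr_one (w : Fin 1 → Fin 1 → M) : metricTr q w = w 0 0 := by
  simp [metricTr, metricCoeff_one]

theorem braidOp_one (hq : 0 < q) (w : Fin 1 → Fin 1 → M) : braidOp q w = w := by
  funext i j
  rw [braidOp_apply hq]
  have hi : i = 0 := Subsingleton.elim _ _
  have hj : j = 0 := Subsingleton.elim _ _
  subst hi hj
  simp [flipCoeff]

theorem kap_one : kap q 1 = 1 := by simp [kap]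

/-! ### Relations between the braid matrix and the metric -/

/-- The value of a closed loop (the quantum dimension); passing from n to n + 2 adds q^n + q^(-n).
It is kept multiplied by q - q⁻¹ to avoid division. -/
theorem metricTr_metricVec (hq : 0 < q) (m : ℕ) (v : M) :
    ((q : ℂ) - (q : ℂ)⁻¹) • metricTr q (metricVec q m v) =
      ((q : ℂ) - (q : ℂ)⁻¹ - kap q m + (kap q m)⁻¹) • v := by
  have hq' : (q : ℂ) ≠ 0 := by exact_mod_cast hq.ne'
  induction m using inner_induction with
  | h0 => simp [metricTr, kap]
  | h1 => simp [metricTr_one, metricVec_one, kap_one]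
  | h n ih =>
    have hp := edgeCoeff_ne_zero (n := n) hq
    rw [metricTr_succ hq]
    simp only [metricVec_zero_last _ hq, metricVec_last_zero _ hq, metricVec_inner_inner]
    rw [smul_add, smul_add, show (fun i j => metricVec q n v i j) = metricVec q n v from rfl, ih,
      kap_succ_eq hq, kap_eq hq]
    match_scalars
    field_simp
    ring

theorem metricTr_braidOp (hq : 0 < q) (m : ℕ) (w : Fin m → Fin m → M) :
    metricTr q (braidOp q w) = kap q m • metricTr q w := by
  have hq' : (q : ℂ) ≠ 0 := by exact_mod_cast hq.ne'
  induction m using inner_induction with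
  | h0 => simp [metricTr]
  | h1 => simp [braidOp_one hq, kap_one]
  | h n ih =>
    have hp := edgeCoeff_ne_zero (n := n) hq
    have hN := metricTr_metricVec hq n (w 0 (Fin.last (n + 1)))
    rw [metricTr_succ hq, metricTr_succ hq]
    simp only [braidOp_zero_last _ hq, braidOp_last_zero _ hq, braidOp_inner_inner _ hq,
      metricTr_sub, metricTr_smul]
    rw [ih, mul_comm ((q : ℂ) - (q : ℂ)⁻¹) (edgeCoeff q n)⁻¹, mul_smul _ ((q : ℂ) - (q : ℂ)⁻¹), hN,
      kap_succ_eq hq, kap_eq hq]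
    match_scalars <;> field_simp <;> ring

theorem braidOp_metricVec (hq : 0 < q) (m : ℕ) (v : M) (a b : Fin m) :
    braidOp q (metricVec q m v) a b = kap q m • metricVec q m v a b := by
  have hq' : (q : ℂ) ≠ 0 := by exact_mod_cast hq.ne'
  induction m using inner_induction with
  | h0 => exact a.elim0
  | h1 => simp [braidOp_one hq, kap_one]
  | h n ih =>
    have hp := edgeCoeff_ne_zero (n := n) hq
    have hN := metricTr_metricVec hq n v
    induction a using inner_cases <;> induction b using inner_cases <;>
    simp only [braidOp_zero_last _ hq, braidOp_last_zero _ hq, braidOp_inner_inner _ hq,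
      braidOp_zero_zero _ hq, braidOp_last_last _ hq, braidOp_zero_inner _ hq,
      braidOp_inner_zero _ hq, braidOp_inner_last _ hq, braidOp_last_inner _ hq,
      metricVec_zero_zero, metricVec_last_last, metricVec_zero_inner, metricVec_inner_zero,
      metricVec_last_inner, metricVec_inner_last, metricVec_zero_last _ hq,
      metricVec_last_zero _ hq, metricVec_inner_inner, metricVec_smul_apply, smul_zero, add_zero]
    · rw [show (fun x y => metricVec q n v x y) = metricVec q n v from rfl, smul_sub, smul_sub,
        smul_comm _ (edgeCoeff q n)⁻¹ (metricTr q _), hN, kap_succ_eq hq, kap_eq hq]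
      match_scalars; field_simp; ring
    · rw [show (fun x y => metricVec q n v x y) = metricVec q n v from rfl, ih, kap_succ_eq hq,
        kap_eq hq]
      match_scalars; field_simp; ring
    · rw [kap_succ_eq hq]
      match_scalars; field_simp

theorem braidOp_zero_apply (a b : Fin m) :
    braidOp q (fun _ _ => (0 : M)) a b = 0 := by
  simpa using braidOp_smul_apply (q := q) 0 (fun _ _ => (0 : M)) a b

theorem metricTr_zero : metricTr q (fun _ _ : Fin m => (0 : M)) = 0 := by
  simp [metricTr]

/-- The skein relation R - R⁻¹ = (q - q⁻¹)(1 - K), multiplied by R. In this form it does not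
presuppose that R is invertible. -/
theorem braidOp_braidOp (hq : 0 < q) (m : ℕ) (w : Fin m → Fin m → M) (a b : Fin m) :
    braidOp q (braidOp q w) a b = w a b + ((q : ℂ) - (q : ℂ)⁻¹) • braidOp q w a b -
      (((q : ℂ) - (q : ℂ)⁻¹) * kap q m) • metricVec q m (metricTr q w) a b := by
  have hq' : (q : ℂ) ≠ 0 := by exact_mod_cast hq.ne'
  induction m using inner_induction with
  | h0 => exact a.elim0
  | h1 =>
    simp [braidOp_one hq, kap_one, metricVec_one, metricTr_one, Subsingleton.elim a 0,
      Subsingleton.elim b 0]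
  | h n ih =>
    have hp := edgeCoeff_ne_zero (n := n) hq
    have hN := metricTr_metricVec hq n (w 0 (Fin.last (n + 1)))
    induction a using inner_cases <;> induction b using inner_cases <;>
    simp only [braidOp_zero_last _ hq, braidOp_last_zero _ hq, braidOp_inner_inner _ hq,
      braidOp_zero_zero _ hq, braidOp_last_last _ hq, braidOp_zero_inner _ hq,
      braidOp_inner_zero _ hq, braidOp_inner_last _ hq, braidOp_last_inner _ hq,
      metricVec_zero_zero, metricVec_last_last, metricVec_zero_inner, metricVec_inner_zero,
      metricVec_last_inner, metricVec_inner_last, metricVec_zero_last _ hq,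
      metricVec_last_zero _ hq, metricVec_inner_inner, metricVec_smul_apply, metricVec_add_apply,
      metricVec_sub_apply, smul_zero, add_zero, sub_zero, metricTr_succ hq, metricTr_sub,
      metricTr_smul, metricTr_braidOp hq, braidOp_sub_apply, braidOp_smul_apply, ih,
      braidOp_metricVec hq, kap_succ_eq hq, kap_eq hq]
    · match_scalars; field_simp; ring
    · rw [kap_eq hq] at hN
      linear_combination (norm := (match_scalars <;> field_simp <;> ring))
        (((q : ℂ) - (q : ℂ)⁻¹) * (edgeCoeff q n)⁻¹ * (edgeCoeff q n)⁻¹) • hN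
    all_goals match_scalars <;> field_simp <;> ring

/-- A strand slides past a cup: R₁₂⁻¹(g ⊗ C) = R₂₃(C ⊗ g), with R₁₂⁻¹ eliminated by the skein
relation. -/
theorem slide_vec (hq : 0 < q) (m : ℕ) (g : Fin m → M) (a b c : Fin m) :
    braidOp q (fun s t => metricVec q m (g s) t c) a b -
      braidOp q (fun v s => metricVec q m (g s) a v) b c =
    ((q : ℂ) - (q : ℂ)⁻¹) • (metricVec q m (g a) b c - metricVec q m (g c) a b) := by
  have hq' : (q : ℂ) ≠ 0 := by exact_mod_cast hq.ne'
  induction m using inner_induction with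
  | h0 => exact a.elim0
  | h1 =>
    simp [braidOp_one hq, metricVec_one, Subsingleton.elim a 0, Subsingleton.elim b 0,
      Subsingleton.elim c 0]
  | h n ih =>
    have hp := edgeCoeff_ne_zero (n := n) hq
    induction a using inner_cases <;> induction b using inner_cases <;>
      induction c using inner_cases <;>
    simp only [braidOp_zero_last _ hq, braidOp_last_zero _ hq, braidOp_inner_inner _ hq,
      braidOp_zero_zero _ hq, braidOp_last_last _ hq, braidOp_zero_inner _ hq,
      braidOp_inner_zero _ hq, braidOp_inner_last _ hq, braidOp_last_inner _ hq,
      metricVec_zero_zero, metricVec_last_last, metricVec_zero_inner, metricVec_inner_zero,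
      metricVec_last_inner, metricVec_inner_last, metricVec_zero_last _ hq,
      metricVec_last_zero _ hq, metricVec_inner_inner, smul_zero, add_zero, zero_add, sub_self,
      zero_sub, sub_zero, metricTr_zero, braidOp_zero_apply, metricVec_zero_apply,
      metricTr_metricVec_left hq, metricTr_metricVec_right hq, metricVec_smul_apply, ih] <;>
    match_scalars <;> field_simp <;> ring

/-- The dual statement, a strand sliding past a cap. -/
theorem slide_tr (hq : 0 < q) (m : ℕ) (h : Fin m → Fin m → Fin m → M) (a : Fin m) :
    metricTr q (fun k l => braidOp q (fun x y => h x y l) a k) -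
      metricTr q (fun k l => braidOp q (h k) l a) =
    ((q : ℂ) - (q : ℂ)⁻¹) • (metricTr q (h a) - metricTr q (fun k l => h k l a)) := by
  have hq' : (q : ℂ) ≠ 0 := by exact_mod_cast hq.ne'
  induction m using inner_induction with
  | h0 => exact a.elim0
  | h1 =>
    simp [braidOp_one hq, metricTr_one, Subsingleton.elim a 0]
  | h n ih =>
    have hp := edgeCoeff_ne_zero (n := n) hq
    induction a using inner_cases <;>
    simp only [braidOp_zero_last _ hq, braidOp_last_zero _ hq, braidOp_inner_inner _ hq,
      braidOp_zero_zero _ hq, braidOp_last_last _ hq, braidOp_zero_inner _ hq,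
      braidOp_inner_zero _ hq, braidOp_inner_last _ hq, braidOp_last_inner _ hq,
      metricTr_succ hq, metricTr_add, metricTr_sub, metricTr_smul,
      metricTr_metricVec_left hq, metricTr_metricVec_right hq]
    · match_scalars <;> field_simp <;> ring
    · linear_combination (norm := (match_scalars <;> field_simp <;> ring))
        ih (fun i j k => h (inner i) (inner j) (inner k)) _
    · match_scalars <;> field_simp <;> ring

/-! ### Crossings on three strands and the braid relation -/

/-- The braid matrix on the first two of three indices. -/
noncomputable def braid12 (q : ℝ) (h : Fin m → Fin m → Fin m → M) : Fin m → Fin m → Fin m → M :=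
  fun a b c => braidOp q (fun x y => h x y c) a b

/-- The braid matrix on the last two of three indices. -/
noncomputable def braid23 (q : ℝ) (h : Fin m → Fin m → Fin m → M) : Fin m → Fin m → Fin m → M :=
  fun a => braidOp q (h a)

/-- A cup passes over a strand. Sliding turns the inner crossing into R₁₂, and the correction terms
of `slide_vec` cancel those of the skein relation. This and the next three lemmas serve as rewriting
rules for the inner indices in `braid_relation`. -/
theorem braid12_braid23_vec (hq : 0 < q) (g : Fin m → M) (a b c : Fin m) :
    braidOp q (fun x y => braidOp q (fun s t => metricVec q m (g t) x s) y c) a b =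
      metricVec q m (g a) b c := by
  have h (x y : Fin m) : braidOp q (fun s t => metricVec q m (g t) x s) y c =
      braidOp q (fun s t => metricVec q m (g s) t c) x y -
        ((q : ℂ) - (q : ℂ)⁻¹) • (metricVec q m (g x) y c - metricVec q m (g c) x y) := by
    rw [← slide_vec hq]; abel
  have h2 := braidOp_braidOp hq m (fun s t => metricVec q m (g s) t c) a b
  have h3 := braidOp_metricVec hq m (g c) a b
  rw [metricTr_metricVec_left hq] at h2
  simp only [h, braidOp_sub_apply, braidOp_smul_apply]
  rw [show braidOp q (fun x y => braidOp q (fun s t => metricVec q m (g s) t c) x y) a b =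
    braidOp q (braidOp q (fun s t => metricVec q m (g s) t c)) a b from rfl, h2,
    show braidOp q (fun x y => metricVec q m (g c) x y) a b = _ from h3]
  module

theorem braid23_braid12_vec (hq : 0 < q) (g : Fin m → M) (a b c : Fin m) :
    braidOp q (fun x y => braidOp q (fun s t => metricVec q m (g s) t y) a x) b c =
      metricVec q m (g c) a b := by
  have h (x y : Fin m) : braidOp q (fun s t => metricVec q m (g s) t y) a x =
      braidOp q (fun s t => metricVec q m (g t) a s) x y +
        ((q : ℂ) - (q : ℂ)⁻¹) • (metricVec q m (g a) x y - metricVec q m (g y) a x) := by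
    rw [← slide_vec hq]; abel
  have h2 := braidOp_braidOp hq m (fun s t => metricVec q m (g t) a s) b c
  have h3 := braidOp_metricVec hq m (g a) b c
  rw [metricTr_metricVec_right hq] at h2
  simp only [h, braidOp_add_apply, braidOp_sub_apply, braidOp_smul_apply]
  rw [show braidOp q (fun x y => braidOp q (fun s t => metricVec q m (g t) a s) x y) b c =
    braidOp q (braidOp q (fun s t => metricVec q m (g t) a s)) b c from rfl, h2,
    show braidOp q (fun x y => metricVec q m (g a) x y) b c = _ from h3]
  module

theorem tr12_braid23_braid12 (hq : 0 < q) (h : Fin m → Fin m → Fin m → M) (a : Fin m) :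
    metricTr q (fun x y => braidOp q (fun s t => braidOp q (fun i j => h i j t) x s) y a) =
      metricTr q (h a) := by
  have h1 := slide_tr hq m (fun x y z => braidOp q (fun i j => h i j z) x y) a
  have h2 (k l : Fin m) := braidOp_braidOp hq m (fun i j => h i j l) a k
  have h3 := metricTr_braidOp hq m (fun i j => h i j a)
  simp only [show ∀ k l, braidOp q (fun x y => braidOp q (fun i j => h i j l) x y) a k = _ from h2,
    metricTr_add, metricTr_sub, metricTr_smul, metricTr_metricVec_right hq] at h1
  rw [show metricTr q (fun k l => braidOp q (fun i j => h i j a) k l) = _ from h3] at h1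
  linear_combination (norm := module) (-1 : ℂ) • h1

theorem tr23_braid12_braid23 (hq : 0 < q) (h : Fin m → Fin m → Fin m → M) (a : Fin m) :
    metricTr q (fun x y => braidOp q (fun s t => braidOp q (h s) t y) a x) =
      metricTr q (fun i j => h i j a) := by
  have h1 := slide_tr hq m (fun x => braidOp q (h x)) a
  simp only [braidOp_braidOp hq, metricTr_add, metricTr_sub, metricTr_smul,
    metricTr_metricVec_left hq, metricTr_braidOp hq] at h1
  linear_combination (norm := module) h1

/-- A curl in a strand, removed at the cost of the inverse eigenvalue of R on the metric; the loop
value enters after sliding. -/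
theorem tr12_braid23_vec (hq : 0 < q) (g : Fin m → M) (a : Fin m) :
    metricTr q (fun x y => braidOp q (fun s t => metricVec q m (g t) x s) y a) =
      (kap q m)⁻¹ • g a := by
  have hk : kap q m ≠ 0 := zpow_ne_zero _ (by exact_mod_cast hq.ne')
  have h (x y : Fin m) : braidOp q (fun s t => metricVec q m (g t) x s) y a =
      braidOp q (fun s t => metricVec q m (g s) t a) x y -
        ((q : ℂ) - (q : ℂ)⁻¹) • (metricVec q m (g x) y a - metricVec q m (g a) x y) := by
    rw [← slide_vec hq]; abel
  have h3 := metricTr_braidOp hq m (fun s t => metricVec q m (g s) t a)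
  have hN := metricTr_metricVec hq m (g a)
  simp only [h, metricTr_sub, metricTr_smul, metricTr_metricVec_left hq] at h3 ⊢
  rw [show metricTr q (fun x y => braidOp q (fun s t => metricVec q m (g s) t a) x y) = _ from h3]
  linear_combination (norm := module) hN

theorem tr23_braid12_vec (hq : 0 < q) (g : Fin m → M) (a : Fin m) :
    metricTr q (fun x y => braidOp q (fun s t => metricVec q m (g s) t y) a x) =
      (kap q m)⁻¹ • g a := by
  have h (x y : Fin m) : braidOp q (fun s t => metricVec q m (g s) t y) a x =
      braidOp q (fun s t => metricVec q m (g t) a s) x y +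
        ((q : ℂ) - (q : ℂ)⁻¹) • (metricVec q m (g a) x y - metricVec q m (g y) a x) := by
    rw [← slide_vec hq]; abel
  have h3 := metricTr_braidOp hq m (fun s t => metricVec q m (g t) a s)
  have hN := metricTr_metricVec hq m (g a)
  simp only [h, metricTr_add, metricTr_sub, metricTr_smul, metricTr_metricVec_right hq] at h3 ⊢
  rw [show metricTr q (fun x y => braidOp q (fun s t => metricVec q m (g t) a s) x y) = _ from h3]
  linear_combination (norm := module) hN

/-- There are 27 kinds of index triples, each entry being first, inner or last. The rules above
reduce each one to size n; most then agree coefficient by coefficient, and the exceptions need the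
loop value, a sliding relation or the induction hypothesis. -/
theorem braid_relation (hq : 0 < q) (m : ℕ) (h : Fin m → Fin m → Fin m → M) :
    braid12 q (braid23 q (braid12 q h)) = braid23 q (braid12 q (braid23 q h)) := by
  have hq' : (q : ℂ) ≠ 0 := by exact_mod_cast hq.ne'
  induction m using inner_induction with
  | h0 => funext a; exact a.elim0
  | h1 => simp [funext_iff, braid12, braid23, braidOp_one hq]
  | h n ih =>
    have hp := edgeCoeff_ne_zero (n := n) hq
    have hN := fun v : M => metricTr_metricVec hq n v
    funext a b c
    rw [kap_eq hq] at hN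
    induction a using inner_cases <;> induction b using inner_cases <;>
      induction c using inner_cases <;>
    simp only [braid12, braid23, braidOp_zero_last _ hq, braidOp_last_zero _ hq,
      braidOp_inner_inner _ hq,
      braidOp_zero_zero _ hq, braidOp_last_last _ hq, braidOp_zero_inner _ hq,
      braidOp_inner_zero _ hq, braidOp_inner_last _ hq, braidOp_last_inner _ hq,
      metricTr_add, metricTr_sub, metricTr_smul, braidOp_add_apply, braidOp_sub_apply,
      braidOp_smul_apply, metricVec_add_apply, metricVec_sub_apply, metricVec_smul_apply,
      metricTr_metricVec_left hq, metricTr_metricVec_right hq, braid12_braid23_vec hq,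
      braid23_braid12_vec hq, tr12_braid23_braid12 hq, tr23_braid12_braid23 hq,
      tr12_braid23_vec hq, tr23_braid12_vec hq, metricTr_braidOp hq, braidOp_metricVec hq,
      braidOp_braidOp hq, kap_eq hq]
    case h.h0.h0.h2 =>
      linear_combination (norm := (match_scalars <;> field_simp <;> ring))
        (-((q : ℂ) - (q : ℂ)⁻¹) * ((q : ℂ) - (q : ℂ)⁻¹) * (edgeCoeff q n)⁻¹ * (edgeCoeff q n)⁻¹) •
          hN (h 0 0 (Fin.last (n + 1)))
    case h.h0.h2.h2 =>
      linear_combination (norm := (match_scalars <;> field_simp <;> ring))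
        (((q : ℂ) - (q : ℂ)⁻¹) * ((q : ℂ) - (q : ℂ)⁻¹) * (edgeCoeff q n)⁻¹ * (edgeCoeff q n)⁻¹) •
          hN (h 0 (Fin.last (n + 1)) (Fin.last (n + 1)))
    case h.h0.h1.h2 i =>
      linear_combination (norm := (match_scalars <;> field_simp <;> ring))
        (-((q : ℂ) - (q : ℂ)⁻¹) * (edgeCoeff q n)⁻¹) •
          slide_tr hq n (fun i j k => h (inner i) (inner j) (inner k)) i
    -- The inner block is the relation of size n; its corrections from the outer pair of indices
    -- match by sliding a cup.
    case h.h1.h1.h1 i j k =>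
      have h1 : braidOp q (fun x y => braidOp q (fun s t => braidOp q
            (fun i j => h (inner i) (inner j) (inner t)) x s) y k) i j =
          braidOp q (fun x y => braidOp q (fun s t => braidOp q
            (fun i j => h (inner s) (inner i) (inner j)) t y) i x) j k :=
        congrFun (congrFun (congrFun (ih (fun i j k => h (inner i) (inner j) (inner k))) i) j) k
      have h2 := slide_vec hq n (fun i => h 0 (inner i) (Fin.last (n + 1))) i j k
      linear_combination (norm := (match_scalars <;> field_simp <;> ring))
        h1 - (((q : ℂ) - (q : ℂ)⁻¹) * (edgeCoeff q n)⁻¹) • h2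
    all_goals match_scalars <;> field_simp <;> ring

/-! ### The inverse and the spectral projections of the braid matrix -/

/-- The action of the inverse braid matrix on two-index families of vectors. -/
noncomputable def braidInvOp (q : ℝ) (w : Fin m → Fin m → M) : Fin m → Fin m → M :=
  matOp (braidMatrix q m)⁻¹ w

/-- The matrix `C^{ij} C_{kl}`. -/
noncomputable def metricMatrix (q : ℝ) (m : ℕ) : Matrix (Fin m × Fin m) (Fin m × Fin m) ℝ :=
  fun a b => qMetric q m a.1 a.2 * qMetric q m b.1 b.2

theorem matOp_metricMatrix (w : Fin m → Fin m → M) :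
    matOp (metricMatrix q m) w = metricVec q m (metricTr q w) := by
  funext i j
  simp only [matOp_apply, metricMatrix, Complex.ofReal_mul, qMetric_cast, metricVec, metricTr]
  split_ifs with h
  · simp only [mul_ite, mul_zero, ite_smul, zero_smul, Finset.sum_ite_eq', Finset.sum_ite_eq,
      Finset.mem_univ, if_true, Finset.smul_sum, mul_smul]
  · simp

theorem braidOp_eq_matOp (w : Fin m → Fin m → M) : matOp (braidMatrix q m) w = braidOp q w := rfl

/-- The skein relation again, with the product R K replaced by q^(1-m) K. -/
theorem braidMatrix_mul_sub (hq : 0 < q) :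
    braidMatrix q m * (braidMatrix q m - (q - q⁻¹) • (1 - metricMatrix q m)) = 1 := by
  apply matOp_injective
  intro w
  funext i j
  simp only [matOp_mul, matOp_one, matOp_sub, matOp_smul, matOp_metricMatrix, braidOp_eq_matOp]
  have h1 := braidOp_braidOp hq m w i j
  have h2 := braidOp_metricVec hq m (metricTr q w) i j
  have h3 : braidOp q (braidOp q w - ((q - q⁻¹ : ℝ) : ℂ) • (w - metricVec q m (metricTr q w))) i j =
      braidOp q (braidOp q w) i j - ((q - q⁻¹ : ℝ) : ℂ) • (braidOp q w i j -
        braidOp q (metricVec q m (metricTr q w)) i j) := by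
    rw [← braidOp_sub_apply, ← braidOp_smul_apply, ← braidOp_sub_apply]
    rfl
  rw [h3, h1, h2]
  push_cast
  module

theorem isUnit_braidMatrix (hq : 0 < q) : IsUnit (braidMatrix q m).det :=
  (Matrix.isUnit_iff_isUnit_det _).mp (IsUnit.of_mul_eq_one _ (braidMatrix_mul_sub hq))

theorem braidMatrix_inv (hq : 0 < q) :
    (braidMatrix q m)⁻¹ = braidMatrix q m - (q - q⁻¹) • (1 - metricMatrix q m) :=
  Matrix.inv_eq_right_inv (braidMatrix_mul_sub hq)

theorem braidInvOp_apply (hq : 0 < q) (w : Fin m → Fin m → M) (i j : Fin m) :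
    braidInvOp q w i j = braidOp q w i j -
      ((q : ℂ) - (q : ℂ)⁻¹) • (w i j - metricVec q m (metricTr q w) i j) := by
  rw [braidInvOp, braidMatrix_inv hq]
  simp only [matOp_one, matOp_sub, matOp_smul, matOp_metricMatrix, braidOp_eq_matOp]
  simp

theorem braidOp_braidInvOp (hq : 0 < q) (w : Fin m → Fin m → M) :
    braidOp q (braidInvOp q w) = w := by
  rw [braidInvOp, braidOp, ← matOp_mul, Matrix.mul_nonsing_inv _ (isUnit_braidMatrix hq), matOp_one]

theorem kap_cast : ((q ^ (1 - (m : ℤ)) : ℝ) : ℂ) = kap q m := by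
  simp [kap]

theorem kap_ne_zero (hq : 0 < q) : kap q m ≠ 0 := zpow_ne_zero _ (by exact_mod_cast hq.ne')

theorem muConst_cast (hq : 0 < q) : ((muConst q m : ℝ) : ℂ) = 1 + q * kap q m := by
  have hq' : (q : ℂ) ≠ 0 := by exact_mod_cast hq.ne'
  rw [muConst, kap]
  push_cast
  rw [← zpow_one_add₀ hq']
  congr 2; ring

theorem muConst_pos (hq : 0 < q) : 0 < muConst q m := by
  have := zpow_pos hq (2 - (m : ℤ))
  unfold muConst; linarith

theorem muConst_ne_zero (hq : 0 < q) : (1 + q * kap q m : ℂ) ≠ 0 := by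
  rw [← muConst_cast hq]
  exact_mod_cast (muConst_pos hq).ne'

theorem antisym_const_ne_zero (hq : 0 < q) :
    ((q + q⁻¹) * (q⁻¹ + q ^ (1 - (m : ℤ))))⁻¹ ≠ 0 := by
  have := zpow_pos hq (1 - (m : ℤ))
  positivity

theorem matOp_antisymProj (hq : 0 < q) (w : Fin m → Fin m → M) (i j : Fin m) :
    matOp (antisymProj q m) w i j =
      ((((q + q⁻¹) * (q⁻¹ + q ^ (1 - (m : ℤ))))⁻¹ : ℝ) : ℂ) •
        ((1 + q * kap q m) • w i j - ((q : ℂ)⁻¹ + kap q m) • braidOp q w i j -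
          (((q : ℂ) - (q : ℂ)⁻¹) * kap q m) • metricVec q m (metricTr q w) i j) := by
  rw [antisymProj]
  simp only [matOp_smul, matOp_mul, matOp_sub, matOp_one, braidOp_eq_matOp, Pi.smul_apply]
  congr 1
  rw [kap_cast]
  simp only [Pi.sub_apply, Pi.smul_apply]
  rw [show braidOp q (braidOp q w - kap q m • w) i j =
      braidOp q (braidOp q w) i j - kap q m • braidOp q w i j by
    rw [← braidOp_smul_apply, ← braidOp_sub_apply]; rfl, braidOp_braidOp hq]
  module

/-- The families killed by the antisymmetric projection, in terms of the braid matrix. -/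
theorem braidOp_of_antisym (hq : 0 < q) {w : Fin m → Fin m → M}
    (h : matOp (antisymProj q m) w = 0) (i j : Fin m) :
    braidOp q w i j = (q : ℂ) • w i j -
      (kap q m * ((q : ℂ) ^ 2 - 1) / (1 + q * kap q m)) • metricVec q m (metricTr q w) i j := by
  have hq' : (q : ℂ) ≠ 0 := by exact_mod_cast hq.ne'
  have hmu := muConst_ne_zero (m := m) hq
  have h1 := congrFun (congrFun h i) j
  rw [matOp_antisymProj hq, Pi.zero_apply, Pi.zero_apply, smul_eq_zero_iff_right
    (by exact_mod_cast antisym_const_ne_zero hq)] at h1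
  -- This factor normalizes the coefficient q⁻¹ + q^(1-m) of `braidOp` to 1, so that the relation
  -- can be solved for it.
  have h2 := congrArg (fun v => (q / (1 + q * kap q m) : ℂ) • v) h1
  simp only [smul_zero] at h2
  linear_combination (norm := skip) (-1 : ℂ) • h2
  match_scalars <;> field_simp <;> ring

/-- Used for w = x^i x^j and w = ∂^i ∂^j f, whose traces are x² and Δf. If the trace vanishes, q R⁻¹
fixes w. -/
theorem braidInvOp_of_antisym (hq : 0 < q) {w : Fin m → Fin m → M}
    (h : matOp (antisymProj q m) w = 0) (i j : Fin m) :
    (q : ℂ) • braidInvOp q w i j = w i j +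
      (((q : ℂ) ^ 2 - 1) / (1 + q * kap q m)) • metricVec q m (metricTr q w) i j := by
  have hq' : (q : ℂ) ≠ 0 := by exact_mod_cast hq.ne'
  have hmu := muConst_ne_zero (m := m) hq
  rw [braidInvOp_apply hq, braidOp_of_antisym hq h]
  match_scalars <;> field_simp <;> ring

/-- On the range of 𝒫_A the braid matrix is -q⁻¹, so 𝒫_A (1 + q R) = 0. This is why the Leibniz rule
carries the factor q. -/
theorem matOp_antisymProj_one_add (hq : 0 < q) (w : Fin m → Fin m → M) :
    matOp (antisymProj q m) (w + (q : ℂ) • braidOp q w) = 0 := by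
  have hq' : (q : ℂ) ≠ 0 := by exact_mod_cast hq.ne'
  funext i j
  rw [map_add, map_smul, Pi.add_apply, Pi.add_apply, Pi.smul_apply, Pi.smul_apply,
    matOp_antisymProj hq, matOp_antisymProj hq, braidOp_braidOp hq, metricTr_braidOp hq,
    metricVec_smul_apply, smul_comm (q : ℂ), ← smul_add]
  rw [Pi.zero_apply, Pi.zero_apply]
  refine smul_eq_zero_of_right _ ?_
  match_scalars <;> field_simp <;> ring

/-! ### Three indices -/

/-- A matrix acting on the first two of three indices. -/
noncomputable def mat12 (A : Matrix (Fin m × Fin m) (Fin m × Fin m) ℝ) :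
    (Fin m → Fin m → Fin m → M) →ₗ[ℂ] (Fin m → Fin m → Fin m → M) where
  toFun h := fun i j k => matOp A (fun a b => h a b k) i j
  map_add' h h' := by
    funext i j k
    exact congrFun (congrFun (map_add (matOp A) (fun a b => h a b k) (fun a b => h' a b k)) i) j
  map_smul' t h := by
    funext i j k
    exact congrFun (congrFun (map_smul (matOp A) t (fun a b => h a b k)) i) j

/-- A matrix acting on the last two of three indices. -/
noncomputable def mat23 (A : Matrix (Fin m × Fin m) (Fin m × Fin m) ℝ) :
    (Fin m → Fin m → Fin m → M) →ₗ[ℂ] (Fin m → Fin m → Fin m → M) where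
  toFun h := fun i => matOp A (h i)
  map_add' h h' := by
    funext i
    exact map_add (matOp A) (h i) (h' i)
  map_smul' t h := by
    funext i
    exact map_smul (matOp A) t (h i)

theorem mat12_apply (A : Matrix (Fin m × Fin m) (Fin m × Fin m) ℝ) (h : Fin m → Fin m → Fin m → M)
    (i j k : Fin m) : mat12 A h i j k = matOp A (fun a b => h a b k) i j := rfl

theorem mat23_apply (A : Matrix (Fin m × Fin m) (Fin m × Fin m) ℝ) (h : Fin m → Fin m → Fin m → M)
    (i j k : Fin m) : mat23 A h i j k = matOp A (h i) j k := rfl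

section
variable (A A' : Matrix (Fin m × Fin m) (Fin m × Fin m) ℝ) (h : Fin m → Fin m → Fin m → M)

theorem mat12_mul : mat12 (A * A') h = mat12 A (mat12 A' h) := by
  funext i j k; simp only [mat12_apply, matOp_mul]
theorem mat23_mul : mat23 (A * A') h = mat23 A (mat23 A' h) := by
  funext i j k; simp only [mat23_apply, matOp_mul]; rfl
theorem mat12_sub : mat12 (A - A') h = mat12 A h - mat12 A' h := by
  funext i j k; simp only [mat12_apply, matOp_sub, Pi.sub_apply]
theorem mat23_sub : mat23 (A - A') h = mat23 A h - mat23 A' h := by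
  funext i j k; simp only [mat23_apply, matOp_sub, Pi.sub_apply]
theorem mat12_smul (t : ℝ) : mat12 (t • A) h = (t : ℂ) • mat12 A h := by
  funext i j k; simp only [mat12_apply, matOp_smul, Pi.smul_apply]
theorem mat23_smul (t : ℝ) : mat23 (t • A) h = (t : ℂ) • mat23 A h := by
  funext i j k; simp only [mat23_apply, matOp_smul, Pi.smul_apply]
theorem mat12_one : mat12 (1 : Matrix (Fin m × Fin m) (Fin m × Fin m) ℝ) h = h := by
  funext i j k; simp only [mat12_apply, matOp_one]
theorem mat23_one : mat23 (1 : Matrix (Fin m × Fin m) (Fin m × Fin m) ℝ) h = h := by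
  funext i j k; simp only [mat23_apply, matOp_one]
end

theorem mat12_inv_mat12 (hq : 0 < q) (h : Fin m → Fin m → Fin m → M) :
    mat12 (braidMatrix q m)⁻¹ (mat12 (braidMatrix q m) h) = h := by
  rw [← mat12_mul, Matrix.nonsing_inv_mul _ (isUnit_braidMatrix hq), mat12_one]

theorem mat23_inv_mat23 (hq : 0 < q) (h : Fin m → Fin m → Fin m → M) :
    mat23 (braidMatrix q m)⁻¹ (mat23 (braidMatrix q m) h) = h := by
  rw [← mat23_mul, Matrix.nonsing_inv_mul _ (isUnit_braidMatrix hq), mat23_one]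

theorem mat12_mat12_inv (hq : 0 < q) (h : Fin m → Fin m → Fin m → M) :
    mat12 (braidMatrix q m) (mat12 (braidMatrix q m)⁻¹ h) = h := by
  rw [← mat12_mul, Matrix.mul_nonsing_inv _ (isUnit_braidMatrix hq), mat12_one]

theorem mat23_mat23_inv (hq : 0 < q) (h : Fin m → Fin m → Fin m → M) :
    mat23 (braidMatrix q m) (mat23 (braidMatrix q m)⁻¹ h) = h := by
  rw [← mat23_mul, Matrix.mul_nonsing_inv _ (isUnit_braidMatrix hq), mat23_one]

theorem mat_braid (hq : 0 < q) (h : Fin m → Fin m → Fin m → M) :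
    mat12 (braidMatrix q m) (mat23 (braidMatrix q m) (mat12 (braidMatrix q m) h)) =
      mat23 (braidMatrix q m) (mat12 (braidMatrix q m) (mat23 (braidMatrix q m) h)) :=
  braid_relation hq m h

/-- The braid relation lets R₁₂⁻¹R₂₃⁻¹ intertwine R₁₂ with R₂₃, hence also polynomials in them, of
which 𝒫_A is one. -/
theorem mat23_antisymProj_intertwine (hq : 0 < q) (h : Fin m → Fin m → Fin m → M) :
    mat23 (antisymProj q m) (mat12 (braidMatrix q m)⁻¹ (mat23 (braidMatrix q m)⁻¹ h)) =
      mat12 (braidMatrix q m)⁻¹ (mat23 (braidMatrix q m)⁻¹ (mat12 (antisymProj q m) h)) := by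
  have key (h : Fin m → Fin m → Fin m → M) :
      mat23 (braidMatrix q m) (mat12 (braidMatrix q m)⁻¹ (mat23 (braidMatrix q m)⁻¹ h)) =
      mat12 (braidMatrix q m)⁻¹ (mat23 (braidMatrix q m)⁻¹ (mat12 (braidMatrix q m) h)) := by
    have h1 := mat_braid hq (mat12 (braidMatrix q m)⁻¹ (mat23 (braidMatrix q m)⁻¹ h))
    rw [mat12_mat12_inv hq, mat23_mat23_inv hq] at h1
    rw [h1, mat23_inv_mat23 hq, mat12_inv_mat12 hq]
  rw [antisymProj]
  simp only [mat23_smul, mat12_smul, mat12_mul, mat23_mul, mat12_sub, mat23_sub, mat12_one,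
    mat23_one, map_sub, map_smul, key]

theorem mat12_antisymProj_intertwine (hq : 0 < q) (h : Fin m → Fin m → Fin m → M) :
    mat12 (antisymProj q m) (mat23 (braidMatrix q m)⁻¹ (mat12 (braidMatrix q m)⁻¹ h)) =
      mat23 (braidMatrix q m)⁻¹ (mat12 (braidMatrix q m)⁻¹ (mat23 (antisymProj q m) h)) := by
  have key (h : Fin m → Fin m → Fin m → M) :
      mat12 (braidMatrix q m) (mat23 (braidMatrix q m)⁻¹ (mat12 (braidMatrix q m)⁻¹ h)) =
      mat23 (braidMatrix q m)⁻¹ (mat12 (braidMatrix q m)⁻¹ (mat23 (braidMatrix q m) h)) := by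
    have h1 := mat_braid hq (mat23 (braidMatrix q m)⁻¹ (mat12 (braidMatrix q m)⁻¹ h))
    rw [mat23_mat23_inv hq, mat12_mat12_inv hq] at h1
    rw [← h1, mat12_inv_mat12 hq, mat23_inv_mat23 hq]
  rw [antisymProj]
  simp only [mat23_smul, mat12_smul, mat12_mul, mat23_mul, mat12_sub, mat23_sub, mat12_one,
    mat23_one, map_sub, map_smul, key]

/-- The family `v^i C^{jk}`. -/
noncomputable def vecMetric (q : ℝ) (g : Fin m → M) : Fin m → Fin m → Fin m → M :=
  fun i j k => metricVec q m (g i) j k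

/-- The family `C^{ij} v^k`. -/
noncomputable def metricVecR (q : ℝ) (g : Fin m → M) : Fin m → Fin m → Fin m → M :=
  fun i j k => metricVec q m (g k) i j

/-- Contraction of the first two of three indices. -/
noncomputable def tr12 (q : ℝ) (h : Fin m → Fin m → Fin m → M) : Fin m → M :=
  fun k => metricTr q (fun i j => h i j k)

/-- Contraction of the last two of three indices. -/
noncomputable def tr23 (q : ℝ) (h : Fin m → Fin m → Fin m → M) : Fin m → M :=
  fun i => metricTr q (h i)

theorem tr12_add (h h' : Fin m → Fin m → Fin m → M) : tr12 q (h + h') = tr12 q h + tr12 q h' := by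
  funext k; exact metricTr_add _ _
theorem tr23_add (h h' : Fin m → Fin m → Fin m → M) : tr23 q (h + h') = tr23 q h + tr23 q h' := by
  funext k; exact metricTr_add _ _
theorem tr12_smul (t : ℂ) (h : Fin m → Fin m → Fin m → M) : tr12 q (t • h) = t • tr12 q h := by
  funext k; exact metricTr_smul _ _
theorem tr23_smul (t : ℂ) (h : Fin m → Fin m → Fin m → M) : tr23 q (t • h) = t • tr23 q h := by
  funext k; exact metricTr_smul _ _

theorem tr12_vecMetric (hq : 0 < q) (g : Fin m → M) : tr12 q (vecMetric q g) = g := by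
  funext k; exact metricTr_metricVec_left hq g k

theorem tr23_metricVecR (hq : 0 < q) (g : Fin m → M) : tr23 q (metricVecR q g) = g := by
  funext k; exact metricTr_metricVec_right hq g k

theorem tr12_mat12 (hq : 0 < q) (h : Fin m → Fin m → Fin m → M) :
    tr12 q (mat12 (braidMatrix q m) h) = kap q m • tr12 q h := by
  funext k; exact metricTr_braidOp hq m _

theorem tr23_mat23 (hq : 0 < q) (h : Fin m → Fin m → Fin m → M) :
    tr23 q (mat23 (braidMatrix q m) h) = kap q m • tr23 q h := by
  funext k; exact metricTr_braidOp hq m _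

/-- `slide_vec` in its natural form, now that R is known to be invertible. The next three lemmas are
its variants for cups and caps. -/
theorem mat12_inv_vecMetric (hq : 0 < q) (g : Fin m → M) :
    mat12 (braidMatrix q m)⁻¹ (vecMetric q g) = mat23 (braidMatrix q m) (metricVecR q g) := by
  funext i j k
  have h1 := slide_vec hq m g i j k
  have h2 := braidInvOp_apply hq (fun a b => vecMetric q g a b k) i j
  rw [show metricTr q (fun a b => vecMetric q g a b k) = g k from metricTr_metricVec_left hq g k]
    at h2
  rw [mat12_apply, mat23_apply]
  refine h2.trans ?_
  linear_combination (norm := (unfold vecMetric metricVecR braidOp; module)) h1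

theorem mat23_inv_metricVecR (hq : 0 < q) (g : Fin m → M) :
    mat23 (braidMatrix q m)⁻¹ (metricVecR q g) = mat12 (braidMatrix q m) (vecMetric q g) := by
  funext i j k
  have h1 := slide_vec hq m g i j k
  have h2 := braidInvOp_apply hq (metricVecR q g i) j k
  rw [show metricTr q (metricVecR q g i) = g i from metricTr_metricVec_right hq g i] at h2
  rw [mat12_apply, mat23_apply]
  refine h2.trans ?_
  linear_combination (norm := (unfold vecMetric metricVecR braidOp; module)) -h1

theorem tr23_mat12_inv (hq : 0 < q) (h : Fin m → Fin m → Fin m → M) :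
    tr23 q (mat12 (braidMatrix q m)⁻¹ h) = tr12 q (mat23 (braidMatrix q m) h) := by
  funext a
  have h1 := slide_tr hq m h a
  have h2 (k l : Fin m) := braidInvOp_apply hq (fun x y => h x y l) a k
  rw [show tr23 q (mat12 (braidMatrix q m)⁻¹ h) a =
    metricTr q (fun k l => braidInvOp q (fun x y => h x y l) a k) from rfl]
  simp only [h2, metricTr_sub, metricTr_smul,
    metricTr_metricVec_right hq (fun l => metricTr q (fun x y => h x y l))]
  rw [show tr12 q (mat23 (braidMatrix q m) h) a =
    metricTr q (fun k l => braidOp q (h k) l a) from rfl]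
  linear_combination (norm := module) h1

theorem tr12_mat23_inv (hq : 0 < q) (h : Fin m → Fin m → Fin m → M) :
    tr12 q (mat23 (braidMatrix q m)⁻¹ h) = tr23 q (mat12 (braidMatrix q m) h) := by
  funext a
  have h1 := slide_tr hq m h a
  have h2 (k l : Fin m) := braidInvOp_apply hq (h k) l a
  rw [show tr12 q (mat23 (braidMatrix q m)⁻¹ h) a =
    metricTr q (fun k l => braidInvOp q (h k) l a) from rfl]
  simp only [h2, metricTr_sub, metricTr_smul,
    metricTr_metricVec_left hq (fun k => metricTr q (h k))]
  rw [show tr23 q (mat12 (braidMatrix q m) h) a =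
    metricTr q (fun k l => braidOp q (fun x y => h x y l) a k) from rfl]
  linear_combination (norm := module) -h1

/-! ### The partial derivatives -/

theorem submodule_eq_top_of_mul_mem (S : Submodule ℂ (QPoly q m)) (h1 : 1 ∈ S)
    (hx : ∀ i, ∀ f ∈ S, qCoord q m i * f ∈ S) : S = ⊤ := by
  have key (a : FreeAlgebra ℂ (Fin m)) :
      ∀ f ∈ S, RingQuot.mkAlgHom ℂ (QEuclidRel q m) a * f ∈ S := by
    induction a using FreeAlgebra.induction with
    | grade0 r =>
      intro f hf
      rw [AlgHom.commutes, ← Algebra.smul_def]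
      exact S.smul_mem _ hf
    | grade1 i => exact hx i
    | mul a b ha hb =>
      intro f hf
      rw [map_mul, mul_assoc]
      exact ha _ (hb _ hf)
    | add a b ha hb =>
      intro f hf
      rw [map_add, add_mul]
      exact S.add_mem (ha _ hf) (hb _ hf)
  rw [eq_top_iff]
  rintro f -
  obtain ⟨a, rfl⟩ := RingQuot.mkAlgHom_surjective ℂ (QEuclidRel q m) f
  simpa using key a 1 h1

/-- Linear maps on `𝒫` are determined by their value at `1` and on products `x^i f`. -/
theorem qPoly_ext {φ ψ : QPoly q m →ₗ[ℂ] M} (h1 : φ 1 = ψ 1)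
    (hx : ∀ f, φ f = ψ f → ∀ i, φ (qCoord q m i * f) = ψ (qCoord q m i * f)) : φ = ψ := by
  have := submodule_eq_top_of_mul_mem (LinearMap.eqLocus φ ψ) h1 (fun i f hf => hx f hf i)
  exact LinearMap.eqLocus_eq_top.mp this

theorem map_metricVec {M' : Type*} [AddCommGroup M'] [Module ℂ M'] (φ : M →ₗ[ℂ] M') (v : M)
    (i j : Fin m) : φ (metricVec q m v i j) = metricVec q m (φ v) i j := by
  unfold metricVec; split_ifs <;> simp

theorem map_metricTr {M' : Type*} [AddCommGroup M'] [Module ℂ M'] (φ : M →ₗ[ℂ] M')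
    (w : Fin m → Fin m → M) : φ (metricTr q w) = metricTr q (fun i j => φ (w i j)) := by
  simp [metricTr]

theorem matOp_antisymProj_coord :
    matOp (antisymProj q m) (fun k l => qCoord q m k * qCoord q m l) = 0 := by
  funext i j
  have h := RingQuot.mkAlgHom_rel ℂ (s := QEuclidRel q m) ⟨i, j, rfl, rfl⟩
  rw [map_zero, map_sum] at h
  rw [Pi.zero_apply, Pi.zero_apply, matOp_apply, ← h]
  refine Finset.sum_congr rfl fun k _ => ?_
  rw [map_sum]
  refine Finset.sum_congr rfl fun l _ => ?_
  rw [map_smul, map_mul]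
  rfl

theorem matOp_antisymProj_coord_mul (g : QPoly q m) :
    matOp (antisymProj q m) (fun k l => qCoord q m k * (qCoord q m l * g)) = 0 := by
  funext i j
  have h := matOp_map (LinearMap.mulRight ℂ g) (antisymProj q m)
    (fun k l => qCoord q m k * qCoord q m l) i j
  rw [matOp_antisymProj_coord] at h
  simp only [LinearMap.mulRight_apply, mul_assoc] at h
  rw [← h]
  simp

theorem mat12_antisymProj_coord (g : Fin m → QPoly q m) :
    mat12 (antisymProj q m) (fun i j k => qCoord q m i * (qCoord q m j * g k)) = 0 := by
  funext i j k
  exact congrFun (congrFun (matOp_antisymProj_coord_mul (g k)) i) j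

theorem mul_metricVec (a v : QPoly q m) (i j : Fin m) :
    a * metricVec q m v i j = metricVec q m (a * v) i j :=
  map_metricVec (LinearMap.mulLeft ℂ a) v i j

theorem mul_matOp (A : Matrix (Fin m × Fin m) (Fin m × Fin m) ℝ) (a : QPoly q m)
    (w : Fin m → Fin m → QPoly q m) (i j : Fin m) :
    a * matOp A w i j = matOp A (fun k l => a * w k l) i j :=
  matOp_map (LinearMap.mulLeft ℂ a) A w i j

/-- The components of the defining relation of the partial derivatives. -/
noncomputable def leibnizVec (f : QPoly q m) (v : Fin m → QPoly q m) :
    Fin m → Fin m → QPoly q m :=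
  metricVec q m f + (q : ℂ) • matOp (braidMatrix q m)⁻¹ (fun k l => qCoord q m k * v l)

theorem metricVec_add (v v' : M) : metricVec q m (v + v') = metricVec q m v + metricVec q m v' := by
  funext i j; exact metricVec_add_apply v v' i j

theorem metricVec_smul (t : ℂ) (v : M) : metricVec q m (t • v) = t • metricVec q m v := by
  funext i j; exact metricVec_smul_apply t v i j

theorem leibnizVec_add (f f' : QPoly q m) (v v' : Fin m → QPoly q m) :
    leibnizVec (f + f') (v + v') = leibnizVec f v + leibnizVec f' v' := by
  have : (fun k l => qCoord q m k * (v + v') l) =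
      (fun k l => qCoord q m k * v l) + fun k l => qCoord q m k * v' l := by
    funext k l; exact mul_add _ _ _
  unfold leibnizVec
  rw [this, map_add, metricVec_add, smul_add]
  abel

theorem leibnizVec_smul (t : ℂ) (f : QPoly q m) (v : Fin m → QPoly q m) :
    leibnizVec (t • f) (t • v) = t • leibnizVec f v := by
  have : (fun k l => qCoord q m k * (t • v) l) = t • (fun k l => qCoord q m k * v l) := by
    funext k l; simp only [Pi.smul_apply, mul_smul_comm]
  unfold leibnizVec
  rw [this, map_smul, metricVec_smul, smul_add, smul_comm t]

/-- The joint action of multiplication by `x^j` on a polynomial and its derivatives. -/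
noncomputable def jetMul (q : ℝ) (m : ℕ) (j : Fin m) :
    Module.End ℂ (QPoly q m × (Fin m → QPoly q m)) where
  toFun p := (qCoord q m j * p.1, fun i => leibnizVec p.1 p.2 i j)
  map_add' p p' := Prod.ext (mul_add _ _ _)
    (funext fun i => congrFun (congrFun (leibnizVec_add p.1 p'.1 p.2 p'.2) i) j)
  map_smul' t p := Prod.ext (mul_smul_comm _ _ _)
    (funext fun i => congrFun (congrFun (leibnizVec_smul t p.1 p.2) i) j)

/-- The expansion of ∂^i x^j x^k f with v^l in the place of ∂^l f. It is stated for arbitrary v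
because it is needed before the derivatives exist. -/
theorem leibnizVec_leibnizVec (f : QPoly q m) (v : Fin m → QPoly q m) :
    (fun i j k => leibnizVec (qCoord q m k * f) (fun t => leibnizVec f v t k) i j) =
      metricVecR q (fun k => qCoord q m k * f) +
      (q : ℂ) • mat12 (braidMatrix q m)⁻¹ (vecMetric q (fun k => qCoord q m k * f)) +
      ((q : ℂ) * q) • mat12 (braidMatrix q m)⁻¹ (mat23 (braidMatrix q m)⁻¹
        (fun i j k => qCoord q m i * (qCoord q m j * v k))) := by
  have h : (fun i j k => qCoord q m i * leibnizVec f v j k) =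
      vecMetric q (fun k => qCoord q m k * f) + (q : ℂ) • mat23 (braidMatrix q m)⁻¹
        (fun i j k => qCoord q m i * (qCoord q m j * v k)) := by
    funext i j k
    simp only [leibnizVec, Pi.add_apply, Pi.smul_apply, mul_add, mul_smul_comm, mul_metricVec,
      mul_matOp, vecMetric, mat23_apply]
  have h2 : mat12 (braidMatrix q m)⁻¹ (fun i j k => qCoord q m i * leibnizVec f v j k) =
      mat12 (braidMatrix q m)⁻¹ (vecMetric q (fun k => qCoord q m k * f)) +
      (q : ℂ) • mat12 (braidMatrix q m)⁻¹ (mat23 (braidMatrix q m)⁻¹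
        (fun i j k => qCoord q m i * (qCoord q m j * v k))) := by
    rw [h, map_add, map_smul]
  rw [add_assoc, mul_smul, ← smul_add, ← h2]
  rfl

/-- The Leibniz rule respects the relations. In the last term of the expansion 𝒫_A moves onto x^i
x^j and gives 0; the first two combine, by sliding, into (1 + q R₂₃)(C ⊗ x f). -/
theorem mat23_antisymProj_leibniz (hq : 0 < q) (f : QPoly q m) (v : Fin m → QPoly q m) :
    mat23 (antisymProj q m)
      (fun i j k => leibnizVec (qCoord q m k * f) (fun t => leibnizVec f v t k) i j) = 0 := by
  rw [leibnizVec_leibnizVec, map_add, map_smul, mat23_antisymProj_intertwine hq,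
    mat12_antisymProj_coord, map_zero, map_zero, smul_zero, add_zero, mat12_inv_vecMetric hq]
  funext i
  exact matOp_antisymProj_one_add hq _

/-- The action of `𝒫` on polynomials together with their derivatives. -/
noncomputable def jetHom (q : ℝ) (m : ℕ) (hq : 0 < q) :
    QPoly q m →ₐ[ℂ] Module.End ℂ (QPoly q m × (Fin m → QPoly q m)) :=
  RingQuot.liftAlgHom ℂ ⟨FreeAlgebra.lift ℂ (jetMul q m), by
    rintro a b ⟨i, j, rfl, rfl⟩
    refine LinearMap.ext fun p => ?_
    simp only [map_sum, map_smul, map_mul, FreeAlgebra.lift_ι_apply, map_zero,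
      LinearMap.zero_apply, LinearMap.sum_apply, LinearMap.smul_apply, Module.End.mul_apply]
    change matOp (antisymProj q m) (fun k l => jetMul q m k (jetMul q m l p)) i j = 0
    refine Prod.ext ?_ (funext fun t => ?_)
    · refine (matOp_map (LinearMap.fst ℂ (QPoly q m) (Fin m → QPoly q m)) _ _ i j).trans ?_
      exact congrFun (congrFun (matOp_antisymProj_coord_mul p.1) i) j
    · refine (matOp_map (LinearMap.proj (φ := fun _ => QPoly q m) t ∘ₗ
        LinearMap.snd ℂ (QPoly q m) (Fin m → QPoly q m)) _ _ i j).trans ?_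
      exact congrFun (congrFun (congrFun (mat23_antisymProj_leibniz hq p.1 p.2) t) i) j⟩

theorem jetHom_coord (hq : 0 < q) (i : Fin m) : jetHom q m hq (qCoord q m i) = jetMul q m i := by
  unfold jetHom qCoord
  rw [RingQuot.liftAlgHom_mkAlgHom_apply, FreeAlgebra.lift_ι_apply]

theorem jetHom_fst (hq : 0 < q) (f : QPoly q m) (p : QPoly q m × (Fin m → QPoly q m)) :
    (jetHom q m hq f p).1 = f * p.1 := by
  have : LinearMap.fst ℂ (QPoly q m) (Fin m → QPoly q m) ∘ₗ LinearMap.applyₗ p ∘ₗ (jetHom q m hq).toLinearMap =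
      LinearMap.mulRight ℂ p.1 := by
    apply qPoly_ext
    · simp
    · intro f hf i
      simp only [LinearMap.comp_apply, LinearMap.applyₗ_apply_apply, AlgHom.toLinearMap_apply,
        LinearMap.fst_apply, LinearMap.mulRight_apply, map_mul, Module.End.mul_apply,
        jetHom_coord] at hf ⊢
      rw [mul_assoc, ← hf]
      rfl
  exact LinearMap.congr_fun this f

theorem isPartials_iff {d : Fin m → (QPoly q m →ₗ[ℂ] QPoly q m)} :
    IsPartials q m d ↔ (∀ i, d i 1 = 0) ∧
      ∀ i j f, d i (qCoord q m j * f) = leibnizVec f (fun l => d l f) i j := by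
  unfold IsPartials
  refine and_congr_right fun _ => forall_congr' fun i => forall_congr' fun j =>
    forall_congr' fun f => ?_
  have : leibnizVec f (fun l => d l f) i j = ((qMetric q m i j : ℝ) : ℂ) • f +
        ∑ k, ∑ l, ((q * (braidMatrix q m)⁻¹ (i, j) (k, l) : ℝ) : ℂ) • (qCoord q m k * d l f) := by
    simp only [leibnizVec, Pi.add_apply, Pi.smul_apply, matOp_apply, metricVec, qMetric_cast,
      Finset.smul_sum, ← mul_smul, Complex.ofReal_mul, ite_smul, zero_smul]
  rw [this]

theorem isPartials_unique {d d' : Fin m → (QPoly q m →ₗ[ℂ] QPoly q m)} (hd : IsPartials q m d)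
    (hd' : IsPartials q m d') : d = d' := by
  rw [isPartials_iff] at hd hd'
  have : LinearMap.pi d = LinearMap.pi d' := by
    apply qPoly_ext
    · funext i; simp [hd.1, hd'.1]
    · intro f hf j
      funext i
      have h (l) : d l f = d' l f := congrFun hf l
      simp [hd.2, hd'.2, h]
  funext i
  exact LinearMap.ext fun f => congrFun (LinearMap.congr_fun this f) i

theorem existsUnique_isPartials (hq : 0 < q) : ∃! d, IsPartials q m d := by
  -- The action of f on the jet (1, 0) of the constant 1 gives the jet of f; its second component is
  -- the family of derivatives.
  refine ⟨fun i => LinearMap.proj i ∘ₗ LinearMap.snd ℂ _ _ ∘ₗ LinearMap.applyₗ (1, 0) ∘ₗ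
    (jetHom q m hq).toLinearMap, isPartials_iff.mpr ⟨fun i => ?_, fun i j f => ?_⟩,
    fun d hd => isPartials_unique hd (isPartials_iff.mpr ⟨fun i => ?_, fun i j f => ?_⟩)⟩
  all_goals
    simp only [LinearMap.comp_apply, LinearMap.applyₗ_apply_apply, AlgHom.toLinearMap_apply,
      LinearMap.snd_apply, map_mul, Module.End.mul_apply, jetHom_coord, LinearMap.proj_apply,
      map_one, Module.End.one_apply, Pi.zero_apply]
  all_goals
    change leibnizVec _ _ i j = _
    rw [jetHom_fst, mul_one]

theorem qPartial_spec (hq : 0 < q) : IsPartials q m (qPartial q m) :=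
  Classical.epsilon_spec (existsUnique_isPartials hq).exists

theorem qPartial_one (hq : 0 < q) (i : Fin m) : qPartial q m i 1 = 0 := (qPartial_spec hq).1 i

theorem qPartial_coord_mul (hq : 0 < q) (i j : Fin m) (f : QPoly q m) :
    qPartial q m i (qCoord q m j * f) = leibnizVec f (fun l => qPartial q m l f) i j :=
  (isPartials_iff.mp (qPartial_spec hq)).2 i j f

/-! ### The Laplace and Euler operators -/

theorem normSqElt_eq : normSqElt q m = metricTr q (fun i j => qCoord q m i * qCoord q m j) := by
  simp [normSqElt, metricTr, qMetric_cast]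

theorem normSqElt_mul (f : QPoly q m) :
    normSqElt q m * f = metricTr q (fun i j => qCoord q m i * (qCoord q m j * f)) := by
  rw [normSqElt_eq]
  have := map_metricTr (q := q) (LinearMap.mulRight ℂ f) (fun i j => qCoord q m i * qCoord q m j)
  simpa only [LinearMap.mulRight_apply, mul_assoc] using this

theorem qLaplace_apply (f : QPoly q m) :
    qLaplace q m f = metricTr q (fun i j => qPartial q m i (qPartial q m j f)) := by
  simp [qLaplace, metricTr, qMetric_cast, LinearMap.sum_apply]

/-- The Euler operator `x^i C_{ij} ∂^j`. -/
noncomputable def euler (q : ℝ) (m : ℕ) : Module.End ℂ (QPoly q m) :=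
  ∑ i, metricCoeff q m i • (LinearMap.mulLeft ℂ (qCoord q m i) ∘ₗ qPartial q m i.rev)

theorem euler_apply (f : QPoly q m) :
    euler q m f = metricTr q (fun i j => qCoord q m i * qPartial q m j f) := by
  simp [euler, metricTr, LinearMap.sum_apply]

theorem mul_metricTr (a : QPoly q m) (w : Fin n → Fin n → QPoly q m) :
    a * metricTr q w = metricTr q (fun i j => a * w i j) :=
  map_metricTr (LinearMap.mulLeft ℂ a) w

/-- The contraction of the expansion of ∂^i x^j x^k f over j, k: sliding makes every braid matrix
act on the metric or cancel its inverse. -/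
theorem qPartial_normSqElt_mul (hq : 0 < q) (i : Fin m) (f : QPoly q m) :
    qPartial q m i (normSqElt q m * f) = (1 + q * kap q m) • (qCoord q m i * f) +
      ((q : ℂ) * q) • (normSqElt q m * qPartial q m i f) := by
  have h1 : qPartial q m i (normSqElt q m * f) =
      tr23 q (fun i j k => leibnizVec (qCoord q m k * f)
        (fun t => leibnizVec f (fun l => qPartial q m l f) t k) i j) i := by
    rw [normSqElt_mul, map_metricTr]
    simp only [qPartial_coord_mul hq]
    rfl
  rw [h1, leibnizVec_leibnizVec, tr23_add, tr23_add, tr23_smul, tr23_smul,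
    mat12_inv_vecMetric hq, tr23_mat23 hq, tr23_metricVecR hq, tr23_mat12_inv hq,
    mat23_mat23_inv hq]
  have h2 : tr12 q (fun i j k => qCoord q m i * (qCoord q m j * qPartial q m k f)) i =
      normSqElt q m * qPartial q m i f := by
    rw [normSqElt_mul]; rfl
  simp only [Pi.add_apply, Pi.smul_apply, h2]
  module

theorem qPartial_qPartial_coord_mul (hq : 0 < q) (f : QPoly q m) :
    (fun i j k => qPartial q m i (qPartial q m j (qCoord q m k * f))) =
      vecMetric q (fun i => qPartial q m i f) +
      (q : ℂ) • mat23 (braidMatrix q m)⁻¹ (metricVecR q (fun i => qPartial q m i f)) +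
      ((q : ℂ) * q) • mat23 (braidMatrix q m)⁻¹ (mat12 (braidMatrix q m)⁻¹
        (fun i j k => qCoord q m i * qPartial q m j (qPartial q m k f))) := by
  have h : (fun i a b => qPartial q m i (qCoord q m a * qPartial q m b f)) =
      metricVecR q (fun i => qPartial q m i f) + (q : ℂ) • mat12 (braidMatrix q m)⁻¹
        (fun i j k => qCoord q m i * qPartial q m j (qPartial q m k f)) := by
    funext i a b
    rw [qPartial_coord_mul hq]
    rfl
  have h2 : mat23 (braidMatrix q m)⁻¹
      (fun i a b => qPartial q m i (qCoord q m a * qPartial q m b f)) =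
      mat23 (braidMatrix q m)⁻¹ (metricVecR q (fun i => qPartial q m i f)) +
      (q : ℂ) • mat23 (braidMatrix q m)⁻¹ (mat12 (braidMatrix q m)⁻¹
        (fun i j k => qCoord q m i * qPartial q m j (qPartial q m k f))) := by
    rw [h, map_add, map_smul]
  rw [add_assoc, mul_smul, ← smul_add, ← h2]
  funext i j k
  simp only [qPartial_coord_mul hq j, leibnizVec, Pi.add_apply, Pi.smul_apply, map_add, map_smul,
    map_metricVec, matOp_map]
  rfl

/-- The derivatives satisfy the relations of the coordinates, so h(∂) makes sense for h in 𝒫. The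
argument mirrors `mat23_antisymProj_leibniz`, by induction on the degree. -/
theorem matOp_antisymProj_qPartial (hq : 0 < q) (f : QPoly q m) :
    matOp (antisymProj q m) (fun i j => qPartial q m i (qPartial q m j f)) = 0 := by
  let φ : QPoly q m →ₗ[ℂ] (Fin m → Fin m → QPoly q m) := matOp (antisymProj q m) ∘ₗ
    LinearMap.pi fun i => LinearMap.pi fun j => qPartial q m i ∘ₗ qPartial q m j
  have : φ = 0 := by
    apply qPoly_ext
    · have : (fun i j => qPartial q m i (qPartial q m j 1)) = 0 := by
        funext i j; simp [qPartial_one hq]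
      change matOp (antisymProj q m) (fun i j => qPartial q m i (qPartial q m j 1)) = 0
      rw [this, map_zero]
    · intro f hf k
      funext i j
      change mat12 (antisymProj q m)
        (fun i j k => qPartial q m i (qPartial q m j (qCoord q m k * f))) i j k = 0
      rw [qPartial_qPartial_coord_mul hq, map_add, map_add, map_smul, map_smul,
        mat12_antisymProj_intertwine hq]
      have h1 : mat23 (antisymProj q m)
          (fun i j k => qCoord q m i * qPartial q m j (qPartial q m k f)) = 0 := by
        funext a b c
        have := mul_matOp (antisymProj q m) (qCoord q m a)
          (fun j k => qPartial q m j (qPartial q m k f)) b c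
        rw [mat23_apply, ← this, show matOp (antisymProj q m)
          (fun j k => qPartial q m j (qPartial q m k f)) = 0 from hf]
        simp
      rw [h1, map_zero, map_zero, smul_zero, add_zero, mat23_inv_metricVecR hq]
      have h2 := matOp_antisymProj_one_add hq
        (fun a b => vecMetric q (fun i => qPartial q m i f) a b k)
      rw [map_add, map_smul] at h2
      exact congrFun (congrFun h2 i) j
  exact LinearMap.congr_fun this f

theorem qLaplace_coord_mul (hq : 0 < q) (k : Fin m) (f : QPoly q m) :
    qLaplace q m (qCoord q m k * f) = (1 + q * kap q m) • qPartial q m k f +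
      ((q : ℂ) * q) • (qCoord q m k * qLaplace q m f) := by
  have h1 : qLaplace q m (qCoord q m k * f) =
      tr12 q (fun i j k => qPartial q m i (qPartial q m j (qCoord q m k * f))) k :=
    qLaplace_apply _
  rw [h1, qPartial_qPartial_coord_mul hq, tr12_add, tr12_add, tr12_smul, tr12_smul,
    mat23_inv_metricVecR hq, tr12_mat12 hq, tr12_vecMetric hq, tr12_mat23_inv hq,
    mat12_mat12_inv hq]
  have h2 : tr23 q (fun i j k => qCoord q m i * qPartial q m j (qPartial q m k f)) k =
      qCoord q m k * qLaplace q m f := by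
    rw [qLaplace_apply, mul_metricTr]; rfl
  simp only [Pi.add_apply, Pi.smul_apply, h2]
  module

theorem qLaplace_one (hq : 0 < q) : qLaplace q m 1 = 0 := by
  rw [qLaplace_apply]
  simp [qPartial_one hq, metricTr_zero]

theorem matOp_add_vec (A : Matrix (Fin m × Fin m) (Fin m × Fin m) ℝ) (w v : Fin m → Fin m → M)
    (i j : Fin m) : matOp A (fun k l => w k l + v k l) i j = matOp A w i j + matOp A v i j :=
  congrFun (congrFun (map_add (matOp A) w v) i) j

theorem matOp_smul_vec (A : Matrix (Fin m × Fin m) (Fin m × Fin m) ℝ) (t : ℂ)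
    (w : Fin m → Fin m → M) (i j : Fin m) :
    matOp A (fun k l => t • w k l) i j = t • matOp A w i j :=
  congrFun (congrFun (map_smul (matOp A) t w) i) j

theorem qPartial_qLaplace (hq : 0 < q) (i : Fin m) (f : QPoly q m) :
    qPartial q m i (qLaplace q m f) = qLaplace q m (qPartial q m i f) := by
  have hmu := muConst_ne_zero (m := m) hq
  have : LinearMap.pi (fun i => qPartial q m i ∘ₗ qLaplace q m) =
      LinearMap.pi (fun i => qLaplace q m ∘ₗ qPartial q m i) := by
    apply qPoly_ext
    · funext i; simp [qPartial_one hq, qLaplace_one hq]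
    · intro f hf j
      funext i
      have hf' (l) : qPartial q m l (qLaplace q m f) = qLaplace q m (qPartial q m l f) :=
        congrFun hf l
      -- The term q R⁻¹ ∂∂f produced by ∂^i Δ x^j becomes ∂^i ∂^j f plus a multiple of C^{ij} Δf.
      have h1 := braidInvOp_of_antisym hq (matOp_antisymProj_qPartial hq f) i j
      rw [← qLaplace_apply, braidInvOp] at h1
      simp only [LinearMap.pi_apply, LinearMap.comp_apply, qLaplace_coord_mul hq, map_add, map_smul,
        qPartial_coord_mul hq, leibnizVec, Pi.add_apply, Pi.smul_apply, hf', map_metricVec,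
        matOp_map, matOp_add_vec, matOp_smul_vec]
      linear_combination (norm := skip) (-(1 + q * kap q m)) • h1
      match_scalars <;> field_simp <;> ring
  exact congrFun (LinearMap.congr_fun this f) i

theorem tr23_sub (h h' : Fin m → Fin m → Fin m → M) : tr23 q (h - h') = tr23 q h - tr23 q h' := by
  funext k; exact metricTr_sub _ _

/-- In x^a x^b x^j both R₁₂ and R₂₃⁻¹ are known from the relations. Contracting, the sliding of a
cap equates the two results, which gives a multiple of x² x^j = x^j x². -/
theorem normSqElt_comm_coord (hq : 0 < q) (j : Fin m) :
    normSqElt q m * qCoord q m j = qCoord q m j * normSqElt q m := by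
  have hmu := muConst_ne_zero (m := m) hq
  let T : Fin m → Fin m → Fin m → QPoly q m := fun a b j => qCoord q m a * (qCoord q m b * qCoord q m j)
  have h1 : (q : ℂ) • mat23 (braidMatrix q m)⁻¹ T = T + (((q : ℂ) ^ 2 - 1) / (1 + q * kap q m)) •
      vecMetric q (fun a => qCoord q m a * normSqElt q m) := by
    funext a b c
    have h := congrArg (fun v => qCoord q m a * v)
      (braidInvOp_of_antisym hq (matOp_antisymProj_coord (q := q) (m := m)) b c)
    simp only [mul_add, mul_smul_comm, braidInvOp, mul_matOp, mul_metricVec, ← normSqElt_eq] at h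
    exact h
  have h2 : mat12 (braidMatrix q m) T = (q : ℂ) • T -
      (kap q m * ((q : ℂ) ^ 2 - 1) / (1 + q * kap q m)) •
        metricVecR q (fun j => normSqElt q m * qCoord q m j) := by
    funext a b c
    have h := braidOp_of_antisym hq (matOp_antisymProj_coord_mul (q := q) (m := m) (qCoord q m c)) a b
    rw [← normSqElt_mul] at h
    exact h
  have h3 : tr12 q T j = normSqElt q m * qCoord q m j := (normSqElt_mul _).symm
  have h4 : tr23 q T j = qCoord q m j * normSqElt q m := by
    rw [normSqElt_eq, mul_metricTr]; rfl
  have h5 := congrFun (congrArg (tr12 q) h1) j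
  rw [tr12_smul, tr12_mat23_inv hq, h2, tr23_sub, tr23_smul, tr23_smul,
    tr23_metricVecR hq, tr12_add, tr12_smul, tr12_vecMetric hq] at h5
  simp only [Pi.add_apply, Pi.sub_apply, Pi.smul_apply, h3, h4] at h5
  -- The common factor left on both sides is 1 + q^(4-m).
  have hpos : (1 + q * kap q m * (q : ℂ) ^ 2) ≠ 0 := by
    have h : 0 < 1 + q * q ^ (1 - (m : ℤ)) * q ^ 2 := by
      have := zpow_pos hq (1 - (m : ℤ)); positivity
    have h' : (1 + q * kap q m * (q : ℂ) ^ 2) = ((1 + q * q ^ (1 - (m : ℤ)) * q ^ 2 : ℝ) : ℂ) := by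
      rw [← kap_cast]; push_cast; ring
    rw [h']
    exact_mod_cast h.ne'
  have h6 : (1 + q * kap q m * (q : ℂ) ^ 2) • (normSqElt q m * qCoord q m j) =
      (1 + q * kap q m * (q : ℂ) ^ 2) • (qCoord q m j * normSqElt q m) := by
    linear_combination (norm := skip) (-(1 + q * kap q m)) • h5
    match_scalars <;> field_simp <;> ring
  exact smul_right_injective _ hpos h6

/-- The last term, absent in the commutative case, is why the Euler operator is not diagonal on 𝒫_k.
-/
theorem euler_coord_mul (hq : 0 < q) (j : Fin m) (f : QPoly q m) :
    euler q m (qCoord q m j * f) = qCoord q m j * f +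
      ((q : ℂ) * q) • (qCoord q m j * euler q m f) -
      (q * (kap q m * ((q : ℂ) ^ 2 - 1) / (1 + q * kap q m))) •
        (normSqElt q m * qPartial q m j f) := by
  let T : Fin m → Fin m → Fin m → QPoly q m :=
    fun a b j => qCoord q m a * (qCoord q m b * qPartial q m j f)
  have h1 : (fun a b j => qCoord q m a * qPartial q m b (qCoord q m j * f)) =
      vecMetric q (fun a => qCoord q m a * f) + (q : ℂ) • mat23 (braidMatrix q m)⁻¹ T := by
    funext a b c
    simp only [qPartial_coord_mul hq, leibnizVec, Pi.add_apply, Pi.smul_apply, mul_add,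
      mul_smul_comm, mul_matOp, mul_metricVec]
    rfl
  have h2 : mat12 (braidMatrix q m) T = (q : ℂ) • T -
      (kap q m * ((q : ℂ) ^ 2 - 1) / (1 + q * kap q m)) •
        metricVecR q (fun j => normSqElt q m * qPartial q m j f) := by
    funext a b c
    have h := braidOp_of_antisym hq
      (matOp_antisymProj_coord_mul (q := q) (m := m) (qPartial q m c f)) a b
    rw [← normSqElt_mul] at h
    exact h
  have h3 : tr23 q T j = qCoord q m j * euler q m f := by
    rw [euler_apply, mul_metricTr]; rfl
  have h4 : euler q m (qCoord q m j * f) =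
      tr12 q (fun a b j => qCoord q m a * qPartial q m b (qCoord q m j * f)) j := euler_apply _
  rw [h4, h1, tr12_add, tr12_smul, tr12_vecMetric hq, tr12_mat23_inv hq, h2, tr23_sub, tr23_smul, tr23_smul, tr23_metricVecR hq]
  simp only [Pi.add_apply, Pi.sub_apply, Pi.smul_apply, h3]
  module

theorem euler_one (hq : 0 < q) : euler q m 1 = 0 := by
  rw [euler_apply]
  simp [qPartial_one hq, metricTr_zero]

/-! ### Homogeneous polynomials -/

theorem coord_mul_mem_homogPoly (i : Fin m) {k : ℕ} {f : QPoly q m} (hf : f ∈ homogPoly q m k) :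
    qCoord q m i * f ∈ homogPoly q m (k + 1) := by
  rw [homogPoly, pow_succ']
  exact Submodule.mul_mem_mul (Submodule.subset_span ⟨i, rfl⟩) hf

theorem homogPoly_succ_le {k : ℕ} {S : Submodule ℂ (QPoly q m)}
    (h : ∀ i, ∀ f ∈ homogPoly q m k, qCoord q m i * f ∈ S) : homogPoly q m (k + 1) ≤ S := by
  rw [homogPoly, pow_succ', Submodule.mul_le]
  intro a ha f hf
  induction ha using Submodule.span_induction with
  | mem x hx => obtain ⟨i, rfl⟩ := hx; exact h i f hf
  | zero => rw [zero_mul]; exact S.zero_mem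
  | add x y _ _ hx hy => rw [add_mul]; exact S.add_mem hx hy
  | smul t x _ hx => rw [smul_mul_assoc]; exact S.smul_mem t hx

theorem mem_homogPoly_zero {f : QPoly q m} : f ∈ homogPoly q m 0 ↔ ∃ t : ℂ, f = t • 1 := by
  rw [homogPoly, pow_zero, Submodule.mem_one]
  simp only [Algebra.algebraMap_eq_smul_one, eq_comm]

theorem homogPoly_mul_mem {k l : ℕ} {f g : QPoly q m} (hf : f ∈ homogPoly q m k)
    (hg : g ∈ homogPoly q m l) : f * g ∈ homogPoly q m (k + l) := by
  rw [homogPoly, pow_add]; exact Submodule.mul_mem_mul hf hg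

theorem coord_mem_homogPoly (i : Fin m) : qCoord q m i ∈ homogPoly q m 1 := by
  rw [homogPoly, pow_one]; exact Submodule.subset_span ⟨i, rfl⟩

theorem metricTr_mem {S : Submodule ℂ M} {w : Fin m → Fin m → M} (h : ∀ i j, w i j ∈ S) :
    metricTr q w ∈ S := S.sum_mem fun _ _ => S.smul_mem _ (h _ _)

theorem matOp_mem {S : Submodule ℂ M} {w : Fin m → Fin m → M} (h : ∀ i j, w i j ∈ S)
    (A : Matrix (Fin m × Fin m) (Fin m × Fin m) ℝ) (i j : Fin m) : matOp A w i j ∈ S := by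
  rw [matOp_apply]
  exact S.sum_mem fun k _ => S.sum_mem fun l _ => S.smul_mem _ (h k l)

theorem metricVec_mem {S : Submodule ℂ M} {v : M} (h : v ∈ S) (i j : Fin m) :
    metricVec q m v i j ∈ S := by
  unfold metricVec
  split_ifs
  · exact S.smul_mem _ h
  · exact S.zero_mem

theorem normSqElt_mem_homogPoly : normSqElt q m ∈ homogPoly q m 2 := by
  rw [normSqElt_eq]
  exact metricTr_mem fun i j => homogPoly_mul_mem (coord_mem_homogPoly i) (coord_mem_homogPoly j)

theorem qPartial_of_mem_zero (hq : 0 < q) (i : Fin m) {f : QPoly q m}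
    (hf : f ∈ homogPoly q m 0) : qPartial q m i f = 0 := by
  obtain ⟨t, rfl⟩ := mem_homogPoly_zero.mp hf
  rw [map_smul, qPartial_one hq, smul_zero]

theorem qPartial_mem_homogPoly (hq : 0 < q) {k : ℕ} {f : QPoly q m}
    (hf : f ∈ homogPoly q m (k + 1)) (i : Fin m) : qPartial q m i f ∈ homogPoly q m k := by
  induction k generalizing f i with
  | zero =>
    suffices h : homogPoly q m (0 + 1) ≤ (homogPoly q m 0).comap (qPartial q m i) from h hf
    refine homogPoly_succ_le fun j g hg => ?_
    rw [Submodule.mem_comap, qPartial_coord_mul hq, leibnizVec]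
    simp only [qPartial_of_mem_zero hq _ hg, mul_zero]
    change metricVec q m g i j + (q : ℂ) • matOp (braidMatrix q m)⁻¹ 0 i j ∈ _
    rw [map_zero]
    exact Submodule.add_mem _ (metricVec_mem hg i j) (by simp)
  | succ k ih =>
    suffices h : homogPoly q m (k + 1 + 1) ≤ (homogPoly q m (k + 1)).comap (qPartial q m i) from h hf
    refine homogPoly_succ_le fun j g hg => ?_
    rw [Submodule.mem_comap, qPartial_coord_mul hq, leibnizVec]
    exact Submodule.add_mem _ (metricVec_mem hg i j) (Submodule.smul_mem _ _
      (matOp_mem (fun a b => coord_mul_mem_homogPoly a (ih hg b)) _ _ _))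

/-- The Euler operator on homogeneous polynomials. -/
theorem euler_of_mem (hq : 0 < q) {k : ℕ} {f : QPoly q m} (hf : f ∈ homogPoly q m k) :
    ((q : ℂ) ^ 2 - 1) • euler q m f +
      (q * kap q m * (((q : ℂ) ^ 2 - 1) / (1 + q * kap q m)) ^ 2) •
        (normSqElt q m * qLaplace q m f) = (((q : ℂ) ^ 2) ^ k - 1) • f := by
  have hmu := muConst_ne_zero (m := m) hq
  -- The multiple of x²Δ is chosen so that the terms x² ∂^j f from `euler_coord_mul` and
  -- `qLaplace_coord_mul` cancel; what remains satisfies Λ x^j = (q² - 1) x^j + q² x^j Λ.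
  let Λ : QPoly q m →ₗ[ℂ] QPoly q m := ((q : ℂ) ^ 2 - 1) • euler q m +
      (q * kap q m * (((q : ℂ) ^ 2 - 1) / (1 + q * kap q m)) ^ 2) •
        (LinearMap.mulLeft ℂ (normSqElt q m) ∘ₗ qLaplace q m)
  suffices h : homogPoly q m k ≤ LinearMap.eqLocus Λ ((((q : ℂ) ^ 2) ^ k - 1) • LinearMap.id) from
    h hf
  clear hf f
  induction k with
  | zero =>
    intro f hf
    obtain ⟨t, rfl⟩ := mem_homogPoly_zero.mp hf
    simp [Λ, euler_one hq, qLaplace_one hq, LinearMap.mem_eqLocus]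
  | succ k ih =>
    refine homogPoly_succ_le fun j f hf => ?_
    have h1 := congrArg (fun v => qCoord q m j * v) (ih hf)
    rw [LinearMap.mem_eqLocus]
    simp only [Λ, LinearMap.add_apply, LinearMap.smul_apply, LinearMap.comp_apply,
      LinearMap.mulLeft_apply, mul_add, mul_smul_comm, LinearMap.id_apply, euler_coord_mul hq,
      qLaplace_coord_mul hq, smul_add, smul_sub] at h1 ⊢
    rw [show normSqElt q m * (qCoord q m j * qLaplace q m f) =
      qCoord q m j * (normSqElt q m * qLaplace q m f) by
        rw [← mul_assoc, normSqElt_comm_coord hq, mul_assoc]]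
    linear_combination (norm := skip) ((q : ℂ) ^ 2) • h1
    match_scalars <;> field_simp <;> ring

/-! ### Contractions of tensors -/

section Contraction

variable {V V' V'' : Type*} [AddCommGroup V] [Module ℂ V] [AddCommGroup V'] [Module ℂ V']
  [AddCommGroup V''] [Module ℂ V'']

/-- Application of a functional to the left factor. -/
noncomputable def contractL (φ : V →ₗ[ℂ] ℂ) : V ⊗[ℂ] V' →ₗ[ℂ] V' :=
  (TensorProduct.lid ℂ V').toLinearMap ∘ₗ TensorProduct.map φ LinearMap.id

/-- Application of a functional to the right factor. -/
noncomputable def contractR (ψ : V' →ₗ[ℂ] ℂ) : V ⊗[ℂ] V' →ₗ[ℂ] V :=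
  (TensorProduct.rid ℂ V).toLinearMap ∘ₗ TensorProduct.map LinearMap.id ψ

@[simp] theorem contractL_tmul (φ : V →ₗ[ℂ] ℂ) (v : V) (v' : V') :
    contractL φ (v ⊗ₜ[ℂ] v') = φ v • v' := by simp [contractL]

@[simp] theorem contractR_tmul (ψ : V' →ₗ[ℂ] ℂ) (v : V) (v' : V') :
    contractR ψ (v ⊗ₜ[ℂ] v') = ψ v' • v := by simp [contractR]

theorem contractR_map (ψ : V' →ₗ[ℂ] ℂ) (f : V →ₗ[ℂ] V'') (u : V ⊗[ℂ] V') :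
    contractR ψ (TensorProduct.map f LinearMap.id u) = f (contractR ψ u) := by
  induction u with
  | zero => simp
  | tmul v v' => simp
  | add x y hx hy => simp [hx, hy]

theorem contractL_map (φ : V'' →ₗ[ℂ] ℂ) (f : V →ₗ[ℂ] V'') (u : V ⊗[ℂ] V') :
    contractL φ (TensorProduct.map f LinearMap.id u) = contractL (φ ∘ₗ f) u := by
  induction u with
  | zero => simp
  | tmul v v' => simp
  | add x y hx hy => simp [hx, hy]

theorem apply_contractR (φ : V →ₗ[ℂ] ℂ) (ψ : V' →ₗ[ℂ] ℂ) (u : V ⊗[ℂ] V') :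
    φ (contractR ψ u) = ψ (contractL φ u) := by
  induction u with
  | zero => simp
  | tmul v v' => simp [mul_comm]
  | add x y hx hy => simp [hx, hy]

/-- Expanding in a basis of V' has contractions of u as coefficients. Tensors can thus be tested by
contracting y away, which reduces statements about 𝒫 ⊗ 𝒫 to statements about 𝒫. -/
theorem mem_span_contractR (u : V ⊗[ℂ] V') :
    u ∈ Submodule.span ℂ {t | ∃ (ψ : V' →ₗ[ℂ] ℂ) (v' : V'), t = contractR ψ u ⊗ₜ[ℂ] v'} := by
  let b := Module.Free.chooseBasis ℂ V'
  let e := TensorProduct.equivFinsuppOfBasisRight (M := V) b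
  have he (i) (u : V ⊗[ℂ] V') : e u i = contractR (b.coord i) u := by
    induction u with
    | zero => simp
    | tmul v v' => simp [e]
    | add x y hx hy => simp [hx, hy]
  have hu : u = ∑ i ∈ (e u).support, contractR (b.coord i) u ⊗ₜ[ℂ] b i := by
    conv_lhs => rw [← e.symm_apply_apply u]
    rw [TensorProduct.equivFinsuppOfBasisRight_symm_apply, Finsupp.sum]
    simp only [he]
  have h : ∑ i ∈ (e u).support, contractR (b.coord i) u ⊗ₜ[ℂ] b i ∈ Submodule.span ℂ
      {t | ∃ (ψ : V' →ₗ[ℂ] ℂ) (v' : V'), t = contractR ψ u ⊗ₜ[ℂ] v'} :=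
    Submodule.sum_mem _ fun i _ => Submodule.subset_span ⟨_, _, rfl⟩
  rwa [← hu] at h

theorem eq_zero_of_contractR {u : V ⊗[ℂ] V'} (h : ∀ ψ : V' →ₗ[ℂ] ℂ, contractR ψ u = 0) : u = 0 := by
  refine (Submodule.mem_bot ℂ).mp (Submodule.span_le.mpr ?_ (mem_span_contractR u))
  rintro _ ⟨ψ, v', rfl⟩
  simp [h]

theorem contractR_mem {W : Submodule ℂ V} {W' : Submodule ℂ V'} {u : V ⊗[ℂ] V'}
    (h : u ∈ LinearMap.range (TensorProduct.mapIncl W W')) (ψ : V' →ₗ[ℂ] ℂ) :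
    contractR ψ u ∈ W := by
  obtain ⟨t, rfl⟩ := h
  induction t with
  | zero => simp
  | tmul w w' => simpa [TensorProduct.mapIncl] using W.smul_mem _ w.2
  | add x y hx hy => rw [map_add, map_add]; exact W.add_mem hx hy

/-- A subspace with a nondegenerate system of functionals has a canonical tensor. -/
theorem exists_dual_family {W : Submodule ℂ V} [FiniteDimensional ℂ W]
    (B : W →ₗ[ℂ] (W →ₗ[ℂ] ℂ)) (hB : Function.Injective B) :
    ∃ (ι : Type) (_ : Fintype ι) (b c : ι → W), ∀ w : W, ∑ i, B w (b i) • c i = w ∧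
      ∑ i, B (c i) w • b i = w := by
  have hfin : Module.finrank ℂ W = Module.finrank ℂ (W →ₗ[ℂ] ℂ) :=
    (Subspace.dual_finrank_eq (K := ℂ) (V := W)).symm
  have hsurj := (LinearMap.injective_iff_surjective_of_finrank_eq_finrank hfin).mp hB
  let b := Module.finBasis ℂ W
  choose c hc using fun i => hsurj (b.coord i)
  have h2 (w : W) : ∑ i, B (c i) w • b i = w := by
    simp only [hc]
    exact b.sum_repr w
  refine ⟨_, inferInstance, b, c, fun w => ⟨hB ?_, h2 w⟩⟩
  refine LinearMap.ext fun v => ?_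
  conv_rhs => rw [← h2 v]
  simp [LinearMap.sum_apply, mul_comm]

end Contraction


/-! ### Finite dimension, evaluation at zero, polynomials with vanishing derivatives -/

instance finiteDimensional_homogPoly (k : ℕ) : FiniteDimensional ℂ (homogPoly q m k) := by
  rw [FiniteDimensional, Module.Finite.iff_fg]
  exact (Submodule.fg_span (Set.finite_range _)).pow k

theorem evalZero_coord_mul (i : Fin m) (f : QPoly q m) : evalZero q m (qCoord q m i * f) = 0 := by
  have : evalZero q m (qCoord q m i) = 0 := by
    unfold evalZero qCoord
    rw [RingQuot.liftAlgHom_mkAlgHom_apply, FreeAlgebra.lift_ι_apply]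
  rw [map_mul, this, zero_mul]

theorem evalZero_normSqElt_mul (f : QPoly q m) : evalZero q m (normSqElt q m * f) = 0 := by
  rw [normSqElt_mul]
  refine (map_metricTr (evalZero q m).toLinearMap _).trans ?_
  simp [evalZero_coord_mul, metricTr_zero]

theorem evalZero_of_mem_succ {k : ℕ} {f : QPoly q m} (hf : f ∈ homogPoly q m (k + 1)) :
    evalZero q m f = 0 := by
  have : homogPoly q m (k + 1) ≤ LinearMap.ker (evalZero q m).toLinearMap :=
    homogPoly_succ_le fun i f _ => evalZero_coord_mul i f
  exact this hf

theorem ne_one_of_lt (hq : 0 < q) (hq1 : q < 1) : ((q : ℂ) ^ 2 - 1) ≠ 0 := by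
  have : (q ^ 2 - 1 : ℝ) ≠ 0 := by nlinarith
  exact_mod_cast this

theorem qsq_pow_ne_one (hq : 0 < q) (hq1 : q < 1) (k : ℕ) : (((q : ℂ) ^ 2) ^ (k + 1) - 1) ≠ 0 := by
  have : ((q ^ 2) ^ (k + 1) - 1 : ℝ) ≠ 0 := by
    have := pow_lt_one₀ (sq_nonneg q) (pow_lt_one₀ hq.le hq1 two_ne_zero) (Nat.succ_ne_zero k)
    exact sub_ne_zero.mpr this.ne
  exact_mod_cast this

theorem qLaplace_of_qPartial_eq_zero {f : QPoly q m} (h : ∀ i, qPartial q m i f = 0) :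
    qLaplace q m f = 0 := by
  rw [qLaplace_apply]; simp [h, metricTr_zero]

/-- The constants are the only polynomials with vanishing derivatives. -/
theorem eq_zero_of_qPartial_eq_zero (hq : 0 < q) (hq1 : q < 1) {k : ℕ} {f : QPoly q m}
    (hf : f ∈ homogPoly q m (k + 1)) (h : ∀ i, qPartial q m i f = 0) : f = 0 := by
  have h1 := euler_of_mem hq hf
  rw [qLaplace_of_qPartial_eq_zero h, euler_apply] at h1
  simp only [h, mul_zero, metricTr_zero, smul_zero, add_zero] at h1
  exact (smul_eq_zero.mp h1.symm).resolve_left (qsq_pow_ne_one hq hq1 k)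

/-! ### The generalized powers of the inner product -/

/-- The differential operator `h(∂)`. -/
noncomputable def diffOp (q : ℝ) (m : ℕ) (hq : 0 < q) : QPoly q m →ₐ[ℂ] Module.End ℂ (QPoly q m) :=
  RingQuot.liftAlgHom ℂ ⟨FreeAlgebra.lift ℂ (qPartial q m), by
    rintro a b ⟨i, j, rfl, rfl⟩
    refine LinearMap.ext fun f => ?_
    simp only [map_sum, map_smul, map_mul, FreeAlgebra.lift_ι_apply, map_zero,
      LinearMap.zero_apply, LinearMap.sum_apply, LinearMap.smul_apply, Module.End.mul_apply]
    exact congrFun (congrFun (matOp_antisymProj_qPartial hq f) i) j⟩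

theorem diffOp_coord (hq : 0 < q) (i : Fin m) : diffOp q m hq (qCoord q m i) = qPartial q m i := by
  unfold diffOp qCoord
  rw [RingQuot.liftAlgHom_mkAlgHom_apply, FreeAlgebra.lift_ι_apply]

/-- The pairing `⟨h, f⟩ = (h(∂) f)(0)`. -/
noncomputable def diffPairing (q : ℝ) (m : ℕ) (hq : 0 < q) :
    QPoly q m →ₗ[ℂ] QPoly q m →ₗ[ℂ] ℂ :=
  LinearMap.llcomp ℂ _ _ _ (evalZero q m).toLinearMap ∘ₗ (diffOp q m hq).toLinearMap

theorem diffPairing_apply (hq : 0 < q) (h f : QPoly q m) :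
    diffPairing q m hq h f = evalZero q m (diffOp q m hq h f) := rfl

theorem diffPairing_mul_coord (hq : 0 < q) (h : QPoly q m) (i : Fin m) :
    diffPairing q m hq (h * qCoord q m i) = diffPairing q m hq h ∘ₗ qPartial q m i := by
  refine LinearMap.ext fun f => ?_
  simp [diffPairing_apply, diffOp_coord]

theorem mul_coord_mem_homogPoly (i : Fin m) {k : ℕ} {f : QPoly q m} (hf : f ∈ homogPoly q m k) :
    f * qCoord q m i ∈ homogPoly q m (k + 1) :=
  homogPoly_mul_mem hf (coord_mem_homogPoly i)

theorem one_mem_homogPoly : (1 : QPoly q m) ∈ homogPoly q m 0 :=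
  mem_homogPoly_zero.mpr ⟨1, (one_smul _ _).symm⟩

/-- Nondegeneracy in the second argument. Testing against g x^i is testing ∂^i f against g, so all
∂^i f vanish by induction, hence f does. -/
theorem eq_zero_of_diffPairing (hq : 0 < q) (hq1 : q < 1) {k : ℕ} {f : QPoly q m}
    (hf : f ∈ homogPoly q m k) (h : ∀ g ∈ homogPoly q m k, diffPairing q m hq g f = 0) : f = 0 := by
  induction k generalizing f with
  | zero =>
    obtain ⟨t, rfl⟩ := mem_homogPoly_zero.mp hf
    have := h 1 one_mem_homogPoly
    rw [diffPairing_apply] at this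
    simp only [map_one, Module.End.one_apply, map_smul, smul_eq_mul, mul_one] at this
    rw [this, zero_smul]
  | succ k ih =>
    refine eq_zero_of_qPartial_eq_zero hq hq1 hf fun i => ih (qPartial_mem_homogPoly hq hf i)
      fun g hg => ?_
    have := h (g * qCoord q m i) (mul_coord_mem_homogPoly i hg)
    rwa [diffPairing_mul_coord] at this

/-- The tensor of a pair of dual bases for the nondegenerate pairing on 𝒫_k. -/
theorem exists_canonical (hq : 0 < q) (hq1 : q < 1) (k : ℕ) :
    ∃ G ∈ LinearMap.range (TensorProduct.mapIncl (homogPoly q m k) (homogPoly q m k)),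
      ∀ h ∈ homogPoly q m k, contractL (diffPairing q m hq h) G = h := by
  let B : homogPoly q m k →ₗ[ℂ] (homogPoly q m k →ₗ[ℂ] ℂ) :=
    ((diffPairing q m hq).domRestrict₁₂ (homogPoly q m k) (homogPoly q m k)).flip
  have hB : Function.Injective B := by
    intro f f' hf
    refine Subtype.ext (sub_eq_zero.mp (eq_zero_of_diffPairing hq hq1
      (Submodule.sub_mem _ f.2 f'.2) fun g hg => ?_))
    rw [map_sub, sub_eq_zero]
    exact LinearMap.congr_fun hf (⟨g, hg⟩ : homogPoly q m k)
  obtain ⟨ι, _, b, c, hbc⟩ := exists_dual_family B hB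
  refine ⟨∑ i, (c i : QPoly q m) ⊗ₜ (b i : QPoly q m),
    Submodule.sum_mem _ fun i _ => ⟨c i ⊗ₜ b i, rfl⟩, fun h hh => ?_⟩
  have := congrArg Subtype.val (hbc ⟨h, hh⟩).2
  rw [AddSubmonoidClass.coe_finsetSum] at this
  simp only [map_sum, contractL_tmul]
  exact this

theorem sandwich_tmul (a b f g : QPoly q m) :
    sandwich q m a b (f ⊗ₜ[ℂ] g) = (a * f) ⊗ₜ[ℂ] (g * b) := rfl

theorem contractR_sandwich (a b : QPoly q m) (ψ : QPoly q m →ₗ[ℂ] ℂ)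
    (u : QPoly q m ⊗[ℂ] QPoly q m) :
    contractR ψ (sandwich q m a b u) = a * contractR (ψ ∘ₗ LinearMap.mulRight ℂ b) u := by
  induction u with
  | zero => simp
  | tmul v v' => simp [sandwich_tmul]
  | add x y hx hy => simp [hx, hy, mul_add]

theorem contractL_sandwich (a b : QPoly q m) (φ : QPoly q m →ₗ[ℂ] ℂ)
    (u : QPoly q m ⊗[ℂ] QPoly q m) :
    contractL φ (sandwich q m a b u) = contractL (φ ∘ₗ LinearMap.mulLeft ℂ a) u * b := by
  induction u with
  | zero => simp
  | tmul v v' => simp [sandwich_tmul]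
  | add x y hx hy => simp [hx, hy, add_mul]

theorem isGenPower_unique (hq : 0 < q) (hq1 : q < 1) {G G' : ℕ → QPoly q m ⊗[ℂ] QPoly q m}
    (hG : IsGenPower q m G) (hG' : IsGenPower q m G') : G = G' := by
  funext l
  induction l with
  | zero => rw [hG.1, hG'.1]
  | succ l ih =>
    rw [← sub_eq_zero]
    refine eq_zero_of_contractR fun ψ => ?_
    refine eq_zero_of_qPartial_eq_zero hq hq1
      (contractR_mem (Submodule.sub_mem _ (hG.2.1 (l + 1)) (hG'.2.1 (l + 1))) ψ) fun i => ?_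
    rw [← contractR_map, map_sub, hG.2.2, hG'.2.2, ih, sub_self, map_zero]

theorem eq_zero_of_contractL_diffPairing (hq : 0 < q) (hq1 : q < 1) {k : ℕ}
    {u : QPoly q m ⊗[ℂ] QPoly q m} (hu : ∀ ψ, contractR ψ u ∈ homogPoly q m k)
    (h : ∀ g ∈ homogPoly q m k, contractL (diffPairing q m hq g) u = 0) : u = 0 :=
  eq_zero_of_contractR fun ψ => eq_zero_of_diffPairing hq hq1 (hu ψ) fun g hg => by
    rw [apply_contractR, h g hg, map_zero]

/-- The witness is [l]_q! times the canonical tensor. Its differential equation is checked by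
pairing in x: ∂^j passes to the first argument as right multiplication by x^j, and the canonical
tensor then returns g y^j. -/
theorem exists_isGenPower (hq : 0 < q) (hq1 : q < 1) :
    ∃ G, IsGenPower q m G ∧ ∀ l, ∀ h ∈ homogPoly q m l,
      contractL (diffPairing q m hq h) (G l) = ((qFactorial q l : ℝ) : ℂ) • h := by
  choose G hmem hG using exists_canonical (m := m) hq hq1
  have hspec : IsGenPower q m (fun l => ((qFactorial q l : ℝ) : ℂ) • G l) := by
    refine ⟨?_, fun l => Submodule.smul_mem _ _ (hmem l), fun l j => ?_⟩
    · rw [← sub_eq_zero]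
      refine eq_zero_of_contractL_diffPairing hq hq1 (k := 0) (fun ψ => ?_) fun g hg => ?_
      · rw [map_sub, map_smul, contractR_tmul]
        exact Submodule.sub_mem _ (Submodule.smul_mem _ _ (contractR_mem (hmem 0) ψ))
          (Submodule.smul_mem _ _ one_mem_homogPoly)
      · obtain ⟨t, rfl⟩ := mem_homogPoly_zero.mp hg
        rw [map_sub, map_smul, hG 0 _ hg, contractL_tmul, diffPairing_apply]
        simp [qFactorial]
    · rw [← sub_eq_zero]
      refine eq_zero_of_contractL_diffPairing hq hq1 (k := l) (fun ψ => ?_) fun g hg => ?_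
      · simp only [map_sub, map_smul, contractR_map, contractR_sandwich, one_mul]
        refine Submodule.sub_mem _ (Submodule.smul_mem _ _
          (qPartial_mem_homogPoly hq (contractR_mem (hmem (l + 1)) ψ) j)) ?_
        exact Submodule.smul_mem _ _ (Submodule.smul_mem _ _ (contractR_mem (hmem l) _))
      · simp only [map_sub, map_smul, contractL_map, contractL_sandwich]
        rw [← diffPairing_mul_coord, hG _ _ (mul_coord_mem_homogPoly j hg),
          LinearMap.mulLeft_one, LinearMap.comp_id, hG _ _ hg, smul_smul, qFactorial,
          Finset.prod_range_succ, ← qFactorial, Complex.ofReal_mul, mul_comm, sub_self]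
  exact ⟨_, hspec, fun l h hh => by rw [map_smul, hG l h hh]⟩

theorem existsUnique_isGenPower (hq : 0 < q) (hq1 : q < 1) : ∃! G, IsGenPower q m G :=
  let ⟨G, hG, _⟩ := exists_isGenPower (m := m) hq hq1
  ⟨G, hG, fun _ hG' => isGenPower_unique hq hq1 hG' hG⟩

theorem genPower_spec (hq : 0 < q) (hq1 : q < 1) : IsGenPower q m (genPower q m) :=
  Classical.epsilon_spec (existsUnique_isGenPower hq hq1).exists

theorem contractL_genPower (hq : 0 < q) (hq1 : q < 1) {l : ℕ} {h : QPoly q m}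
    (hh : h ∈ homogPoly q m l) :
    contractL (diffPairing q m hq h) (genPower q m l) = ((qFactorial q l : ℝ) : ℂ) • h := by
  obtain ⟨G, hG, hG'⟩ := exists_isGenPower (m := m) hq hq1
  rw [isGenPower_unique hq hq1 (genPower_spec hq hq1) hG, hG' l h hh]

/-! ### The Laplace operator and powers of `x²` -/

/-- The `q²`-number of an integer. -/
noncomputable def qsqNum (q : ℝ) (k : ℕ) : ℂ := (((q : ℂ) ^ 2) ^ k - 1) / ((q : ℂ) ^ 2 - 1)

/-- The `q²`-number `[m/2 + k]`. -/
noncomputable def qsqHalfNum (q : ℝ) (m k : ℕ) : ℂ :=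
  (q * (kap q m)⁻¹ * ((q : ℂ) ^ 2) ^ k - 1) / ((q : ℂ) ^ 2 - 1)

theorem qsqNum_ne_zero (hq : 0 < q) (hq1 : q < 1) (k : ℕ) : qsqNum q (k + 1) ≠ 0 :=
  div_ne_zero (qsq_pow_ne_one hq hq1 k) (ne_one_of_lt hq hq1)

/-- The `q²`-factorial. -/
noncomputable def qsqFac (q : ℝ) (k : ℕ) : ℂ := ∏ i ∈ Finset.range k, qsqNum q (i + 1)

theorem qsqFac_succ (k : ℕ) : qsqFac q (k + 1) = qsqFac q k * qsqNum q (k + 1) :=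
  Finset.prod_range_succ _ _

theorem qsqFac_ne_zero (hq : 0 < q) (hq1 : q < 1) (k : ℕ) : qsqFac q k ≠ 0 :=
  Finset.prod_ne_zero_iff.mpr fun i _ => qsqNum_ne_zero hq hq1 i

theorem metricTr_braidInvOp (hq : 0 < q) (w : Fin m → Fin m → M) :
    metricTr q (braidInvOp q w) = (kap q m)⁻¹ • metricTr q w := by
  have h := metricTr_braidOp hq m (braidInvOp q w)
  rw [braidOp_braidInvOp hq] at h
  rw [h, inv_smul_smul₀ (kap_ne_zero hq)]

theorem metricTr_leibnizVec (hq : 0 < q) (hq1 : q < 1) (f : QPoly q m) :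
    metricTr q (leibnizVec f (fun l => qPartial q m l f)) =
      ((1 + q * kap q m) * qsqHalfNum q m 0) • f + (q * (kap q m)⁻¹) • euler q m f := by
  have hq' : (q : ℂ) ≠ 0 := by exact_mod_cast hq.ne'
  have h1 := ne_one_of_lt hq hq1
  have hk := kap_ne_zero (m := m) hq
  have h2 := metricTr_metricVec hq m f
  have h3 := metricTr_braidInvOp hq (fun k l => qCoord q m k * qPartial q m l f)
  rw [← euler_apply] at h3
  have h4 : metricTr q (leibnizVec f (fun l => qPartial q m l f)) = metricTr q (metricVec q m f) +
      (q : ℂ) • metricTr q (braidInvOp q (fun k l => qCoord q m k * qPartial q m l f)) := by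
    rw [← metricTr_smul, ← metricTr_add]; rfl
  rw [h4, h3, smul_smul, add_left_inj]
  have h5 : ((q : ℂ) - (q : ℂ)⁻¹) ≠ 0 := by
    intro h
    apply h1
    field_simp at h
    simpa using h
  rw [← smul_right_inj h5, h2, smul_smul, qsqHalfNum]
  congr 1
  field_simp
  ring

/-- Two uses of the rule for ∂^i x² produce an Euler term, which `euler_of_mem` turns into a scalar
and a multiple of x²Δf. -/
theorem qLaplace_normSqElt_mul (hq : 0 < q) (hq1 : q < 1) {l : ℕ} {f : QPoly q m}
    (hf : f ∈ homogPoly q m l) :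
    qLaplace q m (normSqElt q m * f) = ((q : ℂ) ^ 2) • (normSqElt q m * qLaplace q m f) +
      ((1 + q * kap q m) ^ 2 * qsqHalfNum q m l) • f := by
  have hq' : (q : ℂ) ≠ 0 := by exact_mod_cast hq.ne'
  have h1 := ne_one_of_lt hq hq1
  have hk := kap_ne_zero (m := m) hq
  have hmu := muConst_ne_zero (m := m) hq
  have h2 : qLaplace q m (normSqElt q m * f) =
      (1 + q * kap q m) • metricTr q (leibnizVec f (fun l => qPartial q m l f)) +
      ((q : ℂ) * q) • ((1 + q * kap q m) • euler q m f +
        ((q : ℂ) * q) • (normSqElt q m * qLaplace q m f)) := by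
    rw [qLaplace_apply, euler_apply, qLaplace_apply, mul_metricTr]
    simp only [qPartial_normSqElt_mul hq, map_add, map_smul, qPartial_coord_mul hq, metricTr_add,
      metricTr_smul]
  have h3 := euler_of_mem hq hf
  rw [h2, metricTr_leibnizVec hq hq1]
  unfold qsqHalfNum
  linear_combination (norm := skip)
    ((1 + q * kap q m) * (q * (kap q m)⁻¹ + q * q) / ((q : ℂ) ^ 2 - 1)) • h3
  match_scalars
  · field_simp
    ring
  · field_simp
    ring
  · field_simp
    ring

theorem normSqElt_pow_mem_homogPoly (j : ℕ) : normSqElt q m ^ j ∈ homogPoly q m (2 * j) := by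
  induction j with
  | zero => rw [pow_zero]; exact one_mem_homogPoly
  | succ j ih => rw [pow_succ]; exact homogPoly_mul_mem ih normSqElt_mem_homogPoly

theorem qLaplace_normSqElt_pow_mul (hq : 0 < q) (hq1 : q < 1) {l : ℕ} {f : QPoly q m}
    (hf : f ∈ homogPoly q m l) (j : ℕ) :
    qLaplace q m (normSqElt q m ^ (j + 1) * f) =
      (((q : ℂ) ^ 2) ^ (j + 1)) • (normSqElt q m ^ (j + 1) * qLaplace q m f) +
      ((1 + q * kap q m) ^ 2 * qsqNum q (j + 1) * qsqHalfNum q m (l + j)) •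
        (normSqElt q m ^ j * f) := by
  have hq' : (q : ℂ) ≠ 0 := by exact_mod_cast hq.ne'
  have h1 := ne_one_of_lt hq hq1
  induction j with
  | zero =>
    have h2 : qsqNum q 1 = 1 := by rw [qsqNum, pow_one, div_self h1]
    simp [qLaplace_normSqElt_mul hq hq1 hf, h2]
  | succ j ih =>
    have hmem := homogPoly_mul_mem (normSqElt_pow_mem_homogPoly (j + 1)) hf
    have h2 := qLaplace_normSqElt_mul hq hq1 hmem
    rw [ih, mul_add, mul_smul_comm, mul_smul_comm, ← mul_assoc, ← mul_assoc, ← pow_succ',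
      ← mul_assoc, ← pow_succ'] at h2
    rw [h2]
    unfold qsqNum qsqHalfNum
    match_scalars
    · ring
    · field_simp
      ring

/-! ### Harmonic polynomials as differential operators -/

/-- The operator `λ ↦ (T ↦ ∂^i C_{ij} λ(∂^j T))`. -/
noncomputable def derivShift (q : ℝ) (m : ℕ) : Module.End ℂ (Module.End ℂ (QPoly q m)) :=
  ∑ i, metricCoeff q m i • LinearMap.mulLeftRight ℂ (qPartial q m i, qPartial q m i.rev)

/-- The operator `λ ↦ (T ↦ x^i C_{ij} λ(∂^j T))`. -/
noncomputable def coordShift (q : ℝ) (m : ℕ) : Module.End ℂ (Module.End ℂ (QPoly q m)) :=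
  ∑ i, metricCoeff q m i •
    LinearMap.mulLeftRight ℂ (LinearMap.mulLeft ℂ (qCoord q m i), qPartial q m i.rev)

theorem derivShift_apply (L : Module.End ℂ (QPoly q m)) (T : QPoly q m) :
    derivShift q m L T = metricTr q (fun i j => qPartial q m i (L (qPartial q m j T))) := by
  simp [derivShift, metricTr, LinearMap.sum_apply]

theorem coordShift_apply (L : Module.End ℂ (QPoly q m)) (T : QPoly q m) :
    coordShift q m L T = metricTr q (fun i j => qCoord q m i * L (qPartial q m j T)) := by
  simp [coordShift, metricTr, LinearMap.sum_apply]

theorem evalZero_coordShift (L : Module.End ℂ (QPoly q m)) (T : QPoly q m) :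
    evalZero q m (coordShift q m L T) = 0 := by
  rw [coordShift_apply]
  refine (map_metricTr (evalZero q m).toLinearMap _).trans ?_
  simp [evalZero_coord_mul, metricTr_zero]

theorem qLaplace_qPartial_eq_zero (hq : 0 < q) {T : QPoly q m} (hT : qLaplace q m T = 0)
    (i : Fin m) : qLaplace q m (qPartial q m i T) = 0 := by
  rw [← qPartial_qLaplace hq, hT, map_zero]

/-- A crossing slides around two nested caps, from the legs a, b to the legs e, f: first past one
cap as R on the middle legs, then past the other. -/
theorem metricTr_metricTr_inv (hq : 0 < q) (h : Fin m → Fin m → Fin m → Fin m → M) :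
    metricTr q (fun a f => metricTr q (fun b e =>
      matOp (braidMatrix q m)⁻¹ (fun x y => h x y e f) a b)) =
    metricTr q (fun a f => metricTr q (fun b e => matOp (braidMatrix q m)⁻¹ (h a b) e f)) := by
  have comm (g : Fin m → Fin m → Fin m → Fin m → M) :
      metricTr q (fun a f => metricTr q (fun b e => g a f b e)) =
      metricTr q (fun b e => metricTr q (fun a f => g a f b e)) := by
    simp only [metricTr, Finset.smul_sum]
    rw [Finset.sum_comm]
    exact Finset.sum_congr rfl fun _ _ => Finset.sum_congr rfl fun _ _ => smul_comm _ _ _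
  have h1 (a f : Fin m) := congrFun (tr23_mat12_inv hq (fun x y e => h x y e f)) a
  have h2 (b e : Fin m) := congrFun (tr12_mat23_inv hq (h b)) e
  simp only [tr12, tr23, mat12_apply, mat23_apply] at h1 h2
  have h3 : metricTr q (fun a f => metricTr q (fun b e =>
      matOp (braidMatrix q m)⁻¹ (fun x y => h x y e f) a b)) =
      metricTr q (fun a f => metricTr q (fun x y =>
        matOp (braidMatrix q m) (fun y' e => h x y' e f) y a)) :=
    congrArg (metricTr q) (funext fun a => funext fun f => h1 a f)
  rw [h3, comm]
  exact congrArg (metricTr q) (funext fun b => funext fun e => (h2 b e).symm)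

/-- By the Leibniz rule the left side is a metric term, which contracts to L(ΔT) = 0, plus a term
with q R⁻¹. The latter slides over to ∂^e ∂^f T, where it acts as the identity because T is
harmonic. -/
theorem derivShift_coordShift (hq : 0 < q) (L : Module.End ℂ (QPoly q m)) {T : QPoly q m}
    (hT : qLaplace q m T = 0) :
    derivShift q m (coordShift q m L) T = coordShift q m (derivShift q m L) T := by
  have hw (e f : Fin m) : (q : ℂ) • matOp (braidMatrix q m)⁻¹
      (fun e f => qPartial q m e (qPartial q m f T)) e f = qPartial q m e (qPartial q m f T) := by
    have := braidInvOp_of_antisym hq (matOp_antisymProj_qPartial hq T) e f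
    rwa [← qLaplace_apply, hT, metricVec_zero_apply, smul_zero, add_zero] at this
  have h1 : metricTr q (fun a f => metricTr q (fun b e =>
      metricVec q m (L (qPartial q m e (qPartial q m f T))) a b)) = 0 := by
    have (a f : Fin m) := metricTr_metricVec_right hq
      (fun e => L (qPartial q m e (qPartial q m f T))) a
    simp only [this]
    rw [← map_metricTr L, ← qLaplace_apply, hT, map_zero]
  have h2 := metricTr_metricTr_inv hq
    (fun a b e f => qCoord q m a * qPartial q m b (L (qPartial q m e (qPartial q m f T))))
  have h3 (a b e f : Fin m) : (q : ℂ) • matOp (braidMatrix q m)⁻¹ (fun e f => qCoord q m a *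
      qPartial q m b (L (qPartial q m e (qPartial q m f T)))) e f =
      qCoord q m a * qPartial q m b (L (qPartial q m e (qPartial q m f T))) := by
    conv_rhs => rw [← hw e f]
    have := matOp_map (LinearMap.mulLeft ℂ (qCoord q m a) ∘ₗ qPartial q m b ∘ₗ L)
      (braidMatrix q m)⁻¹ (fun e f => qPartial q m e (qPartial q m f T)) e f
    simp only [LinearMap.comp_apply, LinearMap.mulLeft_apply] at this
    rw [map_smul, map_smul, mul_smul_comm, this]
  have h4 := congrArg (fun v => (q : ℂ) • v) h2
  simp only [← metricTr_smul, h3] at h4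
  simp only [derivShift_apply, coordShift_apply, map_metricTr, qPartial_coord_mul hq, mul_metricTr,
    leibnizVec, Pi.add_apply, Pi.smul_apply, metricTr_add]
  rw [h1, zero_add]
  exact h4

theorem evalZero_derivShift_pow_coordShift (hq : 0 < q) (j : ℕ) (L : Module.End ℂ (QPoly q m))
    {T : QPoly q m} (hT : qLaplace q m T = 0) :
    evalZero q m ((derivShift q m ^ j) (coordShift q m L) T) = 0 := by
  suffices h : ∀ T, qLaplace q m T = 0 → (derivShift q m ^ j) (coordShift q m L) T =
      coordShift q m ((derivShift q m ^ j) L) T by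
    rw [h T hT, evalZero_coordShift]
  induction j with
  | zero => intro T _; rfl
  | succ j ih =>
    intro T hT
    rw [pow_succ', Module.End.mul_apply, Module.End.mul_apply, ← derivShift_coordShift hq _ hT,
      derivShift_apply, derivShift_apply]
    simp only [fun i => ih _ (qLaplace_qPartial_eq_zero hq hT i)]

theorem qPartial_mem_sphHarmonics (hq : 0 < q) {k : ℕ} {T : QPoly q m}
    (hT : T ∈ sphHarmonics q m (k + 1)) (i : Fin m) : qPartial q m i T ∈ sphHarmonics q m k :=
  ⟨qPartial_mem_homogPoly hq hT.1 i, qLaplace_qPartial_eq_zero hq hT.2 i⟩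

theorem derivShift_pow_congr (hq : 0 < q) {k : ℕ} {L L' : Module.End ℂ (QPoly q m)}
    (hL : ∀ T ∈ sphHarmonics q m k, L T = L' T) (j : ℕ) :
    ∀ T ∈ sphHarmonics q m (k + j), (derivShift q m ^ j) L T = (derivShift q m ^ j) L' T := by
  induction j with
  | zero => exact hL
  | succ j ih =>
    intro T hT
    rw [pow_succ', Module.End.mul_apply, Module.End.mul_apply, derivShift_apply, derivShift_apply]
    simp only [fun i => ih _ (qPartial_mem_sphHarmonics hq hT i)]

theorem euler_of_mem_sphHarmonics (hq : 0 < q) (hq1 : q < 1) {k : ℕ} {T : QPoly q m}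
    (hT : T ∈ sphHarmonics q m k) : euler q m T = qsqNum q k • T := by
  have h := euler_of_mem hq hT.1
  rw [LinearMap.mem_ker.mp hT.2, mul_zero, smul_zero, add_zero] at h
  rw [qsqNum, div_eq_inv_mul, mul_smul, ← h, inv_smul_smul₀ (ne_one_of_lt hq hq1)]

/-- Iterating [k]_{q²} T = x^i C_{ij} ∂^j T peels the coordinates off T; replacing each x^i by ∂^i
yields the operator T(∂). -/
theorem derivShift_pow_of_mem (hq : 0 < q) (hq1 : q < 1) (L : Module.End ℂ (QPoly q m)) {k : ℕ}
    {T : QPoly q m} (hT : T ∈ sphHarmonics q m k) :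
    (derivShift q m ^ k) L T = qsqFac q k • diffOp q m hq T (L 1) := by
  induction k generalizing T with
  | zero =>
    obtain ⟨t, rfl⟩ := mem_homogPoly_zero.mp hT.1
    simp [qsqFac]
  | succ k ih =>
    rw [pow_succ', Module.End.mul_apply, derivShift_apply]
    simp only [fun i => ih (qPartial_mem_sphHarmonics hq hT i), map_smul, metricTr_smul]
    have h := map_metricTr (q := q) ((LinearMap.applyₗ (L 1)) ∘ₗ (diffOp q m hq).toLinearMap)
      (fun i j => qCoord q m i * qPartial q m j T)
    rw [← euler_apply, euler_of_mem_sphHarmonics hq hq1 hT] at h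
    simp only [LinearMap.comp_apply, AlgHom.toLinearMap_apply, LinearMap.applyₗ_apply_apply,
      map_mul, diffOp_coord, Module.End.mul_apply, map_smul, LinearMap.smul_apply] at h
    rw [← h, smul_smul, qsqFac_succ]

theorem diffPairing_normSqElt_mul (hq : 0 < q) (hq1 : q < 1) {k : ℕ} {T : QPoly q m}
    (hT : T ∈ sphHarmonics q m k) (g : QPoly q m) :
    diffPairing q m hq T (normSqElt q m * g) = 0 := by
  -- L must vary: one shift of x²·L gives a coordinate shift, which vanishes at 0, and q² times x²
  -- multiplied by the shift of L.
  have key (j : ℕ) (L : Module.End ℂ (QPoly q m)) : ∀ T, qLaplace q m T = 0 →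
      evalZero q m ((derivShift q m ^ j) (LinearMap.mulLeft ℂ (normSqElt q m) * L) T) = 0 := by
    induction j generalizing L with
    | zero => intro T _; exact evalZero_normSqElt_mul _
    | succ j ih =>
      intro T hT
      have h : derivShift q m (LinearMap.mulLeft ℂ (normSqElt q m) * L) =
          (1 + q * kap q m) • coordShift q m L +
          ((q : ℂ) * q) • (LinearMap.mulLeft ℂ (normSqElt q m) * derivShift q m L) := by
        refine LinearMap.ext fun T => ?_
        simp only [derivShift_apply, Module.End.mul_apply, LinearMap.mulLeft_apply,
          qPartial_normSqElt_mul hq, LinearMap.add_apply, LinearMap.smul_apply, coordShift_apply,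
          mul_metricTr, metricTr_add, metricTr_smul]
      rw [pow_succ, Module.End.mul_apply, h, map_add, map_smul, map_smul, LinearMap.add_apply,
        LinearMap.smul_apply, LinearMap.smul_apply, map_add, map_smul, map_smul,
        evalZero_derivShift_pow_coordShift hq j L hT, ih _ T hT, smul_zero, smul_zero, add_zero]
  have h := key k (LinearMap.mulRight ℂ g) T hT.2
  rw [derivShift_pow_of_mem hq hq1 _ hT, map_smul] at h
  rw [diffPairing_apply]
  simpa [qsqFac_ne_zero hq hq1] using h

theorem qLaplace_qLaplace_pow (b : ℕ) (f : QPoly q m) :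
    qLaplace q m ((qLaplace q m ^ b) f) = (qLaplace q m ^ (b + 1)) f := by
  rw [pow_succ', Module.End.mul_apply]

theorem qLaplace_pow_coord_mul (hq : 0 < q) (hq1 : q < 1) (i : Fin m) (b : ℕ) (f : QPoly q m) :
    (qLaplace q m ^ (b + 1)) (qCoord q m i * f) =
      (((q : ℂ) ^ 2) ^ (b + 1)) • (qCoord q m i * (qLaplace q m ^ (b + 1)) f) +
      ((1 + q * kap q m) * qsqNum q (b + 1)) • qPartial q m i ((qLaplace q m ^ b) f) := by
  have h1 := ne_one_of_lt hq hq1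
  induction b with
  | zero =>
    have h2 : qsqNum q 1 = 1 := by rw [qsqNum, pow_one, div_self h1]
    simp [qLaplace_coord_mul hq, h2]
    module
  | succ b ih =>
    rw [← qLaplace_qLaplace_pow, ih, map_add, map_smul, map_smul, qLaplace_coord_mul hq,
      ← qPartial_qLaplace hq, qLaplace_qLaplace_pow, qLaplace_qLaplace_pow]
    unfold qsqNum
    match_scalars
    · field_simp
      ring
    · ring

/-- Multiplication by `f` followed by a power of the Laplace operator. -/
noncomputable def laplaceMul (b : ℕ) (f : QPoly q m) : Module.End ℂ (QPoly q m) :=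
  qLaplace q m ^ b * LinearMap.mulRight ℂ f

theorem laplaceMul_zero_of_mem (hq : 0 < q) (hq1 : q < 1) (f : QPoly q m) {k : ℕ} {T : QPoly q m}
    (hT : T ∈ sphHarmonics q m k) :
    qsqNum q k • laplaceMul 0 f T = coordShift q m (laplaceMul 0 f) T := by
  rw [← map_smul, ← euler_of_mem_sphHarmonics hq hq1 hT, euler_apply, map_metricTr,
    coordShift_apply]
  simp [laplaceMul, mul_assoc]

theorem laplaceMul_succ_of_mem (hq : 0 < q) (hq1 : q < 1) (b : ℕ) (f : QPoly q m) {k : ℕ}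
    {T : QPoly q m} (hT : T ∈ sphHarmonics q m k) :
    qsqNum q k • laplaceMul (b + 1) f T =
      (((q : ℂ) ^ 2) ^ (b + 1)) • coordShift q m (laplaceMul (b + 1) f) T +
      ((1 + q * kap q m) * qsqNum q (b + 1)) • derivShift q m (laplaceMul b f) T := by
  rw [← map_smul, ← euler_of_mem_sphHarmonics hq hq1 hT, euler_apply, map_metricTr,
    coordShift_apply, derivShift_apply]
  simp only [laplaceMul, Module.End.mul_apply, LinearMap.mulRight_apply, mul_assoc,
    qLaplace_pow_coord_mul hq hq1, metricTr_add, metricTr_smul]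

/-- At 0 the coordinate shift in `laplaceMul_succ_of_mem` disappears, so one Laplacian and one
degree of T are traded for a shift, with factor μ [b]_{q²} / [k]_{q²}. If b = k these factors
multiply to μ^k. If b runs out first, only a coordinate shift is left; if k does, a power of Δ hits
f. -/
theorem evalZero_derivShift_pow_laplaceMul (hq : 0 < q) (hq1 : q < 1) {f : QPoly q m}
    (hf : qLaplace q m f = 0) (k j b : ℕ) {T : QPoly q m} (hT : T ∈ sphHarmonics q m (k + j)) :
    evalZero q m ((derivShift q m ^ j) (laplaceMul b f) T) = if b = k then
      (1 + q * kap q m) ^ k * evalZero q m ((derivShift q m ^ (j + k)) (laplaceMul 0 f) T)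
      else 0 := by
  induction k generalizing j b with
  | zero =>
    rcases b with _ | b
    · simp
    · rw [zero_add] at hT
      rw [derivShift_pow_of_mem hq hq1 _ hT, if_neg (Nat.succ_ne_zero b), laplaceMul,
        Module.End.mul_apply, LinearMap.mulRight_apply, one_mul, pow_succ, Module.End.mul_apply,
        hf, map_zero, map_zero, smul_zero, map_zero]
  | succ k ih =>
    have hk := qsqNum_ne_zero hq hq1 k
    rcases b with _ | b
    · rw [if_neg (Nat.succ_ne_zero k).symm]
      have h := derivShift_pow_congr hq (L := qsqNum q (k + 1) • laplaceMul 0 f)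
        (L' := coordShift q m (laplaceMul 0 f))
        (fun T hT => laplaceMul_zero_of_mem hq hq1 f hT) j T hT
      have h' := congrArg (evalZero q m) h
      rw [map_smul, LinearMap.smul_apply, map_smul,
        evalZero_derivShift_pow_coordShift hq j _ hT.2] at h'
      exact (smul_eq_zero.mp h').resolve_left hk
    · have h := derivShift_pow_congr hq (L := qsqNum q (k + 1) • laplaceMul (b + 1) f)
        (L' := (((q : ℂ) ^ 2) ^ (b + 1)) • coordShift q m (laplaceMul (b + 1) f) +
          ((1 + q * kap q m) * qsqNum q (b + 1)) • derivShift q m (laplaceMul b f))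
        (fun T hT => laplaceMul_succ_of_mem hq hq1 b f hT) j T hT
      have h' := congrArg (evalZero q m) h
      rw [map_smul, map_add, map_smul, map_smul,
        LinearMap.smul_apply, LinearMap.add_apply, LinearMap.smul_apply, LinearMap.smul_apply,
        map_smul, map_add, map_smul, map_smul,
        evalZero_derivShift_pow_coordShift hq j _ hT.2, smul_zero, zero_add,
        ← Module.End.mul_apply (derivShift q m ^ j), ← pow_succ,
        ih (j + 1) b (by rwa [add_comm j 1, ← add_assoc])] at h'
      by_cases hb : b = k
      · subst hb
        rw [if_pos rfl] at h' ⊢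
        simp only [smul_eq_mul] at h'
        rw [show j + (b + 1) = j + 1 + b by ring]
        apply mul_left_cancel₀ hk
        linear_combination h'
      · rw [if_neg hb, smul_zero] at h'
        rw [if_neg (by omega)]
        exact (smul_eq_zero.mp h').resolve_left hk

/-- The functional `f ↦ (Δ^b (T f))(0)` on harmonic polynomials, for a spherical harmonic `T`. -/
theorem evalZero_qLaplace_pow_mul (hq : 0 < q) (hq1 : q < 1) {k : ℕ} {T f : QPoly q m}
    (hT : T ∈ sphHarmonics q m k) (hf : qLaplace q m f = 0) (b : ℕ) :
    evalZero q m ((qLaplace q m ^ b) (T * f)) =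
      if b = k then (1 + q * kap q m) ^ k * qsqFac q k * diffPairing q m hq T f else 0 := by
  have h := evalZero_derivShift_pow_laplaceMul hq hq1 hf k 0 b hT
  rw [zero_add, derivShift_pow_of_mem hq hq1 _ hT] at h
  simpa [laplaceMul, mul_assoc, diffPairing_apply] using h

/-! ### The coefficients of the reproducing kernel -/

theorem qNumber_eq (u : ℝ) : qNumber q u = (1 - q ^ u) / (1 - q) := by
  rw [qNumber, ← neg_div_neg_eq, neg_sub, neg_sub]

theorem qNumber_pos (hq : 0 < q) (hq1 : q < 1) {u : ℝ} (hu : 0 < u) : 0 < qNumber q u :=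
  div_pos_of_neg_of_neg (by linarith [Real.rpow_lt_one hq.le hq1 hu]) (by linarith)

theorem qFactorial_succ (k : ℕ) :
    qFactorial q (k + 1) = qFactorial q k * qNumber q ((k : ℝ) + 1) :=
  Finset.prod_range_succ _ _

theorem qFactorial_pos (hq : 0 < q) (hq1 : q < 1) (k : ℕ) : 0 < qFactorial q k :=
  Finset.prod_pos fun i _ => qNumber_pos hq hq1 (by positivity)

theorem qNumber_sq_cast (k : ℕ) : ((qNumber (q ^ 2) ((k : ℝ) + 1) : ℝ) : ℂ) = qsqNum q (k + 1) := by
  unfold qNumber qsqNum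
  rw [show ((k : ℝ) + 1) = ((k + 1 : ℕ) : ℝ) by push_cast; ring, Real.rpow_natCast]
  push_cast
  rfl

theorem qFactorial_sq_cast (k : ℕ) : ((qFactorial (q ^ 2) k : ℝ) : ℂ) = qsqFac q k := by
  unfold qFactorial qsqFac
  rw [Complex.ofReal_prod]
  exact Finset.prod_congr rfl fun i _ => qNumber_sq_cast i

theorem sq_rpow_half_add (hq : 0 < q) (k : ℕ) :
    (q ^ 2) ^ ((m : ℝ) / 2 + k) = q ^ m * (q ^ 2) ^ k := by
  rw [Real.rpow_add (by positivity), Real.rpow_natCast, ← Real.rpow_natCast q 2,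
    ← Real.rpow_mul hq.le, ← Real.rpow_natCast q m]
  congr 2
  push_cast
  ring

theorem qNumber_sq_half_cast (hq : 0 < q) (k : ℕ) :
    ((qNumber (q ^ 2) ((m : ℝ) / 2 + k) : ℝ) : ℂ) = qsqHalfNum q m k := by
  have hq' : (q : ℂ) ≠ 0 := by exact_mod_cast hq.ne'
  have h : (q : ℂ) * (kap q m)⁻¹ = (q : ℂ) ^ m := by
    rw [kap, ← zpow_neg, ← zpow_one_add₀ hq', ← zpow_natCast]
    congr 1; ring
  unfold qNumber qsqHalfNum
  rw [sq_rpow_half_add hq, h]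
  push_cast
  rfl

theorem gegCoeff_eq (hq : 0 < q) (lam : ℝ) {j : ℕ} (hj : 2 * j ≤ n) :
    gegCoeff q m n lam j =
      (-1) ^ j * q ^ (j * (j - 1)) / (qFactorial (q ^ 2) j * qFactorial q (n - 2 * j)) *
        (qShifted (q ^ (2 * lam)) (q ^ 2) (n - j) / (1 - q ^ 2) ^ (n - j)) *
        muConst q m ^ (n - 2 * j) := by
  have h1 (a : ℝ) (k : ℕ) : ((Polynomial.C a * (Polynomial.C (1 + q) * Polynomial.X) ^ k).comp
      (Polynomial.C (muConst q m / (1 + q)) * Polynomial.X)) =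
      Polynomial.C (a * muConst q m ^ k) * Polynomial.X ^ k := by
    have : (1 + q) * (muConst q m / (1 + q)) = muConst q m := mul_div_cancel₀ _ (by positivity)
    rw [Polynomial.mul_comp, Polynomial.C_comp, Polynomial.pow_comp, Polynomial.mul_comp,
      Polynomial.C_comp, Polynomial.X_comp, ← mul_assoc, ← Polynomial.C_mul, this, mul_pow,
      ← Polynomial.C_pow, ← mul_assoc, ← Polynomial.C_mul]
  unfold gegCoeff qGegenbauer
  rw [Polynomial.sum_comp, Polynomial.finsetSum_coeff,
    Finset.sum_eq_single_of_mem j (Finset.mem_range.mpr (by omega))]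
  · rw [h1, Polynomial.coeff_C_mul, Polynomial.coeff_X_pow, if_pos rfl, mul_one]
  · intro i hi hij
    have := Finset.mem_range.mp hi
    rw [h1, Polynomial.coeff_C_mul, Polynomial.coeff_X_pow, if_neg (by omega), mul_zero]

/-- The recurrence that cancels, in ΔF_n, the term from Δ acting on the generalized power at index j
against the one from Δ acting on x^{2(j+1)}. Here n = r + 2 + 2j. -/
theorem gegCoeff_succ (hq : 0 < q) (hq1 : q < 1) (hm : 2 ≤ m) (j r : ℕ) :
    gegCoeff q m (r + 2 + 2 * j) ((m : ℝ) / 2 - 1) j * (q ^ 2) ^ j *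
        (qNumber q ((r + 1 : ℕ) + 1) * qNumber q ((r : ℝ) + 1)) +
      gegCoeff q m (r + 2 + 2 * j) ((m : ℝ) / 2 - 1) (j + 1) * (muConst q m ^ 2 *
        qNumber (q ^ 2) ((j : ℝ) + 1) * qNumber (q ^ 2) ((m : ℝ) / 2 + (r + j : ℕ))) = 0 := by
  have hQ : (1 - q ^ 2) ≠ 0 := by nlinarith
  have hQ1 : q ^ 2 < 1 := by nlinarith
  have hA : q ^ (2 * ((m : ℝ) / 2 - 1)) = q ^ (m - 2) := by
    rw [← Real.rpow_natCast, Nat.cast_sub hm]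
    congr 1; push_cast; ring
  obtain ⟨p, rfl⟩ := Nat.exists_eq_add_of_le' hm
  have hf1 := (qFactorial_pos (q := q ^ 2) (by positivity) hQ1 j).ne'
  have hf2 := (qFactorial_pos hq hq1 r).ne'
  have hn1 := (qNumber_pos (q := q ^ 2) (by positivity) hQ1 (u := (j : ℝ) + 1) (by positivity)).ne'
  have hn2 := (qNumber_pos hq hq1 (u := (r : ℝ) + 1) (by positivity)).ne'
  have hn3 := (qNumber_pos hq hq1 (u := ((r + 1 : ℕ) : ℝ) + 1) (by positivity)).ne'
  rw [gegCoeff_eq hq _ (by omega), gegCoeff_eq hq _ (by omega), hA,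
    show r + 2 + 2 * j - 2 * j = r + 1 + 1 by omega,
    show r + 2 + 2 * j - 2 * (j + 1) = r by omega,
    show r + 2 + 2 * j - j = r + j + 1 + 1 by omega,
    show r + 2 + 2 * j - (j + 1) = r + j + 1 by omega,
    -- Subtraction is truncated, so j = 0 is treated separately.
    show (j + 1) * (j + 1 - 1) = j * (j - 1) + 2 * j by
      rcases j with _ | j
      · rfl
      · simp only [Nat.add_sub_cancel]; ring,
    qFactorial_succ, qFactorial_succ, qFactorial_succ,
    show qShifted (q ^ (p + 2 - 2)) (q ^ 2) (r + j + 1 + 1) =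
      qShifted (q ^ (p + 2 - 2)) (q ^ 2) (r + j + 1) * (1 - q ^ (p + 2 - 2) * (q ^ 2) ^ (r + j + 1))
      from Finset.prod_range_succ _ _,
    show qNumber (q ^ 2) (((p + 2 : ℕ) : ℝ) / 2 + (r + j : ℕ)) =
      (1 - q ^ (p + 2) * (q ^ 2) ^ (r + j)) / (1 - q ^ 2) by
      rw [qNumber_eq, sq_rpow_half_add hq],
    Nat.add_sub_cancel]
  generalize qNumber (q ^ 2) ((j : ℝ) + 1) = N1 at *
  generalize qNumber q ((r : ℝ) + 1) = N2 at *
  generalize qNumber q (((r + 1 : ℕ) : ℝ) + 1) = N3 at *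
  generalize qFactorial (q ^ 2) j = f1 at *
  generalize qFactorial q r = f2 at *
  generalize qShifted _ _ _ = s
  field_simp
  ring

/-! ### The kernel is harmonic -/

/-- Linearity of the contraction in ψ, needed to move the sum over the metric from y² inside ψ to
the outside. -/
theorem exists_linearMap_contractR_eq {V V' : Type*} [AddCommGroup V] [Module ℂ V] [AddCommGroup V']
    [Module ℂ V'] (u : V ⊗[ℂ] V') :
    ∃ C : (V' →ₗ[ℂ] ℂ) →ₗ[ℂ] V, ∀ ψ, contractR ψ u = C ψ := by
  induction u with
  | zero => exact ⟨0, fun ψ => by simp⟩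
  | tmul v v' => exact ⟨(LinearMap.toSpanSingleton ℂ V v) ∘ₗ LinearMap.applyₗ v', fun ψ => by simp⟩
  | add x y hx hy =>
    obtain ⟨C, hC⟩ := hx
    obtain ⟨D, hD⟩ := hy
    exact ⟨C + D, fun ψ => by rw [map_add, hC, hD, LinearMap.add_apply]⟩

theorem genPower_mem (hq : 0 < q) (hq1 : q < 1) (l : ℕ) (ψ : QPoly q m →ₗ[ℂ] ℂ) :
    contractR ψ (genPower q m l) ∈ homogPoly q m l :=
  contractR_mem ((genPower_spec hq hq1).2.1 l) ψ

theorem qPartial_contractR_genPower (hq : 0 < q) (hq1 : q < 1) (l : ℕ) (ψ : QPoly q m →ₗ[ℂ] ℂ)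
    (j : Fin m) : qPartial q m j (contractR ψ (genPower q m (l + 1))) =
      ((qNumber q ((l : ℝ) + 1) : ℝ) : ℂ) •
        contractR (ψ ∘ₗ LinearMap.mulRight ℂ (qCoord q m j)) (genPower q m l) := by
  rw [← contractR_map, (genPower_spec hq hq1).2.2, map_smul, contractR_sandwich, one_mul]

theorem qLaplace_contractR_genPower (hq : 0 < q) (hq1 : q < 1) (l : ℕ)
    (ψ : QPoly q m →ₗ[ℂ] ℂ) : qLaplace q m (contractR ψ (genPower q m (l + 2))) =
      ((qNumber q ((l + 1 : ℕ) + 1) * qNumber q ((l : ℝ) + 1) : ℝ) : ℂ) •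
        contractR (ψ ∘ₗ LinearMap.mulRight ℂ (normSqElt q m)) (genPower q m l) := by
  obtain ⟨C, hC⟩ := exists_linearMap_contractR_eq (genPower q m l)
  have h : ψ ∘ₗ LinearMap.mulRight ℂ (normSqElt q m) = metricTr q (fun i j =>
      (ψ ∘ₗ LinearMap.mulRight ℂ (qCoord q m j)) ∘ₗ LinearMap.mulRight ℂ (qCoord q m i)) := by
    refine LinearMap.ext fun f => ?_
    have h1 := map_metricTr (q := q) (ψ ∘ₗ LinearMap.mulLeft ℂ f)
      (fun i j => qCoord q m i * qCoord q m j)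
    rw [← normSqElt_eq] at h1
    refine h1.trans ?_
    simp [metricTr, LinearMap.sum_apply, mul_assoc]
  rw [qLaplace_apply]
  simp only [qPartial_contractR_genPower hq hq1, map_smul, metricTr_smul, hC, smul_smul,
    Complex.ofReal_mul]
  rw [h, map_metricTr]

theorem qLaplace_of_mem_zero (hq : 0 < q) {f : QPoly q m} (hf : f ∈ homogPoly q m 0) :
    qLaplace q m f = 0 := by
  obtain ⟨t, rfl⟩ := mem_homogPoly_zero.mp hf
  rw [map_smul, qLaplace_one hq, smul_zero]

theorem qLaplace_of_mem_one (hq : 0 < q) {f : QPoly q m} (hf : f ∈ homogPoly q m 1) :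
    qLaplace q m f = 0 := by
  rw [qLaplace_apply]
  simp only [fun i j => qPartial_of_mem_zero hq i (qPartial_mem_homogPoly hq hf j), metricTr_zero]

theorem contractR_kernelF (ψ : QPoly q m →ₗ[ℂ] ℂ) :
    contractR ψ (kernelF q m n) = ((kernelConst q m n : ℝ) : ℂ) •
      ∑ j ∈ Finset.range (n / 2 + 1), ((gegCoeff q m n ((m : ℝ) / 2 - 1) j : ℝ) : ℂ) •
        (normSqElt q m ^ j * contractR (ψ ∘ₗ LinearMap.mulRight ℂ (normSqElt q m ^ j))
          (genPower q m (n - 2 * j))) := by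
  unfold kernelF
  rw [map_smul, map_sum]
  simp only [map_smul, contractR_sandwich]

theorem qLaplace_contractR_kernelF (hq : 0 < q) (hq1 : q < 1) (hm : 2 ≤ m)
    (ψ : QPoly q m →ₗ[ℂ] ℂ) : qLaplace q m (contractR ψ (kernelF q m n)) = 0 := by
  rw [contractR_kernelF, map_smul, map_sum]
  refine smul_eq_zero_of_right _ ?_
  let e : ℕ → QPoly q m := fun j =>
    contractR (ψ ∘ₗ LinearMap.mulRight ℂ (normSqElt q m ^ j)) (genPower q m (n - 2 * j))
  let c : ℕ → ℂ := fun j => ((gegCoeff q m n ((m : ℝ) / 2 - 1) j : ℝ) : ℂ)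
  -- Telescoping: after the cancellations up to J, only Δ acting on the generalized power of the
  -- last term remains.
  have key (J : ℕ) (hJ : 2 * J ≤ n) :
      ∑ j ∈ Finset.range (J + 1), qLaplace q m (c j • (normSqElt q m ^ j * e j)) =
      (c J * ((q : ℂ) ^ 2) ^ J) • (normSqElt q m ^ J * qLaplace q m (e J)) := by
    induction J with
    | zero => simp
    | succ J ih =>
      obtain ⟨r, rfl⟩ : ∃ r, n = r + 2 + 2 * J := ⟨n - 2 - 2 * J, by omega⟩
      have h1 : qLaplace q m (e J) =
          ((qNumber q ((r + 1 : ℕ) + 1) * qNumber q ((r : ℝ) + 1) : ℝ) : ℂ) • e (J + 1) := by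
        have := qLaplace_contractR_genPower hq hq1 r
          (ψ ∘ₗ LinearMap.mulRight ℂ (normSqElt q m ^ J))
        simp only [e]
        rw [show r + 2 + 2 * J - 2 * J = r + 2 by omega, this,
          show r + 2 + 2 * J - 2 * (J + 1) = r by omega, LinearMap.comp_assoc,
          ← LinearMap.mulRight_mul, ← pow_succ']
      have h2 : e (J + 1) ∈ homogPoly q m r := by
        have := genPower_mem hq hq1 r (ψ ∘ₗ LinearMap.mulRight ℂ (normSqElt q m ^ (J + 1)))
        simp only [e]
        rwa [show r + 2 + 2 * J - 2 * (J + 1) = r by omega]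
      have h3 := congrArg Complex.ofReal (gegCoeff_succ (m := m) hq hq1 hm J r)
      rw [Finset.sum_range_succ, ih (by omega), map_smul, qLaplace_normSqElt_pow_mul hq hq1 h2, h1,
        mul_smul_comm]
      simp only [Complex.ofReal_add, Complex.ofReal_mul, Complex.ofReal_pow, muConst_cast hq,
        qNumber_sq_half_cast hq, qNumber_sq_cast, Complex.ofReal_zero] at h3 ⊢
      linear_combination (norm := module) congrArg (fun t => t • (normSqElt q m ^ J * e (J + 1))) h3
  rw [key (n / 2) (by omega)]
  have h4 : e (n / 2) ∈ homogPoly q m (n - 2 * (n / 2)) := genPower_mem hq hq1 _ _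
  -- The last generalized power has degree 0 or 1 in x.
  have h5 : qLaplace q m (e (n / 2)) = 0 := by
    rcases Nat.mod_two_eq_zero_or_one n with h | h
    · exact qLaplace_of_mem_zero hq (by rwa [show n - 2 * (n / 2) = 0 by omega] at h4)
    · exact qLaplace_of_mem_one hq (by rwa [show n - 2 * (n / 2) = 1 by omega] at h4)
  rw [h5, mul_zero, smul_zero]

theorem contractR_kernelF_mem (hq : 0 < q) (hq1 : q < 1) (hm : 2 ≤ m) (ψ : QPoly q m →ₗ[ℂ] ℂ) :
    contractR ψ (kernelF q m n) ∈ sphHarmonics q m n := by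
  refine ⟨?_, qLaplace_contractR_kernelF hq hq1 hm ψ⟩
  rw [contractR_kernelF]
  refine Submodule.smul_mem _ _ (Submodule.sum_mem _ fun j hj => Submodule.smul_mem _ _ ?_)
  have h := homogPoly_mul_mem (normSqElt_pow_mem_homogPoly j)
    (genPower_mem hq hq1 (n - 2 * j) (ψ ∘ₗ LinearMap.mulRight ℂ (normSqElt q m ^ j)))
  have := Finset.mem_range.mp hj
  rwa [show 2 * j + (n - 2 * j) = n by omega] at h

/-! ### The `q`-Gamma function -/

theorem summable_qShifted (hq : 0 < q) (hq1 : q < 1) (u : ℝ) :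
    Summable fun i : ℕ => ‖-(u * q ^ i)‖ := by
  simp only [norm_neg, norm_mul, norm_pow]
  refine (summable_geometric_of_lt_one (norm_nonneg q) ?_).mul_left _
  rwa [Real.norm_of_nonneg hq.le]

theorem qShiftedInf_eq (hq : 0 < q) (hq1 : q < 1) (u : ℝ) :
    qShiftedInf u q = (1 - u) * qShiftedInf (u * q) q := by
  have h := multipliable_one_add_of_summable (summable_qShifted hq hq1 (u * q))
  unfold qShiftedInf
  rw [tprod_eq_zero_mul' (f := fun i => 1 - u * q ^ i)]
  · simp only [pow_zero, mul_one, pow_succ']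
    simp only [mul_assoc]
  · simpa only [pow_succ', mul_assoc, sub_eq_add_neg] using h

theorem qShiftedInf_ne_zero (hq : 0 < q) (hq1 : q < 1) {u : ℝ} (hu : u < 1) :
    qShiftedInf u q ≠ 0 := by
  have h := tprod_one_add_ne_zero_of_summable (f := fun i : ℕ => -(u * q ^ i)) (fun i => ?_)
    (summable_qShifted hq hq1 u)
  · simpa only [qShiftedInf, sub_eq_add_neg] using h
  · have h1 : q ^ i ≤ 1 := pow_le_one₀ hq.le hq1.le
    have h2 : 0 < q ^ i := pow_pos hq i
    nlinarith

theorem qGamma_ne_zero (hq : 0 < q) (hq1 : q < 1) {t : ℝ} (ht : 0 < t) : qGamma q t ≠ 0 :=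
  mul_ne_zero (div_ne_zero (qShiftedInf_ne_zero hq hq1 hq1)
    (qShiftedInf_ne_zero hq hq1 (Real.rpow_lt_one hq.le hq1 ht)))
    (Real.rpow_pos_of_pos (by linarith) _).ne'

theorem qGamma_add_one (hq : 0 < q) (hq1 : q < 1) {t : ℝ} (ht : 0 < t) :
    qGamma q (t + 1) = qNumber q t * qGamma q t := by
  have h1 : 0 < 1 - q := by linarith
  have h2 : q ^ t < 1 := Real.rpow_lt_one hq.le hq1 ht
  have h3 : q ^ (t + 1) < 1 := Real.rpow_lt_one hq.le hq1 (by linarith)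
  have h4 := qShiftedInf_ne_zero hq hq1 h3
  have h5 : (1 - q) ^ (1 - t) = (1 - q) ^ (1 - (t + 1)) * (1 - q) := by
    rw [← Real.rpow_add_one h1.ne']
    congr 1; ring
  have h6 : 1 - q ^ t ≠ 0 := by linarith
  unfold qGamma
  rw [qShiftedInf_eq hq hq1 (q ^ t), ← Real.rpow_add_one hq.ne', h5, qNumber_eq]
  field_simp

theorem qGamma_add_nat (hq : 0 < q) (hq1 : q < 1) {t : ℝ} (ht : 0 < t) (k : ℕ) :
    qGamma q (t + k) = (∏ i ∈ Finset.range k, qNumber q (t + i)) * qGamma q t := by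
  induction k with
  | zero => simp
  | succ k ih =>
    rw [Nat.cast_succ, ← add_assoc, qGamma_add_one hq hq1 (by positivity), ih,
      Finset.prod_range_succ]
    ring

theorem qShifted_div_pow (hq : 0 < q) (t : ℝ) (k : ℕ) :
    qShifted (q ^ t) q k / (1 - q) ^ k = ∏ i ∈ Finset.range k, qNumber q (t + i) := by
  rw [qShifted, Finset.pow_eq_prod_const, ← Finset.prod_div_distrib]
  refine Finset.prod_congr rfl fun i _ => ?_
  rw [qNumber_eq, Real.rpow_add hq, Real.rpow_natCast]

/-! ### The integral over the quantum sphere -/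

/-- A tensor whose contractions lie in W sees only the restriction of a functional to W. Functionals
on 𝒫 can thus be exchanged when they agree on harmonic polynomials. -/
theorem contractL_congr {V V' : Type*} [AddCommGroup V] [Module ℂ V] [AddCommGroup V']
    [Module ℂ V'] {W : Submodule ℂ V} {u : V ⊗[ℂ] V'} (hu : ∀ ψ, contractR ψ u ∈ W)
    {φ φ' : V →ₗ[ℂ] ℂ} (h : ∀ w ∈ W, φ w = φ' w) : contractL φ u = contractL φ' u := by
  rw [← sub_eq_zero, ← Module.forall_dual_apply_eq_zero_iff ℂ]
  intro ψ
  rw [map_sub, ← apply_contractR, ← apply_contractR, h _ (hu ψ), sub_self]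

theorem contractL_smul_left {V V' : Type*} [AddCommGroup V] [Module ℂ V] [AddCommGroup V']
    [Module ℂ V'] (t : ℂ) (φ : V →ₗ[ℂ] ℂ) (u : V ⊗[ℂ] V') :
    contractL (t • φ) u = t • contractL φ u := by
  induction u with
  | zero => simp
  | tmul v v' => simp [mul_smul]
  | add x y hx hy => simp [hx, hy]

theorem homogPoly_succ_le' {k : ℕ} {S : Submodule ℂ (QPoly q m)}
    (h : ∀ i, ∀ f ∈ homogPoly q m k, f * qCoord q m i ∈ S) : homogPoly q m (k + 1) ≤ S := by
  rw [homogPoly, pow_succ, Submodule.mul_le]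
  intro f hf a ha
  induction ha using Submodule.span_induction with
  | mem x hx => obtain ⟨i, rfl⟩ := hx; exact h i f hf
  | zero => rw [mul_zero]; exact S.zero_mem
  | add x y _ _ hx hy => rw [mul_add]; exact S.add_mem hx hy
  | smul t x _ hx => rw [mul_smul_comm]; exact S.smul_mem t hx

theorem diffPairing_of_ne (hq : 0 < q) {k l : ℕ} (hkl : k ≠ l) {h f : QPoly q m}
    (hh : h ∈ homogPoly q m k) (hf : f ∈ homogPoly q m l) : diffPairing q m hq h f = 0 := by
  induction k generalizing l f h with
  | zero =>
    obtain ⟨t, rfl⟩ := mem_homogPoly_zero.mp hh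
    obtain ⟨l, rfl⟩ := Nat.exists_eq_succ_of_ne_zero hkl.symm
    simp [diffPairing_apply, evalZero_of_mem_succ hf]
  | succ k ih =>
    suffices hle : homogPoly q m (k + 1) ≤ LinearMap.ker ((diffPairing q m hq).flip f) from hle hh
    refine homogPoly_succ_le' fun i g hg => ?_
    rw [LinearMap.mem_ker, LinearMap.flip_apply, diffPairing_mul_coord, LinearMap.comp_apply]
    rcases l with _ | l
    · rw [qPartial_of_mem_zero hq i hf, map_zero]
    · exact ih (by omega) hg (qPartial_mem_homogPoly hq hf i)

/-- The coefficients of the Pizzetti formula. -/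
noncomputable def pizzettiCoeff (q : ℝ) (m k : ℕ) : ℝ :=
  2 * qGamma (q ^ 2) (1 / 2) ^ m /
    (muConst q m ^ (2 * k) * qFactorial (q ^ 2) k * qGamma (q ^ 2) ((k : ℝ) + (m : ℝ) / 2))

theorem sphereIntegralX_eq (T : QPoly q m ⊗[ℂ] QPoly q m) :
    sphereIntegralX q m T = ∑ᶠ k : ℕ, ((pizzettiCoeff q m k : ℝ) : ℂ) •
      contractL ((evalZero q m).toLinearMap ∘ₗ (qLaplace q m ^ k)) T := rfl

theorem sphereIntegralX_sandwich (hq : 0 < q) (hq1 : q < 1) {k : ℕ} {S : QPoly q m}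
    (hS : S ∈ sphHarmonics q m k) {T : QPoly q m ⊗[ℂ] QPoly q m}
    (hT : ∀ ψ, contractR ψ T ∈ sphHarmonics q m n) :
    sphereIntegralX q m (sandwich q m S 1 T) =
      ((pizzettiCoeff q m k * (muConst q m ^ k * qFactorial (q ^ 2) k) : ℝ) : ℂ) •
        contractL (diffPairing q m hq S) T := by
  have h (b : ℕ) : contractL ((evalZero q m).toLinearMap ∘ₗ (qLaplace q m ^ b))
      (sandwich q m S 1 T) = if b = k then
        ((muConst q m ^ k * qFactorial (q ^ 2) k : ℝ) : ℂ) • contractL (diffPairing q m hq S) T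
        else 0 := by
    rw [contractL_sandwich, mul_one]
    have h1 := contractL_congr hT (φ := ((evalZero q m).toLinearMap ∘ₗ (qLaplace q m ^ b)) ∘ₗ
      LinearMap.mulLeft ℂ S) (φ' := (if b = k then
        ((muConst q m ^ k * qFactorial (q ^ 2) k : ℝ) : ℂ) else 0) • diffPairing q m hq S)
      (fun f hf => by
        refine (evalZero_qLaplace_pow_mul hq hq1 hS hf.2 b).trans ?_
        rw [LinearMap.smul_apply, Complex.ofReal_mul, Complex.ofReal_pow, muConst_cast hq,
          qFactorial_sq_cast]
        split_ifs <;> simp)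
    rw [h1]
    refine (contractL_smul_left _ _ _).trans ?_
    split_ifs
    · rfl
    · exact zero_smul _ _
  rw [sphereIntegralX_eq, finsum_eq_single _ k (fun b hb => by rw [h, if_neg hb, smul_zero]), h,
    if_pos rfl, smul_smul, Complex.ofReal_mul (pizzettiCoeff q m k)]

theorem contractL_kernelF_of_ne (hq : 0 < q) (hq1 : q < 1) (hm : 2 ≤ m) {k : ℕ} (hk : k ≠ n)
    {S : QPoly q m} (hS : S ∈ sphHarmonics q m k) :
    contractL (diffPairing q m hq S) (kernelF q m n) = 0 := by
  have h := contractL_congr (contractR_kernelF_mem (n := n) hq hq1 hm)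
    (φ := diffPairing q m hq S) (φ' := (0 : ℂ) • diffPairing q m hq S) (fun f hf => by
      rw [zero_smul, diffPairing_of_ne hq hk hS.1 hf.1, LinearMap.zero_apply])
  rw [h, contractL_smul_left, zero_smul]

theorem contractL_kernelF (hq : 0 < q) (hq1 : q < 1) {S : QPoly q m}
    (hS : S ∈ sphHarmonics q m n) :
    contractL (diffPairing q m hq S) (kernelF q m n) =
      ((kernelConst q m n * (gegCoeff q m n ((m : ℝ) / 2 - 1) 0 * qFactorial q n) : ℝ) : ℂ) • S := by
  unfold kernelF
  rw [map_smul, map_sum, Finset.sum_eq_single_of_mem 0 (by simp)]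
  · rw [map_smul, contractL_sandwich, pow_zero, LinearMap.mulLeft_one, LinearMap.comp_id, mul_one,
      mul_zero, Nat.sub_zero, contractL_genPower hq hq1 hS.1, smul_smul, smul_smul]
    push_cast
    rw [mul_assoc]
  · intro j _ hj
    obtain ⟨i, rfl⟩ := Nat.exists_eq_succ_of_ne_zero hj
    have h : diffPairing q m hq S ∘ₗ LinearMap.mulLeft ℂ (normSqElt q m ^ (i + 1)) =
        (0 : ℂ) • diffPairing q m hq S := by
      refine LinearMap.ext fun f => ?_
      rw [LinearMap.comp_apply, LinearMap.mulLeft_apply, pow_succ', mul_assoc,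
        diffPairing_normSqElt_mul hq hq1 hS, zero_smul, LinearMap.zero_apply]
    rw [map_smul, contractL_sandwich, Nat.succ_eq_add_one, h, contractL_smul_left, zero_smul,
      zero_mul, smul_zero]

/-- Powers of μ and factorials cancel; what remains is Γ_{q²}(m/2 + k) obtained from Γ_{q²}(m/2 - 1)
by k + 1 steps of the functional equation. The first k steps form the shifted factorial of the
Gegenbauer coefficient, the last is the q-number in C_k. Positivity of m/2 - 1 requires m ≥ 3. -/
theorem pizzettiCoeff_mul_kernelConst (hq : 0 < q) (hq1 : q < 1) (hm : 3 ≤ m) (k : ℕ) :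
    pizzettiCoeff q m k * (muConst q m ^ k * qFactorial (q ^ 2) k) *
      (kernelConst q m k * (gegCoeff q m k ((m : ℝ) / 2 - 1) 0 * qFactorial q k)) = 1 := by
  have hQ : 0 < q ^ 2 := by positivity
  have hQ1 : q ^ 2 < 1 := by nlinarith
  have hm' : (3 : ℝ) ≤ m := by exact_mod_cast hm
  have ht : 0 < (m : ℝ) / 2 - 1 := by linarith
  have h1 := qGamma_ne_zero hQ hQ1 (t := 1 / 2) (by norm_num)
  have h2 := qGamma_ne_zero hQ hQ1 (t := (k : ℝ) + (m : ℝ) / 2) (by positivity)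
  have h3 := (muConst_pos (m := m) hq).ne'
  have h4 := (qFactorial_pos hQ hQ1 k).ne'
  have h5 := (qFactorial_pos hq hq1 k).ne'
  have h6 := qGamma_add_nat hQ hQ1 ht (k + 1)
  have h7 := qShifted_div_pow hQ ((m : ℝ) / 2 - 1) k
  have h8 : q ^ (2 * ((m : ℝ) / 2 - 1)) = (q ^ 2) ^ ((m : ℝ) / 2 - 1) := by
    rw [Real.rpow_mul hq.le, Real.rpow_two]
  rw [show (m : ℝ) / 2 - 1 + ((k + 1 : ℕ) : ℝ) = (k : ℝ) + (m : ℝ) / 2 by push_cast; ring,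
    Finset.prod_range_succ, ← h7,
    show (m : ℝ) / 2 - 1 + (k : ℝ) = (m : ℝ) / 2 + k - 1 by ring] at h6
  have h9 : qFactorial (q ^ 2) 0 = 1 := rfl
  rw [gegCoeff_eq hq _ (Nat.zero_le _), h8, h9, Nat.sub_zero, zero_mul,
    pow_zero, pow_zero, one_mul, one_mul, one_div]
  unfold pizzettiCoeff kernelConst
  have h10 : qGamma (q ^ 2) (1 / 2) ^ m ≠ 0 := pow_ne_zero _ h1
  rw [two_mul k, pow_add]
  have h11 := pow_ne_zero k h3
  calc _ = qShifted ((q ^ 2) ^ ((m : ℝ) / 2 - 1)) (q ^ 2) k / (1 - q ^ 2) ^ k *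
        qNumber (q ^ 2) ((m : ℝ) / 2 + k - 1) * qGamma (q ^ 2) ((m : ℝ) / 2 - 1) /
        qGamma (q ^ 2) ((k : ℝ) + (m : ℝ) / 2) := by
        generalize qShifted _ _ _ / _ = s
        field_simp
    _ = 1 := by rw [← h6, div_self h2]

/-- F is only known to lie in W in its left factor. Reproduction makes the pairing nondegenerate on
W, so the dual-basis tensor in W ⊗ W reproduces as well; reproducing tensors with left contractions
in W are unique, hence F is that tensor. -/
theorem mem_and_unique_of_reproducing {V : Type*} [AddCommGroup V] [Module ℂ V]
    {W : Submodule ℂ V} [FiniteDimensional ℂ W] {P : V →ₗ[ℂ] V →ₗ[ℂ] ℂ} {F : V ⊗[ℂ] V} {t : ℂ}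
    (hF : ∀ ψ, contractR ψ F ∈ W) (h : ∀ S ∈ W, t • contractL (P S) F = S) {T : V ⊗[ℂ] V}
    (hT : ∀ ψ, contractR ψ T ∈ W) (hT' : ∀ S ∈ W, t • contractL (P S) T = S) (ht : t ≠ 0) :
    F ∈ LinearMap.range (TensorProduct.mapIncl W W) ∧ T = F := by
  let B : W →ₗ[ℂ] (W →ₗ[ℂ] ℂ) := P.domRestrict₁₂ W W
  have hB : Function.Injective B := by
    intro f f' hf
    -- Functionals equal on W have the same contraction with F, and this contraction recovers f and
    -- f' up to the factor t.
    have h1 : contractL (P f) F = contractL (P f') F := contractL_congr hF fun w hw =>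
      LinearMap.congr_fun hf (⟨w, hw⟩ : W)
    exact Subtype.ext (by rw [← h f f.2, ← h f' f'.2, h1])
  obtain ⟨ι, _, b, c, hbc⟩ := exists_dual_family B hB
  have huniq {u u' : V ⊗[ℂ] V} (hu : ∀ ψ, contractR ψ u ∈ W) (hu' : ∀ ψ, contractR ψ u' ∈ W)
      (huu : ∀ S ∈ W, t • contractL (P S) u = t • contractL (P S) u') : u = u' := by
    rw [← sub_eq_zero]
    refine eq_zero_of_contractR fun ψ => ?_
    have hmem : contractR ψ (u - u') ∈ W := by rw [map_sub]; exact W.sub_mem (hu ψ) (hu' ψ)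
    have h2 (S : W) : B S ⟨_, hmem⟩ = 0 := by
      change P S (contractR ψ (u - u')) = 0
      rw [apply_contractR, map_sub, smul_right_injective _ ht (huu S S.2), sub_self, map_zero]
    have h3 := (hbc ⟨_, hmem⟩).2
    simp only [h2, zero_smul, Finset.sum_const_zero] at h3
    exact (congrArg Subtype.val h3).symm
  refine ⟨?_, huniq hT hF fun S hS => by rw [h S hS, hT' S hS]⟩
  have hmem : (∑ i, (t⁻¹ • (b i : V)) ⊗ₜ[ℂ] (c i : V)) ∈
      LinearMap.range (TensorProduct.mapIncl W W) :=
    Submodule.sum_mem _ fun i _ => ⟨(t⁻¹ • b i) ⊗ₜ c i, rfl⟩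
  rw [huniq hF (contractR_mem hmem) fun S hS => ?_]
  · exact hmem
  · have h4 := congrArg Subtype.val (hbc ⟨S, hS⟩).1
    rw [AddSubmonoidClass.coe_finsetSum] at h4
    rw [h S hS]
    simp only [map_sum, contractL_tmul, map_smul, smul_assoc, ← Finset.smul_sum]
    rw [smul_inv_smul₀ ht]
    exact h4.symm

instance finiteDimensional_sphHarmonics (k : ℕ) : FiniteDimensional ℂ (sphHarmonics q m k) :=
  Submodule.finiteDimensional_of_le (inf_le_left : sphHarmonics q m k ≤ homogPoly q m k)

theorem sphereIntegralX_kernelF (hq : 0 < q) (hq1 : q < 1) (hm : 3 ≤ m) {k : ℕ} {S : QPoly q m}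
    (hS : S ∈ sphHarmonics q m k) :
    sphereIntegralX q m (sandwich q m S 1 (kernelF q m n)) = if k = n then S else 0 := by
  rw [sphereIntegralX_sandwich hq hq1 hS (contractR_kernelF_mem hq hq1 (by omega))]
  split_ifs with h
  · subst h
    rw [contractL_kernelF hq hq1 hS, smul_smul, ← Complex.ofReal_mul,
      pizzettiCoeff_mul_kernelConst hq hq1 hm, Complex.ofReal_one, one_smul]
  · rw [contractL_kernelF_of_ne hq hq1 (by omega) h hS, smul_zero]

theorem kernelF_reproducing (hq : 0 < q) (hq1 : q < 1) (hm : 3 ≤ m) {k : ℕ}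
    {T : QPoly q m ⊗[ℂ] QPoly q m} (hT : ∀ ψ, contractR ψ T ∈ sphHarmonics q m k)
    (h : ∀ S ∈ sphHarmonics q m k, sphereIntegralX q m (sandwich q m S 1 T) = S) :
    kernelF q m k ∈
      LinearMap.range (TensorProduct.mapIncl (sphHarmonics q m k) (sphHarmonics q m k)) ∧
      T = kernelF q m k := by
  have hF := contractR_kernelF_mem (n := k) hq hq1 (show 2 ≤ m by omega)
  refine mem_and_unique_of_reproducing (P := diffPairing q m hq) (t :=
    ((pizzettiCoeff q m k * (muConst q m ^ k * qFactorial (q ^ 2) k) : ℝ) : ℂ)) hF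
    (fun S hS => ?_) hT (fun S hS => ?_) ?_
  · rw [← sphereIntegralX_sandwich hq hq1 hS hF, sphereIntegralX_kernelF hq hq1 hm hS, if_pos rfl]
  · rw [← sphereIntegralX_sandwich hq hq1 hS hT, h S hS]
  · exact_mod_cast left_ne_zero_of_mul_eq_one (pizzettiCoeff_mul_kernelConst hq hq1 hm k)

end QEuclid


theorem mainTheorem9 (q : ℝ) (hq0 : 0 < q) (hq1 : q < 1) (m : ℕ) (hm : 3 ≤ m) :
    -- the partial derivatives and the generalized powers are well defined
    (∃! d, IsPartials q m d) ∧ (∃! G, IsGenPower q m G) ∧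
    -- the integral formula
    (∀ n k : ℕ, ∀ S ∈ sphHarmonics q m k,
      sphereIntegralX q m (sandwich q m S 1 (kernelF q m n)) = if k = n then S else 0) ∧
    -- `F_k` is the reproducing kernel of the spherical harmonics of degree `k`
    (∀ k : ℕ,
      kernelF q m k ∈
        LinearMap.range (TensorProduct.mapIncl (sphHarmonics q m k) (sphHarmonics q m k)) ∧
      ∀ T ∈ LinearMap.range (TensorProduct.mapIncl (sphHarmonics q m k) (sphHarmonics q m k)),
        (∀ S ∈ sphHarmonics q m k, sphereIntegralX q m (sandwich q m S 1 T) = S) →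
          T = kernelF q m k) := by
  have hF (k : ℕ) (S) (hS : S ∈ sphHarmonics q m k) :
      sphereIntegralX q m (sandwich q m S 1 (kernelF q m k)) = S := by
    rw [QEuclid.sphereIntegralX_kernelF hq0 hq1 hm hS, if_pos rfl]
  refine ⟨QEuclid.existsUnique_isPartials hq0, QEuclid.existsUnique_isGenPower hq0 hq1,
    fun n k S hS => QEuclid.sphereIntegralX_kernelF hq0 hq1 hm hS, fun k => ⟨?_, fun T hT h => ?_⟩⟩
  · exact (QEuclid.kernelF_reproducing hq0 hq1 hm
      (QEuclid.contractR_kernelF_mem hq0 hq1 (by omega)) (hF k)).1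
  · exact (QEuclid.kernelF_reproducing hq0 hq1 hm (QEuclid.contractR_mem hT) h).2
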